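/- **Setting.** Let $\Omega\subset\mathbb R^d$ be open and nonempty, $Q=\Omega\times(0,1)$, and let $\zeta_1,\dots,\zeta_r$ be orthonormal in $L^2(\Omega)$; $\mathbb P_r$, $\mathbb P_{r,r}$ are the orthogonal projections of $L^2(\Omega)$, $L^2(\Omega^2)$ onto $\mathrm{span}\{\zeta_i\}$, $\mathrm{span}\{\zeta_i\otimes\zeta_j\}$. Let $K,S\in L^2(\Omega^2)$, $K_r=\mathbb P_{r,r}K$, $S_r=\mathbb P_{r,r}S$, and assume that the matrices $\mathbf K=(\int K\zeta_p\otimes\zeta_q)_{p,q}$, $\mathbf S=(\int S\zeta_p\otimes\zeta_q)_{p,q}$ are invertible. Let $\rho_0\in L^2(\Omega)$. The Hamiltonian $H(t,x,p)$ is measurable in $(t,x)$, convex and differentiable in $p$, with $H(\cdot,\cdot,0)\in L^2(Q)$, and $L(t,x,v)=\sup_p(-v\cdot p-H(t,x,p))$. The couplings $f_0,f_1(t,x,z)$ and $g_0,g_1(x,z)$ are measurable in $(t,x)$ (resp. $x$), continuous and nondecreasing in $z$, with $f_0(\cdot,\cdot,0)\in L^2(Q)$, $g_0(\cdot,0)\in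 L^2(\Omega)$, and such that $f_1(t,x,\sum_p c_p(t)\zeta_p(x))\in L^2(Q)$ for all $c\in L^2((0,1);\mathbb R^r)$ and $g_1(x,\sum_p w_p\zeta_p(x))\in L^2(\Omega)$ for all $w\in\mathbb R^r$. **Spaces and operators.** $s=(a,b,\alpha,\beta,\phi)$ ranges over $\mathcal H=L^2((0,1);\mathbb R^r)\times\mathbb R^r\times L^2(Q)\times L^2(\Omega)\times H^1(Q)$, where $\langle\phi,h\rangle_{H^1}=\int_\Omega\phi(x,0)h(x,0)dx+\int_\Omega\phi(x,1)h(x,1)dx+\int_Q\nabla_{t,x}\phi\cdot\nabla_{t,x}h$, and $q=(\rho,m,\rho(\cdot,0),\rho(\cdot,1))$ over $\mathcal G=L^2(Q)\times L^2(Q;\mathbb R^d)\times L^2(\Omega)\times L^2(\Omega)$. The bounded linear operator $C:\mathcal H\to\mathcal G$ is $$Cs=\Big(-\sum_i a_i\zeta_i-\alpha-\phi_t,\ -\nabla\phi,\ -\phi(\cdot,0),\ -\sum_i b_i\zeta_i-\beta+\phi(\cdot,1)\Big),$$ with Hilbert adjoint $C^*$. On $\mathcal G$ let $$\Xi(q)=\int_Q\rho\,L(t,x,m/\rho)\,dx\,dt+\mathbf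 1_{\rho(\cdot,0)=\rho_0}+\mathbf 1_{\rho\ge0}+\mathbf 1_{m\ll\rho},\qquad N=\partial\Xi^*,$$ where $\mathbf 1$ is $0$ or $+\infty$. With $F_i,G_i$ the primitives in $z$ of $f_i,g_i$ vanishing at $z=0$, let $U_0(\rho)=\int_QF_0(t,x,\rho)$, $V_0(\mu)=\int_\Omega G_0(x,\mu)$, $U_1(c)=\int_QF_1(t,x,\sum_pc_p\zeta_p)$, $V_1(w)=\int_\Omega G_1(x,\sum_pw_p\zeta_p)$, and $$M(a,b,\alpha,\beta,\phi)=\big(\mathbf K^{-1}\partial U_1^*(a),\ \mathbf S^{-1}\partial V_1^*(b),\ \partial U_0^*(\alpha),\ \partial V_0^*(\beta),\ 0\big).$$ **Systems.** The projected mean field game system, for $\phi\in H^1(Q)$, $\rho\in L^2(Q)$, $\rho\ge0$, with end values $\rho(\cdot,0),\rho(\cdot,1)\in L^2(\Omega)$ and with $f_0(t,x,\rho),\ \rho\nabla_pH(t,x,\nabla\phi)\in L^2(Q)$, is $$\begin{cases}-\phi_t+H(t,x,\nabla\phi)=f_0(t,x,\rho)+\mathbb P_r\big(f_1(t,\cdot,\int_\Omega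 K_r(\cdot,y)\rho(y,t)dy)\big)(x),\\ \rho_t-\nabla\cdot(\rho\nabla_pH(t,x,\nabla\phi))=0,\\ \rho(\cdot,0)=\rho_0,\quad\phi(x,1)=g_0(x,\rho(x,1))+\mathbb P_r\big(g_1(\cdot,\int_\Omega S_r(\cdot,y)\rho(y,1)dy)\big)(x).\end{cases}\tag{1}$$ The coefficient system, for $s\in\mathcal H$ and $q\in\mathcal G$ with $\rho\ge0$, is $$\begin{cases}-\phi_t+H(t,x,\nabla\phi)=\alpha+\sum_ia_i(t)\zeta_i(x),\quad m=-\rho\nabla_pH(t,x,\nabla\phi),\\ \rho(\cdot,0)=\rho_0,\quad\phi(x,1)=\beta(x)+\sum_ib_i\zeta_i(x),\end{cases}\tag{2}$$ and the compatibility conditions are $$\begin{cases}a_i(t)=\int_\Omega f_1\big(t,x,\int_\Omega K_r(x,y)\rho(y,t)dy\big)\zeta_i(x)dx,\quad b_i=\int_\Omega g_1\big(x,\int_\Omega S_r(x,y)\rho(y,1)dy\big)\zeta_i(x)dx\quad\forall i,\\ \alpha=f_0(t,x,\rho),\quad\beta=g_0(x,\rho(x,1)),\quad\rho_t+\nabla\cdot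 m=0.\end{cases}\tag{3}$$ Equations hold almost everywhere; the continuity equation is understood weakly, with the given end values and no flux through $\partial\Omega$: $\int_Q(\psi_t\rho+\nabla\psi\cdot m)=\int_\Omega\psi(x,1)\rho(x,1)dx-\int_\Omega\psi(x,0)\rho(x,0)dx$ for all $\psi\in H^1(Q)$. We say that (1) or (2) holds *up to vacuum* if the Hamilton–Jacobi equation is replaced by: "$\le$" a.e. in $Q$, with equality a.e. on $\{\rho>0\}$. When $\rho>0$ a.e., this is the system itself. **Theorem.** 1. $(\phi,\rho)$, with end values $\rho(\cdot,0),\rho(\cdot,1)$, solves (1) if and only if there are $a,b,\alpha,\beta,m$ such that (2) and (3) hold; the same is true with (1) and (2) understood up to vacuum. 2. $(s,q)$ satisfies (2) up to vacuum and (3) if and only if $$q\in N(Cs),\qquad -C^*q\in Ms.\tag{D}$$ In particular (2)–(3) imply (D), and if $\rho>0$ a.e. then (2)–(3) are equivalent to (D). 3. For every $s$, the primal inclusion $0\in Ms+C^*(N(Cs))$ (P) holds if and only if (D) holds for some $q\in\mathcal G$. 4. $N$ is maximally monotone and $C\ne0$. If $c\mapsto(\partial U_1)(\mathbf Kc)$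 on $L^2((0,1);\mathbb R^r)$ and $w\mapsto(\partial V_1)(\mathbf Sw)$ on $\mathbb R^r$ are maximally monotone, then $M$ is maximally monotone, so that (P)–(D) is a primal-dual pair of monotone inclusions. -/

import Mathlib

open MeasureTheory Set
open scoped Pointwise ContDiff

namespace MFG

noncomputable section

/-- Euclidean space `ℝᵈ`. -/
abbrev Vec (d : ℕ) : Type := EuclideanSpace ℝ (Fin d)

/-- Lebesgue measure on the time interval `(0,1)`. -/
abbrev timeMeasure : Measure ℝ := volume.restrict (Ioo (0 : ℝ) 1)

/-- Lebesgue measure on `Ω`. -/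
abbrev spaceMeasure {d : ℕ} (Ω : Set (Vec d)) : Measure (Vec d) := volume.restrict Ω

/-- Lebesgue measure on `Ω × (0,1)`; its points are `w = (x, t)`. -/
abbrev cylMeasure {d : ℕ} (Ω : Set (Vec d)) : Measure (Vec d × ℝ) :=
  (spaceMeasure Ω).prod timeMeasure

/-- The Hilbert space `L²(Ω × (0,1)) × L²(Ω × (0,1); ℝᵈ) × L²(Ω) × L²(Ω)`. -/
def Quad {d : ℕ} (Ω : Set (Vec d)) : Type :=
  WithLp 2 (Lp ℝ 2 (cylMeasure Ω) × WithLp 2 (Lp (Vec d) 2 (cylMeasure Ω) ×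
    WithLp 2 (Lp ℝ 2 (spaceMeasure Ω) × Lp ℝ 2 (spaceMeasure Ω))))

namespace Quad
variable {d : ℕ} {Ω : Set (Vec d)}

instance : NormedAddCommGroup (Quad Ω) :=
  inferInstanceAs (NormedAddCommGroup (WithLp 2 (Lp ℝ 2 (cylMeasure Ω) ×
    WithLp 2 (Lp (Vec d) 2 (cylMeasure Ω) ×
    WithLp 2 (Lp ℝ 2 (spaceMeasure Ω) × Lp ℝ 2 (spaceMeasure Ω))))))

instance : InnerProductSpace ℝ (Quad Ω) :=
  inferInstanceAs (InnerProductSpace ℝ (WithLp 2 (Lp ℝ 2 (cylMeasure Ω) ×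
    WithLp 2 (Lp (Vec d) 2 (cylMeasure Ω) ×
    WithLp 2 (Lp ℝ 2 (spaceMeasure Ω) × Lp ℝ 2 (spaceMeasure Ω))))))

instance : CompleteSpace (Quad Ω) :=
  inferInstanceAs (CompleteSpace (WithLp 2 (Lp ℝ 2 (cylMeasure Ω) ×
    WithLp 2 (Lp (Vec d) 2 (cylMeasure Ω) ×
    WithLp 2 (Lp ℝ 2 (spaceMeasure Ω) × Lp ℝ 2 (spaceMeasure Ω))))))

def bulk (y : Quad Ω) : Lp ℝ 2 (cylMeasure Ω) := WithLp.fst y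
def field (y : Quad Ω) : Lp (Vec d) 2 (cylMeasure Ω) := (WithLp.snd y).fst
def slice0 (y : Quad Ω) : Lp ℝ 2 (spaceMeasure Ω) := (WithLp.snd y).snd.fst
def slice1 (y : Quad Ω) : Lp ℝ 2 (spaceMeasure Ω) := (WithLp.snd y).snd.snd

/-- The quadruple with the given components. -/
def mk (u : Lp ℝ 2 (cylMeasure Ω)) (v : Lp (Vec d) 2 (cylMeasure Ω))
    (y0 y1 : Lp ℝ 2 (spaceMeasure Ω)) : Quad Ω :=
  WithLp.toLp 2 (u, WithLp.toLp 2 (v, WithLp.toLp 2 (y0, y1)))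

section
variable (u : Lp ℝ 2 (cylMeasure Ω)) (v : Lp (Vec d) 2 (cylMeasure Ω))
  (y0 y1 : Lp ℝ 2 (spaceMeasure Ω)) (y z : Quad Ω) (c : ℝ)

@[simp] lemma mk_bulk : (mk u v y0 y1).bulk = u := rfl
@[simp] lemma mk_field : (mk u v y0 y1).field = v := rfl
@[simp] lemma mk_slice0 : (mk u v y0 y1).slice0 = y0 := rfl
@[simp] lemma mk_slice1 : (mk u v y0 y1).slice1 = y1 := rfl
@[simp] lemma zero_bulk : (0 : Quad Ω).bulk = 0 := rfl
@[simp] lemma zero_field : (0 : Quad Ω).field = 0 := rfl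
@[simp] lemma zero_slice0 : (0 : Quad Ω).slice0 = 0 := rfl
@[simp] lemma zero_slice1 : (0 : Quad Ω).slice1 = 0 := rfl
@[simp] lemma add_bulk : (y + z).bulk = y.bulk + z.bulk := rfl
@[simp] lemma add_field : (y + z).field = y.field + z.field := rfl
@[simp] lemma add_slice0 : (y + z).slice0 = y.slice0 + z.slice0 := rfl
@[simp] lemma add_slice1 : (y + z).slice1 = y.slice1 + z.slice1 := rfl
@[simp] lemma neg_bulk : (-y).bulk = -y.bulk := rfl
@[simp] lemma neg_field : (-y).field = -y.field := rfl
@[simp] lemma neg_slice0 : (-y).slice0 = -y.slice0 := rfl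
@[simp] lemma neg_slice1 : (-y).slice1 = -y.slice1 := rfl
@[simp] lemma smul_bulk : (c • y).bulk = c • y.bulk := rfl
@[simp] lemma smul_field : (c • y).field = c • y.field := rfl
@[simp] lemma smul_slice0 : (c • y).slice0 = c • y.slice0 := rfl
@[simp] lemma smul_slice1 : (c • y).slice1 = c • y.slice1 := rfl

lemma inner_def : inner ℝ y z = inner ℝ y.bulk z.bulk + (inner ℝ y.field z.field +
    (inner ℝ y.slice0 z.slice0 + inner ℝ y.slice1 z.slice1)) := rfl

variable {y z} in
lemma ext' (h1 : y.bulk = z.bulk) (h2 : y.field = z.field) (h3 : y.slice0 = z.slice0)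
    (h4 : y.slice1 = z.slice1) : y = z :=
  WithLp.ofLp_injective 2 (Prod.ext h1 (WithLp.ofLp_injective 2 (Prod.ext h2
    (WithLp.ofLp_injective 2 (Prod.ext h3 h4)))))

lemma norm_sq_def : ‖y‖ ^ 2 = ‖y.bulk‖ ^ 2 + (‖y.field‖ ^ 2 + (‖y.slice0‖ ^ 2 + ‖y.slice1‖ ^ 2)) := by
  simp only [← real_inner_self_eq_norm_sq]
  exact inner_def y y

lemma norm_bulk_le : ‖y.bulk‖ ≤ ‖y‖ := by
  refine (sq_le_sq₀ (norm_nonneg _) (norm_nonneg _)).1 ?_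
  rw [y.norm_sq_def]
  exact le_add_of_nonneg_right (by positivity)

lemma norm_field_le : ‖y.field‖ ≤ ‖y‖ := by
  refine (sq_le_sq₀ (norm_nonneg _) (norm_nonneg _)).1 ?_
  rw [y.norm_sq_def]
  have := sq_nonneg ‖y.bulk‖; have := sq_nonneg ‖y.slice0‖; have := sq_nonneg ‖y.slice1‖
  linarith

lemma norm_slice0_le : ‖y.slice0‖ ≤ ‖y‖ := by
  refine (sq_le_sq₀ (norm_nonneg _) (norm_nonneg _)).1 ?_
  rw [y.norm_sq_def]
  have := sq_nonneg ‖y.bulk‖; have := sq_nonneg ‖y.field‖; have := sq_nonneg ‖y.slice1‖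
  linarith

lemma norm_slice1_le : ‖y.slice1‖ ≤ ‖y‖ := by
  refine (sq_le_sq₀ (norm_nonneg _) (norm_nonneg _)).1 ?_
  rw [y.norm_sq_def]
  have := sq_nonneg ‖y.bulk‖; have := sq_nonneg ‖y.field‖; have := sq_nonneg ‖y.slice0‖
  linarith

end

/-- The components as bounded linear maps. -/
def bulkL : Quad Ω →L[ℝ] Lp ℝ 2 (cylMeasure Ω) :=
  LinearMap.mkContinuous ⟨⟨bulk, add_bulk⟩, fun c y => smul_bulk y c⟩ 1
    fun y => by simpa using norm_bulk_le y
def fieldL : Quad Ω →L[ℝ] Lp (Vec d) 2 (cylMeasure Ω) :=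
  LinearMap.mkContinuous ⟨⟨field, add_field⟩, fun c y => smul_field y c⟩ 1
    fun y => by simpa using norm_field_le y
def slice0L : Quad Ω →L[ℝ] Lp ℝ 2 (spaceMeasure Ω) :=
  LinearMap.mkContinuous ⟨⟨slice0, add_slice0⟩, fun c y => smul_slice0 y c⟩ 1
    fun y => by simpa using norm_slice0_le y
def slice1L : Quad Ω →L[ℝ] Lp ℝ 2 (spaceMeasure Ω) :=
  LinearMap.mkContinuous ⟨⟨slice1, add_slice1⟩, fun c y => smul_slice1 y c⟩ 1
    fun y => by simpa using norm_slice1_le y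

lemma continuous_mk {X : Type*} [TopologicalSpace X] {u : X → Lp ℝ 2 (cylMeasure Ω)}
    {v : X → Lp (Vec d) 2 (cylMeasure Ω)} {y0 y1 : X → Lp ℝ 2 (spaceMeasure Ω)}
    (hu : Continuous u) (hv : Continuous v) (h0 : Continuous y0) (h1 : Continuous y1) :
    Continuous fun x => mk (u x) (v x) (y0 x) (y1 x) :=
  (WithLp.prod_continuous_toLp 2 _ _).comp (hu.prodMk ((WithLp.prod_continuous_toLp 2 _ _).comp
    (hv.prodMk ((WithLp.prod_continuous_toLp 2 _ _).comp (h0.prodMk h1)))))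

@[fun_prop] lemma continuous_bulk : Continuous (bulk (Ω := Ω)) := bulkL.continuous
@[fun_prop] lemma continuous_field : Continuous (field (Ω := Ω)) := fieldL.continuous
@[fun_prop] lemma continuous_slice0 : Continuous (slice0 (Ω := Ω)) := slice0L.continuous
@[fun_prop] lemma continuous_slice1 : Continuous (slice1 (Ω := Ω)) := slice1L.continuous

end Quad

/-- `y = (φ_t, ∇φ, φ(·,0), φ(·,1))` consists of the weak time derivative, the weak spatial gradient
and the traces at `t = 0` and `t = 1` of `φ ∈ L²(Ω × (0,1))`. Test functions compactly supported in
`Ω × ℝ` need not vanish at `t = 0, 1`, so that `time` determines the traces. -/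
structure IsWeakDeriv {d : ℕ} (Ω : Set (Vec d)) (φ : Lp ℝ 2 (cylMeasure Ω))
    (y : Quad Ω) : Prop where
  time : ∀ ψ : Vec d × ℝ → ℝ, ContDiff ℝ ∞ ψ → HasCompactSupport ψ → tsupport ψ ⊆ Ω ×ˢ univ →
    (∫ w, φ w * fderiv ℝ ψ w (0, 1) ∂cylMeasure Ω) + ∫ w, y.bulk w * ψ w ∂cylMeasure Ω
      = (∫ x, y.slice1 x * ψ (x, 1) ∂spaceMeasure Ω)
        - ∫ x, y.slice0 x * ψ (x, 0) ∂spaceMeasure Ω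
  space : ∀ ψ : Vec d × ℝ → ℝ, ContDiff ℝ ∞ ψ → HasCompactSupport ψ →
    tsupport ψ ⊆ Ω ×ˢ Ioo (0 : ℝ) 1 → ∀ e : Vec d,
    (∫ w, φ w * fderiv ℝ ψ w (e, 0) ∂cylMeasure Ω)
      + ∫ w, inner ℝ (y.field w) e * ψ w ∂cylMeasure Ω = 0

section aux
variable {d : ℕ} {Ω : Set (Vec d)}

lemma cylMeasure_eq : cylMeasure Ω = volume.restrict (Ω ×ˢ Ioo (0 : ℝ) 1) := by
  rw [cylMeasure, Measure.prod_restrict]; rfl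

lemma memLp_cyl {F : Type*} [NormedAddCommGroup F] {g : Vec d × ℝ → F} (hg : Continuous g)
    (hc : HasCompactSupport g) : MemLp g 2 (cylMeasure Ω) := by
  rw [cylMeasure_eq]
  exact (hg.memLp_of_hasCompactSupport hc).restrict _

lemma memLp_space {F : Type*} [NormedAddCommGroup F] {g : Vec d → F} (hg : Continuous g)
    (hc : HasCompactSupport g) : MemLp g 2 (spaceMeasure Ω) :=
  (hg.memLp_of_hasCompactSupport hc).restrict _

lemma integral_mul_eq_inner {α : Type*} [MeasurableSpace α] {μ : Measure α} (f : Lp ℝ 2 μ)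
    {g : α → ℝ} (hg : MemLp g 2 μ) :
    ∫ w, f w * g w ∂μ = inner ℝ (hg.toLp g) f := by
  rw [L2.inner_def]
  refine integral_congr_ae ?_
  filter_upwards [hg.coeFn_toLp] with w hw
  rw [hw]; simp

lemma integral_inner_mul_eq_inner {α F : Type*} [MeasurableSpace α] {μ : Measure α}
    [NormedAddCommGroup F] [InnerProductSpace ℝ F] (f : Lp F 2 μ)
    {g : α → ℝ} (e : F) (hg : MemLp (fun w => g w • e) 2 μ) :
    ∫ w, inner ℝ (f w) e * g w ∂μ = inner ℝ (hg.toLp _) f := by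
  rw [L2.inner_def]
  refine integral_congr_ae ?_
  filter_upwards [hg.coeFn_toLp] with w hw
  rw [hw, inner_smul_left, real_inner_comm]; simp [mul_comm]

lemma hasCompactSupport_slice {ψ : Vec d × ℝ → ℝ} (hc : HasCompactSupport ψ) (t : ℝ) :
    HasCompactSupport fun x => ψ (x, t) := by
  refine HasCompactSupport.of_support_subset_isCompact (hc.isCompact.image continuous_fst) ?_
  intro x hx
  exact ⟨(x, t), subset_tsupport _ hx, rfl⟩

lemma memLp_slice {ψ : Vec d × ℝ → ℝ} (h : ContDiff ℝ ∞ ψ) (hc : HasCompactSupport ψ) (t : ℝ) :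
    MemLp (fun x => ψ (x, t)) 2 (spaceMeasure Ω) :=
  memLp_space (h.continuous.comp (by fun_prop)) (hasCompactSupport_slice hc t)

lemma memLp_fderiv {ψ : Vec d × ℝ → ℝ} (h : ContDiff ℝ ∞ ψ) (hc : HasCompactSupport ψ)
    (v : Vec d × ℝ) : MemLp (fun w => fderiv ℝ ψ w v) 2 (cylMeasure Ω) :=
  memLp_cyl ((h.continuous_fderiv (by simp)).clm_apply continuous_const)
    (hc.fderiv_apply ℝ v)

lemma memLp_smul {ψ : Vec d × ℝ → ℝ} (h : ContDiff ℝ ∞ ψ) (hc : HasCompactSupport ψ)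
    (e : Vec d) : MemLp (fun w => ψ w • e) 2 (cylMeasure Ω) :=
  memLp_cyl (h.continuous.smul continuous_const) hc.smul_right

lemma isWeakDeriv_iff (φ : Lp ℝ 2 (cylMeasure Ω)) (y : Quad Ω) :
    IsWeakDeriv Ω φ y ↔
    (∀ ψ : Vec d × ℝ → ℝ, ∀ (h : ContDiff ℝ ∞ ψ) (hc : HasCompactSupport ψ),
      tsupport ψ ⊆ Ω ×ˢ univ →
      inner ℝ ((memLp_fderiv h hc (0, 1)).toLp _) φ
        + inner ℝ ((memLp_cyl h.continuous hc).toLp _) y.bulk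
        = inner ℝ ((memLp_slice h hc 1).toLp _) y.slice1
          - inner ℝ ((memLp_slice h hc 0).toLp _) y.slice0) ∧
    (∀ ψ : Vec d × ℝ → ℝ, ∀ (h : ContDiff ℝ ∞ ψ) (hc : HasCompactSupport ψ),
      tsupport ψ ⊆ Ω ×ˢ Ioo (0 : ℝ) 1 → ∀ e : Vec d,
      inner ℝ ((memLp_fderiv h hc (e, 0)).toLp _) φ
        + inner ℝ ((memLp_smul h hc e).toLp _) y.field = 0) := by
  constructor
  · intro H
    refine ⟨fun ψ h hc hs => ?_, fun ψ h hc hs e => ?_⟩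
    · rw [← integral_mul_eq_inner, ← integral_mul_eq_inner, ← integral_mul_eq_inner,
        ← integral_mul_eq_inner]
      exact H.time ψ h hc hs
    · rw [← integral_mul_eq_inner, ← integral_inner_mul_eq_inner]
      exact H.space ψ h hc hs e
  · rintro ⟨H1, H2⟩
    refine ⟨fun ψ h hc hs => ?_, fun ψ h hc hs e => ?_⟩
    · have := H1 ψ h hc hs
      rw [← integral_mul_eq_inner, ← integral_mul_eq_inner, ← integral_mul_eq_inner,
        ← integral_mul_eq_inner] at this
      exact this
    · have := H2 ψ h hc hs e
      rw [← integral_mul_eq_inner, ← integral_inner_mul_eq_inner] at this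
      exact this

lemma isWeakDeriv_zero : IsWeakDeriv Ω 0 0 := by
  rw [isWeakDeriv_iff]; simp

lemma IsWeakDeriv.add {φ φ' : Lp ℝ 2 (cylMeasure Ω)} {y y' : Quad Ω}
    (h : IsWeakDeriv Ω φ y) (h' : IsWeakDeriv Ω φ' y') : IsWeakDeriv Ω (φ + φ') (y + y') := by
  rw [isWeakDeriv_iff] at *
  refine ⟨fun ψ h1 hc hs => ?_, fun ψ h1 hc hs e => ?_⟩
  · have e1 := h.1 ψ h1 hc hs
    have e2 := h'.1 ψ h1 hc hs
    simp only [Quad.add_bulk, Quad.add_slice0, Quad.add_slice1, inner_add_right]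
    linarith
  · have e1 := h.2 ψ h1 hc hs e
    have e2 := h'.2 ψ h1 hc hs e
    simp only [Quad.add_field, inner_add_right]
    linarith

lemma IsWeakDeriv.smul {φ : Lp ℝ 2 (cylMeasure Ω)} {y : Quad Ω} (c : ℝ)
    (h : IsWeakDeriv Ω φ y) : IsWeakDeriv Ω (c • φ) (c • y) := by
  rw [isWeakDeriv_iff] at *
  refine ⟨fun ψ h1 hc hs => ?_, fun ψ h1 hc hs e => ?_⟩
  · have e1 := h.1 ψ h1 hc hs
    simp only [Quad.smul_bulk, Quad.smul_slice0, Quad.smul_slice1, inner_smul_right]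
    rw [← mul_add, e1]; ring
  · have e1 := h.2 ψ h1 hc hs e
    simp only [Quad.smul_field, inner_smul_right]
    rw [← mul_add, e1]; ring

lemma isClosed_isWeakDeriv :
    IsClosed {p : Lp ℝ 2 (cylMeasure Ω) × Quad Ω | IsWeakDeriv Ω p.1 p.2} := by
  simp only [isWeakDeriv_iff, ofPred_and, ofPred_forall]
  refine IsClosed.inter ?_ ?_
  · exact isClosed_iInter fun ψ => isClosed_iInter fun h => isClosed_iInter fun hc =>
      isClosed_iInter fun _ => isClosed_eq (by fun_prop) (by fun_prop)
  · exact isClosed_iInter fun ψ => isClosed_iInter fun h => isClosed_iInter fun hc =>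
      isClosed_iInter fun _ => isClosed_iInter fun e => isClosed_eq (by fun_prop) (by fun_prop)


lemma isProbabilityMeasure_timeMeasure : IsProbabilityMeasure timeMeasure :=
  ⟨by simp [timeMeasure]⟩

lemma exists_antiderivative {ψ : Vec d × ℝ → ℝ} (h : ContDiff ℝ ∞ ψ) (hc : HasCompactSupport ψ)
    (hs : tsupport ψ ⊆ Ω ×ˢ Ioo (0 : ℝ) 1) :
    ∃ Ψ : Vec d × ℝ → ℝ, ContDiff ℝ ∞ Ψ ∧ HasCompactSupport Ψ ∧ tsupport Ψ ⊆ Ω ×ˢ univ ∧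
      (∀ x, ∀ t ∈ Ioo (0 : ℝ) 1, fderiv ℝ Ψ (x, t) (0, 1) = ψ (x, t)) ∧
      (∀ x, Ψ (x, 1) = 0) ∧
      ∀ x t, Ψ (x, t) ^ 2 ≤ ∫ s, ψ (x, s) ^ 2 ∂timeMeasure := by
  classical
  have hout : ∀ x t, t ∉ Ioo (0 : ℝ) 1 → ψ (x, t) = 0 := fun x t ht =>
    image_eq_zero_of_notMem_tsupport fun hm => ht (hs hm).2
  have hcs : ∀ x, Continuous fun s => ψ (x, s) := fun x => h.continuous.comp (by fun_prop)
  have hint : ∀ x, Integrable (fun s => ψ (x, s)) := fun x =>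
    (hcs x).integrable_of_hasCompactSupport
      (HasCompactSupport.of_support_subset_isCompact (K := Icc 0 1) isCompact_Icc
        fun s hsupp => Ioo_subset_Icc_self (by
          by_contra hn; exact hsupp (hout x s hn)))
  let G : Vec d × ℝ → ℝ := fun q => -∫ u in Ioi q.2, ψ (q.1, u)
  have hGconv : G = fun q => (convolution ((Iio (0 : ℝ)).indicator fun _ => (-1 : ℝ))
      (fun u => ψ (q.1, u)) (ContinuousLinearMap.mul ℝ ℝ) volume) q.2 := by
    funext q
    simp only [convolution_def, G, ContinuousLinearMap.mul_apply']
    rw [← integral_sub_left_eq_self _ volume q.2, ← integral_neg, ← integral_indicator measurableSet_Ioi]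
    refine integral_congr_ae (Filter.Eventually.of_forall fun u => ?_)
    by_cases hu : q.2 < u
    · simp [indicator, hu]
    · simp [indicator, hu]
  have hG : ContDiff ℝ ∞ G := by
    rw [hGconv, ← contDiffOn_univ, ← univ_prod_univ]
    refine contDiffOn_convolution_right_with_param (n := ⊤) (k := Icc (0 : ℝ) 1) _ isOpen_univ
      isCompact_Icc (fun p t _ ht => hout p t fun h' => ht (Ioo_subset_Icc_self h')) ?_ ?_
    · exact (locallyIntegrable_const (-1 : ℝ)).indicator measurableSet_Iio
    · exact h.contDiffOn
  have hG1 : ∀ x, ∀ t ≤ 1, G (x, t) = ∫ u in (1 : ℝ)..t, ψ (x, u) := by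
    intro x t ht
    rw [intervalIntegral.integral_symm, intervalIntegral.integral_of_le ht]
    simp only [G]
    congr 1
    refine setIntegral_eq_of_subset_of_forall_sdiff_eq_zero measurableSet_Ioi
      (fun u hu => hu.1) ?_ 
    intro u hu
    refine hout x u fun h' => hu.2 ⟨hu.1, h'.2.le⟩
  let χ : ContDiffBump (0 : ℝ) := ⟨2, 3, by norm_num, by norm_num⟩
  have hχ : ∀ t ∈ Icc (0 : ℝ) 1, χ t = 1 := fun t ht => χ.one_of_mem_closedBall (by
    rw [mem_closedBall_zero_iff, Real.norm_eq_abs, abs_le]; constructor <;> linarith [ht.1, ht.2])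
  have hΨ : ContDiff ℝ ∞ fun q : Vec d × ℝ => χ q.2 * G q :=
    (χ.contDiff.comp contDiff_snd).mul hG
  have hk : IsCompact (Prod.fst '' tsupport ψ) := hc.isCompact.image continuous_fst
  have hsub : Function.support (fun q : Vec d × ℝ => χ q.2 * G q) ⊆
      (Prod.fst '' tsupport ψ) ×ˢ Metric.closedBall (0 : ℝ) 3 := by
    intro q hq
    refine ⟨?_, ?_⟩
    · by_contra hn
      refine hq ?_
      have : G q = 0 := by
        simp only [G, neg_eq_zero]
        refine integral_eq_zero_of_ae (Filter.Eventually.of_forall fun u => ?_)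
        exact image_eq_zero_of_notMem_tsupport fun hm => hn ⟨_, hm, rfl⟩
      simp [this]
    · have h2 : χ q.2 ≠ 0 := fun h0 => hq (by simp [h0])
      have : q.2 ∈ tsupport χ := subset_tsupport _ h2
      rwa [χ.tsupport_eq] at this
  have hK : IsCompact ((Prod.fst '' tsupport ψ) ×ˢ Metric.closedBall (0 : ℝ) 3) :=
    hk.prod (isCompact_closedBall _ _)
  refine ⟨fun q => χ q.2 * G q, hΨ, HasCompactSupport.of_support_subset_isCompact hK hsub, ?_, ?_,
    ?_, ?_⟩
  · refine (closure_minimal hsub hK.isClosed).trans (prod_mono ?_ (subset_univ _))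
    rintro _ ⟨w, hw, rfl⟩
    exact (hs hw).1
  · intro x t ht
    have hd : HasDerivAt (fun t' => (fun q : Vec d × ℝ => χ q.2 * G q) (x, t'))
        (fderiv ℝ (fun q : Vec d × ℝ => χ q.2 * G q) (x, t) (0, 1)) t := by
      have h1 := (hΨ.differentiable (by simp) (x, t)).hasFDerivAt
      have h2 : HasDerivAt (fun t' : ℝ => (x, t')) ((0 : Vec d), (1 : ℝ)) t :=
        (hasDerivAt_const t x).prodMk (hasDerivAt_id t)
      exact h1.comp_hasDerivAt t h2
    have hd2 : HasDerivAt (fun t' => ∫ u in (1 : ℝ)..t', ψ (x, u)) (ψ (x, t)) t :=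
      intervalIntegral.integral_hasDerivAt_right ((hcs x).intervalIntegrable _ _)
        ((hcs x).stronglyMeasurableAtFilter _ _) (hcs x).continuousAt
    have he : (fun t' => (fun q : Vec d × ℝ => χ q.2 * G q) (x, t')) =ᶠ[nhds t]
        fun t' => ∫ u in (1 : ℝ)..t', ψ (x, u) := by
      filter_upwards [Ioo_mem_nhds ht.1 ht.2] with t' ht'
      rw [hχ t' (Ioo_subset_Icc_self ht'), one_mul, hG1 x t' ht'.2.le]
    exact hd.unique (hd2.congr_of_eventuallyEq he)
  · intro x
    simp [hG1 x 1 le_rfl]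
  · intro x t
    have hb : |χ t * G (x, t)| ≤ ∫ s, |ψ (x, s)| ∂timeMeasure := by
      rw [abs_mul, abs_of_nonneg χ.nonneg]
      have hGb : |G (x, t)| ≤ ∫ s, |ψ (x, s)| ∂timeMeasure := by
        change |-(∫ u in Ioi t, ψ (x, u))| ≤ _
        rw [abs_neg]
        refine (abs_integral_le_integral_abs).trans ?_
        refine (setIntegral_le_integral (hint x).abs
          (Filter.Eventually.of_forall fun _ => abs_nonneg _)).trans_eq ?_
        rw [timeMeasure, setIntegral_eq_integral_of_forall_compl_eq_zero]
        intro s hs'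
        simp [hout x s hs']
      calc χ t * |G (x, t)| ≤ 1 * |G (x, t)| := by gcongr; exact χ.le_one
        _ ≤ _ := by simpa using hGb
    have := isProbabilityMeasure_timeMeasure
    have hj := (convexOn_pow (𝕜 := ℝ) 2).map_integral_le (μ := timeMeasure)
      (f := fun s => |ψ (x, s)|) (by fun_prop) isClosed_Ici
      (Filter.Eventually.of_forall fun s => mem_Ici.2 (abs_nonneg _)) (hint x).abs.restrict
      (by
        refine Integrable.restrict ?_
        refine Continuous.integrable_of_hasCompactSupport (by
          have := hcs x
          simp only [Function.comp_def]; fun_prop) ?_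
        refine HasCompactSupport.of_support_subset_isCompact (K := Icc 0 1) isCompact_Icc
          fun s hsupp => Ioo_subset_Icc_self ?_
        by_contra hn; exact hsupp (by simp [hout x s hn]))
    simp only [sq_abs] at hj
    refine le_trans ?_ hj
    exact sq_le_sq' (by have := abs_le.1 hb; linarith [this.1]) (abs_le.1 hb).2

lemma norm_sq_toLp {α : Type*} [MeasurableSpace α] {μ : Measure α} {g : α → ℝ}
    (hg : MemLp g 2 μ) : ‖hg.toLp g‖ ^ 2 = ∫ w, g w ^ 2 ∂μ := by
  rw [← real_inner_self_eq_norm_sq, ← integral_mul_eq_inner]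
  refine integral_congr_ae ?_
  filter_upwards [hg.coeFn_toLp] with w hw
  rw [hw]; ring

lemma norm_toLp_le_of_bound {ψ Ψ : Vec d × ℝ → ℝ} (h : MemLp ψ 2 (cylMeasure Ω))
    (hΨ : MemLp Ψ 2 (cylMeasure Ω))
    (hb : ∀ x t, Ψ (x, t) ^ 2 ≤ ∫ s, ψ (x, s) ^ 2 ∂timeMeasure) :
    ‖hΨ.toLp Ψ‖ ≤ ‖h.toLp ψ‖ := by
  have := isProbabilityMeasure_timeMeasure
  rw [← sq_le_sq₀ (norm_nonneg _) (norm_nonneg _), norm_sq_toLp, norm_sq_toLp,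
    integral_prod _ hΨ.integrable_sq, integral_prod _ h.integrable_sq]
  refine integral_mono_of_nonneg
    (Filter.Eventually.of_forall fun x => integral_nonneg fun t => sq_nonneg _)
    h.integrable_sq.integral_prod_left (Filter.Eventually.of_forall fun x => ?_)
  have h2 := integral_mono_of_nonneg (μ := timeMeasure) (f := fun t => Ψ (x, t) ^ 2)
    (g := fun _ => ∫ s, ψ (x, s) ^ 2 ∂timeMeasure)
    (Filter.Eventually.of_forall fun t => sq_nonneg _) (integrable_const _)
    (Filter.Eventually.of_forall fun t => hb x t)
  simpa using h2

lemma norm_toLp_slice_le_of_bound {ψ Ψ : Vec d × ℝ → ℝ} (h : MemLp ψ 2 (cylMeasure Ω))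
    (hΨ : MemLp (fun x => Ψ (x, 0)) 2 (spaceMeasure Ω))
    (hb : ∀ x t, Ψ (x, t) ^ 2 ≤ ∫ s, ψ (x, s) ^ 2 ∂timeMeasure) :
    ‖hΨ.toLp _‖ ≤ ‖h.toLp ψ‖ := by
  rw [← sq_le_sq₀ (norm_nonneg _) (norm_nonneg _), norm_sq_toLp, norm_sq_toLp,
    integral_prod _ h.integrable_sq]
  exact integral_mono_of_nonneg (Filter.Eventually.of_forall fun x => sq_nonneg _)
    h.integrable_sq.integral_prod_left (Filter.Eventually.of_forall fun x => hb x 0)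

/-- The classes of smooth functions with compact support in the open cylinder. -/
def testClasses (Ω : Set (Vec d)) : Submodule ℝ (Lp ℝ 2 (cylMeasure Ω)) where
  carrier := {f | ∃ ψ : Vec d × ℝ → ℝ, ContDiff ℝ ∞ ψ ∧ HasCompactSupport ψ ∧
    tsupport ψ ⊆ Ω ×ˢ Ioo (0 : ℝ) 1 ∧ f =ᵐ[cylMeasure Ω] ψ}
  add_mem' := by
    rintro f g ⟨ψ, h1, h2, h3, h4⟩ ⟨ψ', h1', h2', h3', h4'⟩
    exact ⟨ψ + ψ', h1.add h1', h2.add h2', (tsupport_add ψ ψ').trans (union_subset h3 h3'),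
      (Lp.coeFn_add f g).trans (h4.add h4')⟩
  zero_mem' := ⟨0, contDiff_const, HasCompactSupport.zero, by simp [tsupport], Lp.coeFn_zero _ _ _⟩
  smul_mem' := by
    rintro c f ⟨ψ, h1, h2, h3, h4⟩
    exact ⟨c • ψ, contDiff_const.smul h1, h2.smul_left, 
      (closure_mono (Function.support_const_smul_subset c ψ)).trans h3, (Lp.coeFn_smul c f).trans (h4.const_smul c)⟩

lemma locallyIntegrableOn_cyl {g : Vec d × ℝ → ℝ} (hg : MemLp g 2 (cylMeasure Ω)) :
    LocallyIntegrableOn g (Ω ×ˢ Ioo (0 : ℝ) 1) := by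
  rw [cylMeasure_eq] at hg
  exact locallyIntegrableOn_of_locallyIntegrable_restrict (hg.locallyIntegrable (by norm_num))

lemma integral_cyl (g : Vec d × ℝ → ℝ) :
    ∫ w, g w ∂cylMeasure Ω = ∫ w in Ω ×ˢ Ioo (0 : ℝ) 1, g w := by
  rw [cylMeasure_eq]

lemma ae_cyl_iff (hΩ : IsOpen Ω) {p : Vec d × ℝ → Prop} :
    (∀ᵐ w ∂cylMeasure Ω, p w) ↔ ∀ᵐ w : Vec d × ℝ, w ∈ Ω ×ˢ Ioo (0 : ℝ) 1 → p w := by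
  rw [cylMeasure_eq]
  exact ae_restrict_iff' (hΩ.prod isOpen_Ioo).measurableSet

lemma dense_testClasses (hΩ : IsOpen Ω) : (testClasses Ω).topologicalClosure = ⊤ := by
  rw [Submodule.topologicalClosure_eq_top_iff, Submodule.eq_bot_iff]
  intro f hf
  rw [Submodule.mem_orthogonal] at hf
  have hloc := locallyIntegrableOn_cyl (Lp.memLp f)
  have := (hΩ.prod isOpen_Ioo).ae_eq_zero_of_integral_contDiff_smul_eq_zero hloc
    (by
      intro ψ h hc hs
      have h0 := hf ((memLp_cyl h.continuous hc).toLp ψ)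
        ⟨ψ, h, hc, hs, (memLp_cyl h.continuous hc).coeFn_toLp⟩
      rw [← integral_mul_eq_inner, integral_cyl] at h0
      rw [← h0, setIntegral_eq_integral_of_forall_compl_eq_zero]
      · simp [mul_comm]
      · intro w hw
        rw [image_eq_zero_of_notMem_tsupport fun hm => hw (hs hm), mul_zero])
  rw [Lp.eq_zero_iff_ae_eq_zero]
  exact (ae_cyl_iff hΩ).2 this

/-- A function in `H¹` is controlled by its time derivative and its initial trace. -/
lemma IsWeakDeriv.norm_le (hΩ : IsOpen Ω) {φ : Lp ℝ 2 (cylMeasure Ω)} {y : Quad Ω}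
    (H : IsWeakDeriv Ω φ y) : ‖φ‖ ≤ ‖y.bulk‖ + ‖y.slice0‖ := by
  rw [isWeakDeriv_iff] at H
  have key : ∀ f ∈ testClasses Ω, |inner ℝ f φ| ≤ (‖y.bulk‖ + ‖y.slice0‖) * ‖f‖ := by
    rintro f ⟨ψ, h, hc, hs, hf⟩
    obtain ⟨Ψ, g, gc, gs, gt, g1, gb⟩ := exists_antiderivative h hc hs
    have hfψ : f = (memLp_cyl h.continuous hc).toLp ψ :=
      Lp.ext (hf.trans (MemLp.coeFn_toLp _).symm)
    have e1 : (memLp_fderiv (Ω := Ω) g gc (0, 1)).toLp _ = f := by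
      refine Lp.ext ((MemLp.coeFn_toLp _).trans (Filter.EventuallyEq.trans ?_ hf.symm))
      exact (ae_cyl_iff hΩ).2 (Filter.Eventually.of_forall fun w hw => gt w.1 w.2 hw.2)
    have e2 : (memLp_slice (Ω := Ω) g gc 1).toLp _ = 0 := by
      rw [Lp.eq_zero_iff_ae_eq_zero]
      exact (MemLp.coeFn_toLp _).trans (Filter.Eventually.of_forall fun x => g1 x)
    have e := H.1 Ψ g gc gs
    rw [e1, e2, inner_zero_left, zero_sub] at e
    have b1 := norm_toLp_le_of_bound (memLp_cyl (Ω := Ω) h.continuous hc)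
      (memLp_cyl (Ω := Ω) g.continuous gc) gb
    have b2 := norm_toLp_slice_le_of_bound (memLp_cyl (Ω := Ω) h.continuous hc)
      (memLp_slice g gc 0) gb
    rw [← hfψ] at b1 b2
    have c1 := abs_real_inner_le_norm ((memLp_cyl (Ω := Ω) g.continuous gc).toLp Ψ) y.bulk
    have c2 := abs_real_inner_le_norm ((memLp_slice (Ω := Ω) g gc 0).toLp _) y.slice0
    have d1 := mul_le_mul_of_nonneg_right b1 (norm_nonneg y.bulk)
    have d2 := mul_le_mul_of_nonneg_right b2 (norm_nonneg y.slice0)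
    rw [abs_le] at *
    constructor <;> nlinarith
  have key2 : ∀ f : Lp ℝ 2 (cylMeasure Ω), |inner ℝ f φ| ≤ (‖y.bulk‖ + ‖y.slice0‖) * ‖f‖ := by
    intro f
    have hcl : IsClosed {f : Lp ℝ 2 (cylMeasure Ω) |
        |inner ℝ f φ| ≤ (‖y.bulk‖ + ‖y.slice0‖) * ‖f‖} :=
      isClosed_le (by fun_prop) (by fun_prop)
    have hmem : f ∈ (testClasses Ω).topologicalClosure := by
      rw [dense_testClasses hΩ]; trivial
    exact hcl.closure_subset_iff.2 (fun f hf => key f hf) hmem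
  have h3 := key2 φ
  rw [real_inner_self_eq_norm_sq, abs_of_nonneg (sq_nonneg _), sq] at h3
  rcases (norm_nonneg φ).eq_or_lt with h0 | h0
  · rw [← h0]; positivity
  · exact le_of_mul_le_mul_right h3 h0

/-- The space `H¹(Ω × (0,1))`. A function `φ` is represented by `(φ_t, ∇φ, φ(·,0), φ(·,1))`, which
determines it, and the inner product inherited from `Quad Ω` is
`⟨φ, h⟩ = ∫ φ(x,0) h(x,0) dx + ∫ φ(x,1) h(x,1) dx + ∫∫ ∇_{t,x} φ · ∇_{t,x} h dx dt`. -/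
def H1 (Ω : Set (Vec d)) : Submodule ℝ (Quad Ω) where
  carrier := {y | ∃ φ, IsWeakDeriv Ω φ y}
  add_mem' := by
    rintro y y' ⟨φ, h⟩ ⟨φ', h'⟩
    exact ⟨φ + φ', h.add h'⟩
  zero_mem' := ⟨0, isWeakDeriv_zero⟩
  smul_mem' := by
    rintro c y ⟨φ, h⟩
    exact ⟨c • φ, h.smul c⟩

lemma norm_fst_add_le (y : Quad Ω) : ‖y.bulk‖ + ‖y.slice0‖ ≤ 2 * ‖y‖ := by
  linarith [y.norm_bulk_le, y.norm_slice0_le]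

lemma H1.isClosed (hΩ : IsOpen Ω) : IsClosed (H1 Ω : Set (Quad Ω)) := by
  refine IsSeqClosed.isClosed ?_
  intro y y₀ hy hlim
  choose φ hφ using hy
  have hc : CauchySeq φ := by
    have hcy := hlim.cauchySeq
    rw [Metric.cauchySeq_iff] at hcy ⊢
    intro ε hε
    obtain ⟨N, hN⟩ := hcy (ε / 2) (by positivity)
    refine ⟨N, fun m hm n hn => ?_⟩
    have h1 := hN m hm n hn
    rw [dist_eq_norm] at h1 ⊢
    have h2 : IsWeakDeriv Ω (φ m - φ n) (y m - y n) := by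
      have := (hφ m).add ((hφ n).smul (-1))
      simpa [sub_eq_add_neg] using this
    have h3 := h2.norm_le hΩ
    have h4 := norm_fst_add_le (y m - y n)
    linarith
  obtain ⟨φ₀, hφ₀⟩ := cauchySeq_tendsto_of_complete hc
  exact ⟨φ₀, isClosed_isWeakDeriv.mem_of_tendsto (hφ₀.prodMk_nhds hlim)
    (Filter.Eventually.of_forall hφ)⟩


/-- The weak time derivative `φ_t`. -/
def H1.dt (φ : H1 Ω) : Lp ℝ 2 (cylMeasure Ω) := (φ : Quad Ω).bulk

/-- The weak spatial gradient `∇φ`. -/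
def H1.grad (φ : H1 Ω) : Lp (Vec d) 2 (cylMeasure Ω) := (φ : Quad Ω).field

/-- The trace `φ(·,0)`. -/
def H1.init (φ : H1 Ω) : Lp ℝ 2 (spaceMeasure Ω) := (φ : Quad Ω).slice0

/-- The trace `φ(·,1)`. -/
def H1.fin (φ : H1 Ω) : Lp ℝ 2 (spaceMeasure Ω) := (φ : Quad Ω).slice1

end aux

/-! ### Convex analysis -/

/-- The integral of an extended-real function, as the difference of the integrals of its positive
and negative parts; it is used only for integrands whose negative part has a finite integral. -/
def eintegral {X : Type*} [MeasurableSpace X] (μ : Measure X) (f : X → EReal) : EReal :=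
  ((∫⁻ x, (f x).toENNReal ∂μ : ENNReal) : EReal) - ((∫⁻ x, (-f x).toENNReal ∂μ : ENNReal) : EReal)

open Classical in
/-- The indicator of convex analysis: `0` if the condition holds and `+∞` otherwise. -/
def convexInd (p : Prop) : EReal := if p then 0 else ⊤

section convex
variable {V : Type*} [NormedAddCommGroup V] [InnerProductSpace ℝ V]

/-- The convex dual (Fenchel conjugate) `f* p = sup_x ⟨p, x⟩ - f x`. -/
def conj (f : V → EReal) (p : V) : EReal := ⨆ x, ((inner ℝ p x : ℝ) : EReal) - f x

/-- The subdifferential, empty where `f` is not finite. -/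
def subdiff (f : V → EReal) (x : V) : Set V :=
  {p | f x ≠ ⊥ ∧ f x ≠ ⊤ ∧ ∀ y, f x + ((inner ℝ p (y - x) : ℝ) : EReal) ≤ f y}

/-- A set-valued operator is monotone. -/
def IsMonotoneOp (A : V → Set V) : Prop :=
  ∀ x y, ∀ u ∈ A x, ∀ v ∈ A y, 0 ≤ inner ℝ (x - y) (u - v)

/-- A set-valued operator is maximally monotone: it is monotone, and its graph contains every pair
that is monotonically related to all of its points. -/
def IsMaximallyMonotone (A : V → Set V) : Prop :=
  IsMonotoneOp A ∧ ∀ x u, (∀ y, ∀ v ∈ A y, 0 ≤ inner ℝ (x - y) (u - v)) → u ∈ A x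

end convex

/-! ### The data of the mean field game -/

/-- The matrix `k_{pq} = ∫∫ K(x, y) ζ_p(x) ζ_q(y) dx dy`. -/
def kernelMatrix {d r : ℕ} (Ω : Set (Vec d)) (ζ : Fin r → Vec d → ℝ) (K : Vec d → Vec d → ℝ) :
    Matrix (Fin r) (Fin r) ℝ :=
  Matrix.of fun p q =>
    ∫ z, K z.1 z.2 * ζ p z.1 * ζ q z.2 ∂(spaceMeasure Ω).prod (spaceMeasure Ω)

/-- The data of the mean field game on `Ω × (0,1)`, together with the standing assumptions. The
arguments are ordered as `(t, x, p)` for `H`, as `(t, x, z)` for `f₀`, `f₁`, and as `(x, z)` for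
`g₀`, `g₁`. -/
structure MFGData (d r : ℕ) where
  Ω : Set (Vec d)
  isOpen_Ω : IsOpen Ω
  nonempty_Ω : Ω.Nonempty
  /-- the orthonormal system `ζ₁, …, ζᵣ` in `L²(Ω)` -/
  ζ : Fin r → Vec d → ℝ
  memLp_ζ : ∀ i, MemLp (ζ i) 2 (spaceMeasure Ω)
  orthonormal_ζ : Orthonormal ℝ fun i => (memLp_ζ i).toLp (ζ i)
  /-- the initial density -/
  ρInit : Lp ℝ 2 (spaceMeasure Ω)
  /-- the Hamiltonian: measurable in `(t, x)`, convex and differentiable in `p` -/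
  H : ℝ → Vec d → Vec d → ℝ
  measurable_H : ∀ p, AEMeasurable (fun w : Vec d × ℝ => H w.2 w.1 p) (cylMeasure Ω)
  convex_H : ∀ t ∈ Ioo (0 : ℝ) 1, ∀ x ∈ Ω, ConvexOn ℝ univ (H t x)
  differentiable_H : ∀ t ∈ Ioo (0 : ℝ) 1, ∀ x ∈ Ω, Differentiable ℝ (H t x)
  memLp_H : MemLp (fun w : Vec d × ℝ => H w.2 w.1 0) 2 (cylMeasure Ω)
  /-- local couplings: Carathéodory functions, nondecreasing in `z` -/
  f₀ : ℝ → Vec d → ℝ → ℝ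
  measurable_f₀ : ∀ z, AEMeasurable (fun w : Vec d × ℝ => f₀ w.2 w.1 z) (cylMeasure Ω)
  continuous_f₀ : ∀ t ∈ Ioo (0 : ℝ) 1, ∀ x ∈ Ω, Continuous (f₀ t x)
  monotone_f₀ : ∀ t ∈ Ioo (0 : ℝ) 1, ∀ x ∈ Ω, Monotone (f₀ t x)
  memLp_f₀ : MemLp (fun w : Vec d × ℝ => f₀ w.2 w.1 0) 2 (cylMeasure Ω)
  g₀ : Vec d → ℝ → ℝ
  measurable_g₀ : ∀ z, AEMeasurable (fun x => g₀ x z) (spaceMeasure Ω)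
  continuous_g₀ : ∀ x ∈ Ω, Continuous (g₀ x)
  monotone_g₀ : ∀ x ∈ Ω, Monotone (g₀ x)
  memLp_g₀ : MemLp (fun x => g₀ x 0) 2 (spaceMeasure Ω)
  /-- nonlocal couplings: Carathéodory functions, nondecreasing in `z`, whose compositions with
  the linear combinations of the `ζᵢ` are in `L²`, so that their projections are defined -/
  f₁ : ℝ → Vec d → ℝ → ℝ
  measurable_f₁ : ∀ z, AEMeasurable (fun w : Vec d × ℝ => f₁ w.2 w.1 z) (cylMeasure Ω)
  continuous_f₁ : ∀ t ∈ Ioo (0 : ℝ) 1, ∀ x ∈ Ω, Continuous (f₁ t x)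
  monotone_f₁ : ∀ t ∈ Ioo (0 : ℝ) 1, ∀ x ∈ Ω, Monotone (f₁ t x)
  memLp_f₁ : ∀ c : Lp (Vec r) 2 timeMeasure,
    MemLp (fun w : Vec d × ℝ => f₁ w.2 w.1 (∑ p, c w.2 p * ζ p w.1)) 2 (cylMeasure Ω)
  g₁ : Vec d → ℝ → ℝ
  measurable_g₁ : ∀ z, AEMeasurable (fun x => g₁ x z) (spaceMeasure Ω)
  continuous_g₁ : ∀ x ∈ Ω, Continuous (g₁ x)
  monotone_g₁ : ∀ x ∈ Ω, Monotone (g₁ x)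
  memLp_g₁ : ∀ w : Vec r, MemLp (fun x => g₁ x (∑ p, w p * ζ p x)) 2 (spaceMeasure Ω)
  /-- interaction kernels in `L²(Ω × Ω)` with invertible coefficient matrices -/
  K : Vec d → Vec d → ℝ
  memLp_K : MemLp (fun z : Vec d × Vec d => K z.1 z.2) 2 ((spaceMeasure Ω).prod (spaceMeasure Ω))
  isUnit_K : IsUnit (kernelMatrix Ω ζ K).det
  S : Vec d → Vec d → ℝ
  memLp_S : MemLp (fun z : Vec d × Vec d => S z.1 z.2) 2 ((spaceMeasure Ω).prod (spaceMeasure Ω))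
  isUnit_S : IsUnit (kernelMatrix Ω ζ S).det

instance finiteDimensional_span_range {ι V : Type*} [Finite ι] [AddCommGroup V] [Module ℝ V]
    (v : ι → V) : FiniteDimensional ℝ (Submodule.span ℝ (range v)) :=
  FiniteDimensional.span_of_finite ℝ (finite_range v)

namespace MFGData
variable {d r : ℕ} (D : MFGData d r)

/-- The matrix `𝐊`. -/
def matK : Matrix (Fin r) (Fin r) ℝ := kernelMatrix D.Ω D.ζ D.K

/-- The matrix `𝐒`. -/
def matS : Matrix (Fin r) (Fin r) ℝ := kernelMatrix D.Ω D.ζ D.S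

/-- `ζᵢ` as an element of `L²(Ω)`. -/
def ζL (i : Fin r) : Lp ℝ 2 (spaceMeasure D.Ω) := (D.memLp_ζ i).toLp (D.ζ i)

open Classical in
/-- The orthogonal projection `ℙ_r` of `L²(Ω)` onto the span of the `ζᵢ`. -/
def projR (u : Vec d → ℝ) : Lp ℝ 2 (spaceMeasure D.Ω) :=
  if hu : MemLp u 2 (spaceMeasure D.Ω) then
    (Submodule.span ℝ (range D.ζL)).starProjection (hu.toLp u)
  else 0

lemma memLp_tensor {X Y : Type*} [MeasurableSpace X] [MeasurableSpace Y] {μ : Measure X}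
    {ν : Measure Y} [SFinite μ] [SFinite ν] {f : X → ℝ} {g : Y → ℝ} (hf : MemLp f 2 μ)
    (hg : MemLp g 2 ν) : MemLp (fun w : X × Y => f w.1 * g w.2) 2 (μ.prod ν) := by
  have hm : AEStronglyMeasurable (fun w : X × Y => f w.1 * g w.2) (μ.prod ν) :=
    hf.1.comp_fst.mul hg.1.comp_snd
  rw [memLp_two_iff_integrable_sq hm]
  simpa [mul_pow] using hf.integrable_sq.mul_prod hg.integrable_sq

/-- The orthogonal projection `ℙ_{r,r}` of `L²(Ω × Ω)` onto the span of the `ζᵢ ⊗ ζⱼ`. -/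
def projRR (k : Lp ℝ 2 ((spaceMeasure D.Ω).prod (spaceMeasure D.Ω))) :
    Lp ℝ 2 ((spaceMeasure D.Ω).prod (spaceMeasure D.Ω)) :=
  (Submodule.span ℝ (range fun ij : Fin r × Fin r =>
    (memLp_tensor (D.memLp_ζ ij.1) (D.memLp_ζ ij.2)).toLp
      (fun z : Vec d × Vec d => D.ζ ij.1 z.1 * D.ζ ij.2 z.2))).starProjection k

/-- `K_r = ℙ_{r,r}(K)`. -/
def Kr : Lp ℝ 2 ((spaceMeasure D.Ω).prod (spaceMeasure D.Ω)) := D.projRR (D.memLp_K.toLp _)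

/-- `S_r = ℙ_{r,r}(S)`. -/
def Sr : Lp ℝ 2 ((spaceMeasure D.Ω).prod (spaceMeasure D.Ω)) := D.projRR (D.memLp_S.toLp _)
/-! ### Spaces -/

instance completeSpace_H1 : CompleteSpace (H1 D.Ω) :=
  (H1.isClosed D.isOpen_Ω).completeSpace_coe

/-- The primal Hilbert space `L²_t × ℓ² × L²_{x,t} × L²_x × H¹_{x,t}` of tuples
`s = (a, b, α, β, φ)`. -/
def Primal : Type :=
  WithLp 2 (Lp (Vec r) 2 timeMeasure × WithLp 2 (Vec r ×
    WithLp 2 (Lp ℝ 2 (cylMeasure D.Ω) × WithLp 2 (Lp ℝ 2 (spaceMeasure D.Ω) × H1 D.Ω))))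

namespace Primal

instance : NormedAddCommGroup D.Primal :=
  inferInstanceAs (NormedAddCommGroup (WithLp 2 (Lp (Vec r) 2 timeMeasure × WithLp 2 (Vec r ×
    WithLp 2 (Lp ℝ 2 (cylMeasure D.Ω) × WithLp 2 (Lp ℝ 2 (spaceMeasure D.Ω) × H1 D.Ω))))))

instance : InnerProductSpace ℝ D.Primal :=
  inferInstanceAs (InnerProductSpace ℝ (WithLp 2 (Lp (Vec r) 2 timeMeasure × WithLp 2 (Vec r ×
    WithLp 2 (Lp ℝ 2 (cylMeasure D.Ω) × WithLp 2 (Lp ℝ 2 (spaceMeasure D.Ω) × H1 D.Ω))))))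

instance : CompleteSpace D.Primal :=
  inferInstanceAs (CompleteSpace (WithLp 2 (Lp (Vec r) 2 timeMeasure × WithLp 2 (Vec r ×
    WithLp 2 (Lp ℝ 2 (cylMeasure D.Ω) × WithLp 2 (Lp ℝ 2 (spaceMeasure D.Ω) × H1 D.Ω))))))

variable {D}

def a (s : D.Primal) : Lp (Vec r) 2 timeMeasure := WithLp.fst s
def b (s : D.Primal) : Vec r := (WithLp.snd s).fst
def α (s : D.Primal) : Lp ℝ 2 (cylMeasure D.Ω) := (WithLp.snd s).snd.fst
def β (s : D.Primal) : Lp ℝ 2 (spaceMeasure D.Ω) := (WithLp.snd s).snd.snd.fst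
def φ (s : D.Primal) : H1 D.Ω := (WithLp.snd s).snd.snd.snd

/-- The tuple `(a, b, α, β, φ)`. -/
def mk (a : Lp (Vec r) 2 timeMeasure) (b : Vec r) (α : Lp ℝ 2 (cylMeasure D.Ω))
    (β : Lp ℝ 2 (spaceMeasure D.Ω)) (φ : H1 D.Ω) : D.Primal :=
  WithLp.toLp 2 (a, WithLp.toLp 2 (b, WithLp.toLp 2 (α, WithLp.toLp 2 (β, φ))))

section
variable (a : Lp (Vec r) 2 timeMeasure) (b : Vec r) (α : Lp ℝ 2 (cylMeasure D.Ω))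
    (β : Lp ℝ 2 (spaceMeasure D.Ω)) (φ : H1 D.Ω) (s t : D.Primal) (c : ℝ)

@[simp] lemma mk_a : (mk a b α β φ).a = a := rfl
@[simp] lemma mk_b : (mk a b α β φ).b = b := rfl
@[simp] lemma mk_α : (mk a b α β φ).α = α := rfl
@[simp] lemma mk_β : (mk a b α β φ).β = β := rfl
@[simp] lemma mk_φ : (mk a b α β φ).φ = φ := rfl
@[simp] lemma zero_a : (0 : D.Primal).a = 0 := rfl
@[simp] lemma zero_b : (0 : D.Primal).b = 0 := rfl
@[simp] lemma zero_α : (0 : D.Primal).α = 0 := rfl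
@[simp] lemma zero_β : (0 : D.Primal).β = 0 := rfl
@[simp] lemma zero_φ : (0 : D.Primal).φ = 0 := rfl
@[simp] lemma add_a : (s + t).a = s.a + t.a := rfl
@[simp] lemma add_b : (s + t).b = s.b + t.b := rfl
@[simp] lemma add_α : (s + t).α = s.α + t.α := rfl
@[simp] lemma add_β : (s + t).β = s.β + t.β := rfl
@[simp] lemma add_φ : (s + t).φ = s.φ + t.φ := rfl
@[simp] lemma neg_a : (-s).a = -s.a := rfl
@[simp] lemma neg_b : (-s).b = -s.b := rfl
@[simp] lemma neg_α : (-s).α = -s.α := rfl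
@[simp] lemma neg_β : (-s).β = -s.β := rfl
@[simp] lemma neg_φ : (-s).φ = -s.φ := rfl
@[simp] lemma smul_a : (c • s).a = c • s.a := rfl
@[simp] lemma smul_b : (c • s).b = c • s.b := rfl
@[simp] lemma smul_α : (c • s).α = c • s.α := rfl
@[simp] lemma smul_β : (c • s).β = c • s.β := rfl
@[simp] lemma smul_φ : (c • s).φ = c • s.φ := rfl

lemma inner_def : inner ℝ s t = inner ℝ s.a t.a + (inner ℝ s.b t.b + (inner ℝ s.α t.α +
    (inner ℝ s.β t.β + inner ℝ s.φ t.φ))) := rfl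

variable {s t} in
lemma ext' (h1 : s.a = t.a) (h2 : s.b = t.b) (h3 : s.α = t.α) (h4 : s.β = t.β)
    (h5 : s.φ = t.φ) : s = t :=
  WithLp.ofLp_injective 2 (Prod.ext h1 (WithLp.ofLp_injective 2 (Prod.ext h2
    (WithLp.ofLp_injective 2 (Prod.ext h3 (WithLp.ofLp_injective 2 (Prod.ext h4 h5)))))))

lemma norm_sq_def : ‖s‖ ^ 2 = ‖s.a‖ ^ 2 + (‖s.b‖ ^ 2 + (‖s.α‖ ^ 2 + (‖s.β‖ ^ 2 + ‖s.φ‖ ^ 2))) := by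
  simp only [← real_inner_self_eq_norm_sq]
  exact inner_def s s

lemma norm_le_aux {x y z : ℝ} (hx : 0 ≤ x) (hy : 0 ≤ y) (hz : 0 ≤ z) (h : y ^ 2 = x ^ 2 + z) :
    x ≤ y :=
  (sq_le_sq₀ hx hy).1 (by linarith)

lemma norm_a_le : ‖s.a‖ ≤ ‖s‖ :=
  norm_le_aux (norm_nonneg _) (norm_nonneg _)
    (z := ‖s.b‖ ^ 2 + ‖s.α‖ ^ 2 + ‖s.β‖ ^ 2 + ‖s.φ‖ ^ 2) (by positivity)
    (by rw [s.norm_sq_def]; ring)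
lemma norm_b_le : ‖s.b‖ ≤ ‖s‖ :=
  norm_le_aux (norm_nonneg _) (norm_nonneg _)
    (z := ‖s.a‖ ^ 2 + ‖s.α‖ ^ 2 + ‖s.β‖ ^ 2 + ‖s.φ‖ ^ 2) (by positivity)
    (by rw [s.norm_sq_def]; ring)
lemma norm_α_le : ‖s.α‖ ≤ ‖s‖ :=
  norm_le_aux (norm_nonneg _) (norm_nonneg _)
    (z := ‖s.a‖ ^ 2 + ‖s.b‖ ^ 2 + ‖s.β‖ ^ 2 + ‖s.φ‖ ^ 2) (by positivity)
    (by rw [s.norm_sq_def]; ring)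
lemma norm_β_le : ‖s.β‖ ≤ ‖s‖ :=
  norm_le_aux (norm_nonneg _) (norm_nonneg _)
    (z := ‖s.a‖ ^ 2 + ‖s.b‖ ^ 2 + ‖s.α‖ ^ 2 + ‖s.φ‖ ^ 2) (by positivity)
    (by rw [s.norm_sq_def]; ring)
lemma norm_φ_le : ‖s.φ‖ ≤ ‖s‖ :=
  norm_le_aux (norm_nonneg _) (norm_nonneg _)
    (z := ‖s.a‖ ^ 2 + ‖s.b‖ ^ 2 + ‖s.α‖ ^ 2 + ‖s.β‖ ^ 2) (by positivity)
    (by rw [s.norm_sq_def]; ring)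

end

/-- The components as bounded linear maps. -/
def aL : D.Primal →L[ℝ] Lp (Vec r) 2 timeMeasure :=
  LinearMap.mkContinuous ⟨⟨a, add_a⟩, fun c s => smul_a s c⟩ 1
    fun s => by simpa using norm_a_le s
def bL : D.Primal →L[ℝ] Vec r :=
  LinearMap.mkContinuous ⟨⟨b, add_b⟩, fun c s => smul_b s c⟩ 1
    fun s => by simpa using norm_b_le s
def αL : D.Primal →L[ℝ] Lp ℝ 2 (cylMeasure D.Ω) :=
  LinearMap.mkContinuous ⟨⟨α, add_α⟩, fun c s => smul_α s c⟩ 1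
    fun s => by simpa using norm_α_le s
def βL : D.Primal →L[ℝ] Lp ℝ 2 (spaceMeasure D.Ω) :=
  LinearMap.mkContinuous ⟨⟨β, add_β⟩, fun c s => smul_β s c⟩ 1
    fun s => by simpa using norm_β_le s
def φL : D.Primal →L[ℝ] H1 D.Ω :=
  LinearMap.mkContinuous ⟨⟨φ, add_φ⟩, fun c s => smul_φ s c⟩ 1
    fun s => by simpa using norm_φ_le s

end Primal

/-- The dual Hilbert space `L²_{x,t} × L²_{x,t} × L²_x × L²_x` of tuples
`q = (ρ, m, ρ(·,0), ρ(·,1))`. -/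
abbrev Dual : Type := Quad D.Ω

variable {D} in
abbrev Dual.ρ (q : D.Dual) : Lp ℝ 2 (cylMeasure D.Ω) := q.bulk
variable {D} in
abbrev Dual.m (q : D.Dual) : Lp (Vec d) 2 (cylMeasure D.Ω) := q.field
variable {D} in
abbrev Dual.ρ0 (q : D.Dual) : Lp ℝ 2 (spaceMeasure D.Ω) := q.slice0
variable {D} in
abbrev Dual.ρ1 (q : D.Dual) : Lp ℝ 2 (spaceMeasure D.Ω) := q.slice1

/-! ### The operator `C` -/

/-- The map `h ↦ h(t) ζ(x)` from `L²(0,1)` to `L²(Ω × (0,1))`. -/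
def tensorTime {Ω : Set (Vec d)} {ζ : Vec d → ℝ} (hζ : MemLp ζ 2 (spaceMeasure Ω)) :
    Lp ℝ 2 timeMeasure →L[ℝ] Lp ℝ 2 (cylMeasure Ω) :=
  LinearMap.mkContinuous
    { toFun := fun h => (memLp_tensor hζ (Lp.memLp h)).toLp fun w : Vec d × ℝ => ζ w.1 * h w.2
      map_add' := fun h k => by
        rw [← MemLp.toLp_add]
        refine MemLp.toLp_congr _ _ ?_
        filter_upwards [Measure.quasiMeasurePreserving_snd.ae (Lp.coeFn_add h k)] with w hw
        rw [hw]; simp [mul_add]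
      map_smul' := fun c h => by
        rw [RingHom.id_apply, ← MemLp.toLp_const_smul]
        refine MemLp.toLp_congr _ _ ?_
        filter_upwards [Measure.quasiMeasurePreserving_snd.ae (Lp.coeFn_smul c h)] with w hw
        rw [hw]; simp [mul_left_comm] }
    ‖hζ.toLp ζ‖ (fun h => by
      change ‖(memLp_tensor hζ (Lp.memLp h)).toLp _‖ ≤ _
      have h1 : ‖h‖ ^ 2 = ∫ t, h t ^ 2 ∂timeMeasure := by
        conv_lhs => rw [← Lp.toLp_coeFn h (Lp.memLp h)]
        exact norm_sq_toLp _
      rw [← sq_le_sq₀ (norm_nonneg _) (by positivity), mul_pow, norm_sq_toLp, norm_sq_toLp, h1,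
        ← integral_prod_mul]
      simp [mul_pow])

/-- The map `a ↦ ∑ᵢ aᵢ(t) ζᵢ(x)`. -/
def sumTime : Lp (Vec r) 2 timeMeasure →L[ℝ] Lp ℝ 2 (cylMeasure D.Ω) :=
  ∑ i, (tensorTime (D.memLp_ζ i)).comp
    ((EuclideanSpace.proj i : Vec r →L[ℝ] ℝ).compLpL 2 timeMeasure)

/-- The map `b ↦ ∑ᵢ bᵢ ζᵢ(x)`. -/
def sumSpace : Vec r →L[ℝ] Lp ℝ 2 (spaceMeasure D.Ω) :=
  ∑ i, (EuclideanSpace.proj i : Vec r →L[ℝ] ℝ).smulRight (D.ζL i)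

/-- The bounded linear operator
`C (a, b, α, β, φ) = (-∑ aᵢ ζᵢ - α - φ_t, -∇φ, -φ(·,0), -∑ bᵢ ζᵢ - β + φ(·,1))`. -/
def opC : D.Primal →L[ℝ] D.Dual where
  toFun s := Quad.mk (-(D.sumTime s.a) - s.α - H1.dt s.φ) (-H1.grad s.φ) (-H1.init s.φ)
    (-(D.sumSpace s.b) - s.β + H1.fin s.φ)
  map_add' s s' := by
    refine Quad.ext' ?_ ?_ ?_ ?_ <;> simp [H1.dt, H1.grad, H1.init, H1.fin] <;> abel
  map_smul' c s := by
    refine Quad.ext' ?_ ?_ ?_ ?_ <;>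
      simp [H1.dt, H1.grad, H1.init, H1.fin, smul_sub, smul_add]
  cont := by
    have h1 : Continuous fun s : D.Primal => s.a := Primal.aL.continuous
    have h2 : Continuous fun s : D.Primal => s.b := Primal.bL.continuous
    have h3 : Continuous fun s : D.Primal => s.α := Primal.αL.continuous
    have h4 : Continuous fun s : D.Primal => s.β := Primal.βL.continuous
    have h5 : Continuous fun s : D.Primal => s.φ := Primal.φL.continuous
    refine Quad.continuous_mk ?_ ?_ ?_ ?_ <;> simp only [H1.dt, H1.grad, H1.init, H1.fin] <;>
      fun_prop

/-- The adjoint operator `C*`. -/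
def opCAdj : D.Dual →L[ℝ] D.Primal :=
  ContinuousLinearMap.adjoint D.opC

/-! ### The functionals `U₀, V₀, U₁, V₁, Ξ` and the operators `M, N` -/

/-- `U₀(ρ) = ∫∫ F₀(t, x, ρ(x,t)) dx dt` with the primitive `F₀(t, x, z) = ∫₀ᶻ f₀(t, x, u) du`. -/
def U₀ (ρ : Lp ℝ 2 (cylMeasure D.Ω)) : EReal :=
  eintegral (cylMeasure D.Ω) fun w => ((∫ u in (0 : ℝ)..(ρ w), D.f₀ w.2 w.1 u : ℝ) : EReal)

/-- `V₀(μ) = ∫ G₀(x, μ(x)) dx` with the primitive `G₀(x, z) = ∫₀ᶻ g₀(x, u) du`. -/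
def V₀ (μ : Lp ℝ 2 (spaceMeasure D.Ω)) : EReal :=
  eintegral (spaceMeasure D.Ω) fun x => ((∫ u in (0 : ℝ)..(μ x), D.g₀ x u : ℝ) : EReal)

/-- `U₁(c) = ∫∫ F₁(t, x, ∑ cₚ(t) ζₚ(x)) dx dt` with the primitive
`F₁(t, x, z) = ∫₀ᶻ f₁(t, x, u) du`. -/
def U₁ (c : Lp (Vec r) 2 timeMeasure) : EReal :=
  eintegral (cylMeasure D.Ω) fun w =>
    ((∫ u in (0 : ℝ)..(∑ p, c w.2 p * D.ζ p w.1), D.f₁ w.2 w.1 u : ℝ) : EReal)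

/-- `V₁(w) = ∫ G₁(x, ∑ wₚ ζₚ(x)) dx` with the primitive `G₁(x, z) = ∫₀ᶻ g₁(x, u) du`. -/
def V₁ (w : Vec r) : EReal :=
  eintegral (spaceMeasure D.Ω) fun x =>
    ((∫ u in (0 : ℝ)..(∑ p, w p * D.ζ p x), D.g₁ x u : ℝ) : EReal)

/-- The Lagrangian `L(t, x, v) = sup_p (-v · p - H(t, x, p))`. -/
def L (t : ℝ) (x v : Vec d) : EReal := ⨆ p : Vec d, ((-inner ℝ v p - D.H t x p : ℝ) : EReal)

/-- `Ξ(ρ, m) = ∫∫ ρ L(t, x, m/ρ) dx dt + 1_{ρ(·,0) = ρ₀} + 1_{ρ ≥ 0} + 1_{m ≪ ρ}`, as a function of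
`q = (ρ, m, ρ(·,0), ρ(·,1))`; the integrand is `0` where `ρ = 0`. -/
def Xi (q : D.Dual) : EReal :=
  (eintegral (cylMeasure D.Ω) fun w =>
      if 0 < q.ρ w then ((q.ρ w : ℝ) : EReal) * D.L w.2 w.1 ((q.ρ w)⁻¹ • q.m w) else 0)
    + convexInd (q.ρ0 = D.ρInit)
    + convexInd (∀ᵐ w ∂cylMeasure D.Ω, 0 ≤ q.ρ w)
    + convexInd (∀ᵐ w ∂cylMeasure D.Ω, q.ρ w = 0 → q.m w = 0)

/-- The operator `N = ∂Ξ*`. -/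
def opN : D.Dual → Set D.Dual := subdiff (conj D.Xi)

/-- A matrix acting pointwise in time on `L²(0,1; ℝʳ)`. -/
def matTime (A : Matrix (Fin r) (Fin r) ℝ) :
    Lp (Vec r) 2 timeMeasure →L[ℝ] Lp (Vec r) 2 timeMeasure :=
  (Matrix.toEuclideanCLM (𝕜 := ℝ) A : Vec r →L[ℝ] Vec r).compLpL 2 timeMeasure

/-- A matrix acting on `ℝʳ`. -/
def matVec (A : Matrix (Fin r) (Fin r) ℝ) : Vec r →L[ℝ] Vec r := Matrix.toEuclideanCLM (𝕜 := ℝ) A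

/-- The operator `M(a, b, α, β, φ) = (𝐊⁻¹ ∂U₁*(a), 𝐒⁻¹ ∂V₁*(b), ∂U₀*(α), ∂V₀*(β), 0)`. -/
def opM (s : D.Primal) : Set D.Primal :=
  {u | u.a ∈ matTime D.matK⁻¹ '' subdiff (conj D.U₁) s.a ∧
    u.b ∈ matVec D.matS⁻¹ '' subdiff (conj D.V₁) s.b ∧
    u.α ∈ subdiff (conj D.U₀) s.α ∧
    u.β ∈ subdiff (conj D.V₀) s.β ∧
    u.φ = 0}

/-- The primal inclusion (P): `0 ∈ M s + C*(N(C s))`. -/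
def PrimalInclusion (s : D.Primal) : Prop :=
  (0 : D.Primal) ∈ D.opM s + D.opCAdj '' D.opN (D.opC s)

/-- The inclusions (D): `q ∈ N(C s)` and `-C* q ∈ M s`. -/
def DualInclusion (s : D.Primal) (q : D.Dual) : Prop :=
  q ∈ D.opN (D.opC s) ∧ -(D.opCAdj q) ∈ D.opM s

/-! ### The mean field game systems -/

/-- A way to read the Hamilton-Jacobi equation, as a relation between the value of the density, the
left-hand side and the right-hand side at a point. -/
abbrev HJReading : Type := ℝ → ℝ → ℝ → Prop

/-- The Hamilton-Jacobi equation holds. -/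
def hjExact : HJReading := fun _ lhs rhs => lhs = rhs

/-- The Hamilton-Jacobi equation holds where the density is positive, and is an inequality
elsewhere. -/
def hjVacuum : HJReading := fun ρ lhs rhs => lhs ≤ rhs ∧ (0 < ρ → lhs = rhs)

/-- `∇_p H(t, x, ∇φ(x,t))` at `w = (x, t)`. -/
def gradH (φ : H1 D.Ω) (w : Vec d × ℝ) : Vec d :=
  gradient (fun p => D.H w.2 w.1 p) (H1.grad φ w)

/-- `-φ_t + H(t, x, ∇φ)` at `w = (x, t)`. -/
def hjLhs (φ : H1 D.Ω) (w : Vec d × ℝ) : ℝ := -H1.dt φ w + D.H w.2 w.1 (H1.grad φ w)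

/-- The weak form of `ρ_t + ∇ · m = 0` with end values `ρ0`, `ρ1` and no flux through the lateral
boundary, tested against all functions in `H¹(Ω × (0,1))`. -/
def WeakContinuityEq (ρ : Vec d × ℝ → ℝ) (m : Vec d × ℝ → Vec d) (ρ0 ρ1 : Vec d → ℝ) : Prop :=
  ∀ ψ : H1 D.Ω,
    ∫ w, (H1.dt ψ w * ρ w + inner ℝ (H1.grad ψ w) (m w)) ∂cylMeasure D.Ω
      = (∫ x, H1.fin ψ x * ρ1 x ∂spaceMeasure D.Ω) - ∫ x, H1.init ψ x * ρ0 x ∂spaceMeasure D.Ω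

/-- The projected mean field game system for `φ ∈ H¹` and a density `ρ ≥ 0` in `L²` with end values
`ρ0 = ρ(·,0)`, `ρ1 = ρ(·,1)`; the coupling `f₀(t, x, ρ)` and the flux are required to be in `L²`. -/
structure ProjectedSystem (R : HJReading) (φ : H1 D.Ω) (ρ : Lp ℝ 2 (cylMeasure D.Ω))
    (ρ0 ρ1 : Lp ℝ 2 (spaceMeasure D.Ω)) : Prop where
  nonneg : ∀ᵐ w ∂cylMeasure D.Ω, 0 ≤ ρ w
  memLp_coupling : MemLp (fun w : Vec d × ℝ => D.f₀ w.2 w.1 (ρ w)) 2 (cylMeasure D.Ω)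
  memLp_flux : MemLp (fun w => ρ w • D.gradH φ w) 2 (cylMeasure D.Ω)
  hamiltonJacobi : ∀ᵐ t ∂timeMeasure, ∀ᵐ x ∂spaceMeasure D.Ω,
    R (ρ (x, t)) (D.hjLhs φ (x, t))
      (D.f₀ t x (ρ (x, t)) +
        D.projR (fun x' => D.f₁ t x' (∫ y, D.Kr (x', y) * ρ (y, t) ∂spaceMeasure D.Ω)) x)
  continuity : D.WeakContinuityEq ρ (fun w => -(ρ w • D.gradH φ w)) ρ0 ρ1
  initial : ρ0 = D.ρInit
  terminal : ∀ᵐ x ∂spaceMeasure D.Ω, H1.fin φ x = D.g₀ x (ρ1 x) +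
    D.projR (fun x' => D.g₁ x' (∫ y, D.Sr (x', y) * ρ1 y ∂spaceMeasure D.Ω)) x

/-- The system in the variables `(a, b, α, β, φ)` and `(ρ, m)`, without the compatibility
conditions. -/
structure CoefficientSystem (R : HJReading) (s : D.Primal) (q : D.Dual) : Prop where
  nonneg : ∀ᵐ w ∂cylMeasure D.Ω, 0 ≤ q.ρ w
  hamiltonJacobi : ∀ᵐ w ∂cylMeasure D.Ω,
    R (q.ρ w) (D.hjLhs s.φ w) (s.α w + ∑ i, s.a w.2 i * D.ζ i w.1)
  flux : ∀ᵐ w ∂cylMeasure D.Ω, q.m w = -(q.ρ w • D.gradH s.φ w)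
  initial : q.ρ0 = D.ρInit
  terminal : ∀ᵐ x ∂spaceMeasure D.Ω, H1.fin s.φ x = s.β x + ∑ i, s.b i * D.ζ i x

/-- The compatibility conditions. -/
structure Compatibility (s : D.Primal) (q : D.Dual) : Prop where
  a_eq : ∀ i, ∀ᵐ t ∂timeMeasure, s.a t i =
    ∫ x, D.f₁ t x (∫ y, D.Kr (x, y) * q.ρ (y, t) ∂spaceMeasure D.Ω) * D.ζ i x ∂spaceMeasure D.Ω
  b_eq : ∀ i, s.b i =
    ∫ x, D.g₁ x (∫ y, D.Sr (x, y) * q.ρ1 y ∂spaceMeasure D.Ω) * D.ζ i x ∂spaceMeasure D.Ω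
  α_eq : ∀ᵐ w ∂cylMeasure D.Ω, s.α w = D.f₀ w.2 w.1 (q.ρ w)
  β_eq : ∀ᵐ x ∂spaceMeasure D.Ω, s.β x = D.g₀ x (q.ρ1 x)
  continuity : D.WeakContinuityEq q.ρ q.m q.ρ0 q.ρ1

end MFGData

end

end MFG

open MeasureTheory MFG

/-! Everything rests on explicit descriptions of the operators ∂Ξ*, ∂U₀*, ∂V₀*, ∂U₁*, ∂V₁*, and all
of them are found in the same way. A pointwise convexity inequality shows that an explicit relation
lies in the subdifferential of the functional, so `mem_subdiff_conj` puts its inverse into the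
subdifferential of the conjugate. If this inverse is maximally monotone, it has no proper monotone
extension, and `IsMaximallyMonotone.eq_of_subset` turns the inclusion into equality. No lower
semicontinuity and no interchange of supremum and integral is needed, and maximal monotonicity of N
comes out at once.

Maximality has two sources. For U₀, V₀ and Ξ it is Minty's criterion, which becomes a pointwise
problem. For U₀ and V₀ one solves f(x, s) + s = z (`exists_add_eq`). For Ξ one writes a point as its
projection onto the convex set {(u, v) : u + H(-v) ≤ 0} plus a normal vector; the normal vectors are
exactly (ρ, m) = ρ(1, -∇H(-v)) with ρ ≥ 0, and ρ = 0 off the boundary (`exists_projection`).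
Quadratic growth around the projection makes it measurable (`aemeasurable_minimizer`). For U₁ and V₁
the gradient is an everywhere defined monotone map, continuous along lines (`subdiff_comp`).

At σ = Cs the relation found for Ξ is (2) up to vacuum (`coefficientSystem_iff`). The components of
-C*q are the moments of ρ and ρ(·,1) against the ζᵢ, the functions ρ and ρ(·,1) themselves, and an
element of H¹ that vanishes precisely when the continuity equation holds. Multiplied by 𝐊 and 𝐒, the
moments become the coefficients of the projected nonlocal terms, so that -C*q ∈ Ms is (3)
(`opM_iff`). System (1) is (2)–(3) with the coefficients eliminated, because ℙ_r has the inner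
products with the ζᵢ as coefficients (`projectedSystem_iff`). Finally, M is a product of maximally
monotone operators, the first two being inverses of the operators assumed maximal. -/

namespace MFG

/-! ### Subdifferentials, conjugates and maximally monotone operators. -/

section ConvexAnalysis
variable {V : Type*} [NormedAddCommGroup V] [InnerProductSpace ℝ V]

lemma exists_real_of_mem_subdiff {f : V → EReal} {x p : V} (h : p ∈ subdiff f x) :
    ∃ c : ℝ, f x = c :=
  ⟨(f x).toReal, (EReal.coe_toReal h.2.1 h.1).symm⟩

lemma isMonotoneOp_subdiff (f : V → EReal) : IsMonotoneOp (subdiff f) := by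
  intro x y u hu v hv
  obtain ⟨a, ha⟩ := exists_real_of_mem_subdiff hu
  obtain ⟨b, hb⟩ := exists_real_of_mem_subdiff hv
  have h1 := hu.2.2 y
  have h2 := hv.2.2 x
  rw [ha, hb] at h1 h2
  norm_cast at h1 h2
  have h3 : inner ℝ (x - y) (u - v) = -(inner ℝ u (y - x)) - inner ℝ v (x - y) := by
    rw [← neg_sub x y, inner_neg_right, inner_sub_right, real_inner_comm, real_inner_comm v]
    ring
  linarith

/-- Fenchel–Young: subgradients of `f` invert to subgradients of the conjugate. -/
lemma mem_subdiff_conj {f : V → EReal} {x p : V} (h : p ∈ subdiff f x) :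
    x ∈ subdiff (conj f) p := by
  obtain ⟨a, ha⟩ := exists_real_of_mem_subdiff h
  have hge : ∀ p', ((inner ℝ p' x - a : ℝ) : EReal) ≤ conj f p' := fun p' => by
    refine le_iSup_of_le x ?_
    rw [ha]; norm_cast
  have hval : conj f p = ((inner ℝ p x - a : ℝ) : EReal) := by
    refine le_antisymm (iSup_le fun y => ?_) (hge p)
    have h1 := h.2.2 y
    rw [ha] at h1
    induction hy : f y with
    | bot => rw [hy] at h1; simp [← EReal.coe_add] at h1
    | top => simp
    | coe b =>
      rw [hy] at h1
      norm_cast at h1 ⊢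
      rw [inner_sub_right] at h1
      linarith
  refine ⟨by rw [hval]; exact EReal.coe_ne_bot _, by rw [hval]; exact EReal.coe_ne_top _,
    fun p' => ?_⟩
  refine le_trans (le_of_eq ?_) (hge p')
  rw [hval]
  norm_cast
  rw [inner_sub_right, real_inner_comm x p', real_inner_comm x p]
  ring

/-- Maximality forbids proper monotone extensions. Every subdifferential of a conjugate below is
identified through this. -/
lemma IsMaximallyMonotone.eq_of_subset {A B : V → Set V} (hA : IsMaximallyMonotone A)
    (hB : IsMonotoneOp B) (h : ∀ x, A x ⊆ B x) : B = A := by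
  funext x
  exact Subset.antisymm (fun u hu => hA.2 x u fun y v hv => hB x y u hu v (h y hv)) (h x)

/-- A monotone operator `A` such that `I + A` is onto is maximally monotone. -/
lemma IsMonotoneOp.isMaximallyMonotone_of_surjective {A : V → Set V} (hA : IsMonotoneOp A)
    (h : ∀ z, ∃ x, ∃ u ∈ A x, x + u = z) : IsMaximallyMonotone A := by
  refine ⟨hA, fun x u hxu => ?_⟩
  obtain ⟨y, v, hv, hyv⟩ := h (x + u)
  have h1 := hxu y v hv
  -- Since x + u = y + v, the monotone relation between the two pairs reads -‖x - y‖² ≥ 0.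
  have h2 : u - v = -(x - y) := by
    rw [neg_sub, sub_eq_sub_iff_add_eq_add, add_comm, ← hyv, add_comm]
  rw [h2, inner_neg_right, real_inner_self_eq_norm_sq] at h1
  have h3 : x - y = 0 := by
    rw [← norm_eq_zero, ← sq_eq_zero_iff]
    exact le_antisymm (by linarith) (sq_nonneg _)
  rw [h3, neg_zero, sub_eq_zero] at h2
  rw [sub_eq_zero] at h3
  rwa [h2, h3]

/-- A monotone map that is continuous along lines is maximally monotone. -/
lemma isMaximallyMonotone_singleton {A : V → V}
    (hA : ∀ x y, 0 ≤ inner ℝ (x - y) (A x - A y))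
    (hc : ∀ x h, Filter.Tendsto (fun n : ℕ => inner ℝ (A (x + (1 / ((n : ℝ) + 1)) • h)) h)
      Filter.atTop (nhds (inner ℝ (A x) h))) :
    IsMaximallyMonotone fun x => {A x} := by
  refine ⟨fun x y u hu v hv => by rw [hu, hv]; exact hA x y, fun x u hxu => ?_⟩
  have key : ∀ h, inner ℝ u h ≤ inner ℝ (A x) h := by
    intro h
    refine ge_of_tendsto' (hc x h) fun n => ?_
    -- Minty's trick: compare with a point at distance O(1/n) in the direction h, divide by the step
    -- and let it tend to 0.
    have h1 := hxu (x + (1 / ((n : ℝ) + 1)) • h) _ rfl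
    rw [sub_add_cancel_left, inner_neg_left, real_inner_smul_left, inner_sub_right,
      real_inner_comm, real_inner_comm (A _) h] at h1
    have h2 : (0 : ℝ) < 1 / ((n : ℝ) + 1) := by positivity
    nlinarith
  refine ext_inner_right ℝ fun h => le_antisymm (key h) ?_
  have := key (-h)
  simp only [inner_neg_right] at this
  linarith

/-- A pair in the graph is its own witness, and any other pair is not monotonically related to some
point of the graph. In a product of operators, these witnesses fill the coordinates that are not
under study. -/
lemma IsMaximallyMonotone.exists_inner_nonpos {A : V → Set V} (hA : IsMaximallyMonotone A)
    (x u : V) : ∃ y, ∃ v ∈ A y, inner ℝ (x - y) (u - v) ≤ 0 := by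
  by_cases h : u ∈ A x
  · exact ⟨x, u, h, by simp⟩
  · by_contra! hn
    exact h (hA.2 x u fun y v hv => (hn y v hv).le)

lemma IsMaximallyMonotone.exists_inner_neg {A : V → Set V} (hA : IsMaximallyMonotone A)
    {x u : V} (h : u ∉ A x) : ∃ y, ∃ v ∈ A y, inner ℝ (x - y) (u - v) < 0 := by
  by_contra! hn
  exact h (hA.2 x u hn)

/-- The inverse of a maximally monotone operator is maximally monotone. -/
lemma IsMaximallyMonotone.inverse {A : V → Set V} (hA : IsMaximallyMonotone A) :
    IsMaximallyMonotone fun u => {x | u ∈ A x} := by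
  refine ⟨fun x y u hu v hv => ?_, fun u x h => hA.2 x u fun y v hv => ?_⟩
  · rw [real_inner_comm]; exact hA.1 u v x hu y hv
  · rw [real_inner_comm]; exact h v y hv

end ConvexAnalysis

/-! ### Integrals of extended-real functions. -/

section ExtendedIntegral
variable {X : Type*} [MeasurableSpace X] {μ : Measure X}

lemma eintegral_coe {f : X → ℝ} (hf : Integrable f μ) :
    eintegral μ (fun x => (f x : EReal)) = ((∫ x, f x ∂μ : ℝ) : EReal) := by
  have h1 : ∫⁻ x, ENNReal.ofReal (f x) ∂μ ≠ ⊤ := hf.lintegral_lt_top.ne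
  have h2 : ∫⁻ x, ENNReal.ofReal (-f x) ∂μ ≠ ⊤ := hf.neg.lintegral_lt_top.ne
  rw [integral_eq_lintegral_pos_part_sub_lintegral_neg_part hf, EReal.coe_sub, eintegral,
    EReal.coe_ennreal_toReal h1, EReal.coe_ennreal_toReal h2]
  rfl

/-- Subtraction in `EReal` is monotone even at infinite values, so neither measurability nor
integrability is needed. This allows comparison with Ξ at arbitrary arguments. -/
lemma eintegral_mono_ae {f g : X → EReal} (h : ∀ᵐ x ∂μ, f x ≤ g x) :
    eintegral μ f ≤ eintegral μ g := by
  refine EReal.sub_le_sub ?_ ?_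
  · refine EReal.coe_ennreal_le_coe_ennreal_iff.2 (lintegral_mono_ae ?_)
    filter_upwards [h] with x hx using EReal.toENNReal_le_toENNReal hx
  · refine EReal.coe_ennreal_le_coe_ennreal_iff.2 (lintegral_mono_ae ?_)
    filter_upwards [h] with x hx using EReal.toENNReal_le_toENNReal (EReal.neg_le_neg_iff.2 hx)

lemma eintegral_congr_ae {f g : X → EReal} (h : f =ᵐ[μ] g) : eintegral μ f = eintegral μ g :=
  le_antisymm (eintegral_mono_ae h.le) (eintegral_mono_ae h.symm.le)

end ExtendedIntegral

/-! ### Carathéodory functions and primitives of nondecreasing functions. -/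

section Caratheodory
variable {X : Type*} [MeasurableSpace X] {μ : Measure X}
  {E : Type*}

lemma aemeasurable_comp_simpleFunc {f : X → E → ℝ} (hf : ∀ z, AEMeasurable (fun x => f x z) μ)
    (g : SimpleFunc X E) : AEMeasurable (fun x => f x (g x)) μ := by
  have hU : (⋃ c : g.range, g ⁻¹' {(c : E)}) = univ :=
    eq_univ_of_forall fun x => mem_iUnion.2 ⟨⟨g x, g.mem_range_self x⟩, rfl⟩
  rw [← Measure.restrict_univ (μ := μ), ← hU, aemeasurable_iUnion_iff]
  intro c
  refine (hf c).restrict.congr ?_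
  filter_upwards [ae_restrict_mem (g.measurableSet_preimage _)] with x hx
  rw [show g x = c from hx]

/-- Carathéodory functions are superpositionally measurable. -/
lemma aemeasurable_caratheodory [TopologicalSpace E] {f : X → E → ℝ} (hf : ∀ z, AEMeasurable (fun x => f x z) μ)
    (hc : ∀ᵐ x ∂μ, Continuous (f x)) {z : X → E} (hz : AEStronglyMeasurable z μ) :
    AEMeasurable (fun x => f x (z x)) μ := by
  obtain ⟨z', hz', hzz'⟩ := hz
  have : AEMeasurable (fun x => f x (z' x)) μ := by
    refine aemeasurable_of_tendsto_metrizable_ae (u := Filter.atTop)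
      (f := fun n x => f x (hz'.approx n x))
      (fun n => aemeasurable_comp_simpleFunc hf _) ?_
    filter_upwards [hc] with x hx
    exact (hx.tendsto _).comp (hz'.tendsto_approx x)
  refine this.congr ?_
  filter_upwards [hzz'] with x hx
  rw [hx]

end Caratheodory


section Primitive

/-- The subgradient inequality for the primitive of a nondecreasing function. -/
lemma mul_sub_le_integral_sub_integral {φ : ℝ → ℝ} (hc : Continuous φ) (hm : Monotone φ)
    (z z' : ℝ) : φ z * (z' - z) ≤ (∫ u in (0 : ℝ)..z', φ u) - ∫ u in (0 : ℝ)..z, φ u := by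
  rw [intervalIntegral.integral_interval_sub_left (hc.intervalIntegrable _ _)
    (hc.intervalIntegrable _ _)]
  rcases le_total z z' with h | h
  · have := intervalIntegral.integral_mono_on h (intervalIntegrable_const (μ := volume))
      (hc.intervalIntegrable z z') (fun x hx => hm hx.1)
    simpa [mul_comm] using this
  · have := intervalIntegral.integral_mono_on h (hc.intervalIntegrable z' z)
      (intervalIntegrable_const (μ := volume)) (fun x hx => hm hx.2)
    rw [intervalIntegral.integral_symm]
    simp only [intervalIntegral.integral_const, smul_eq_mul] at this
    linarith

/-- The subgradient inequality, used from 0 to z and from z to 0, traps the primitive between φ(0)z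
and φ(z)z. -/
lemma abs_integral_zero_le {φ : ℝ → ℝ} (hc : Continuous φ) (hm : Monotone φ) (z : ℝ) :
    |∫ u in (0 : ℝ)..z, φ u| ≤ |φ 0 * z| + |φ z * z| := by
  have h1 := mul_sub_le_integral_sub_integral hc hm 0 z
  have h2 := mul_sub_le_integral_sub_integral hc hm z 0
  simp only [intervalIntegral.integral_same, sub_zero, zero_sub] at h1 h2
  rw [abs_le]
  constructor
  · linarith [neg_abs_le (φ 0 * z), abs_nonneg (φ z * z)]
  · linarith [le_abs_self (φ z * z), abs_nonneg (φ 0 * z)]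

end Primitive

/-- Carathéodory functions that are nondecreasing in the last variable, with `f(·, 0) ∈ L²`. -/
structure IsMonotoneCaratheodory {X : Type*} [MeasurableSpace X] (μ : Measure X)
    (f : X → ℝ → ℝ) : Prop where
  aemeasurable : ∀ z, AEMeasurable (fun x => f x z) μ
  continuous : ∀ᵐ x ∂μ, Continuous (f x)
  monotone : ∀ᵐ x ∂μ, Monotone (f x)
  memLp_zero : MemLp (fun x => f x 0) 2 μ

/-! ### Superposition operators and the subdifferentials of their integral functionals. -/

namespace IsMonotoneCaratheodory
variable {X : Type*} [MeasurableSpace X] {μ : Measure X} {f : X → ℝ → ℝ}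

/-- Rescaling writes the primitive as z(x) ∫₀¹ f(x, z(x)u) du, a parameter integral over a fixed
interval, to which Fubini's measurability statement applies. -/
lemma aestronglyMeasurable_primitive [SFinite μ] (hf : IsMonotoneCaratheodory μ f) {z : X → ℝ}
    (hz : AEStronglyMeasurable z μ) :
    AEStronglyMeasurable (fun x => ∫ u in (0 : ℝ)..z x, f x u) μ := by
  have h1 : AEMeasurable (fun p : X × ℝ => f p.1 (z p.1 * p.2))
      (μ.prod (volume.restrict (Ioc (0 : ℝ) 1))) :=
    aemeasurable_caratheodory (f := fun (p : X × ℝ) u => f p.1 u)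
      (fun z => (hf.aemeasurable z).comp_fst)
      (Measure.quasiMeasurePreserving_fst.ae hf.continuous)
      (hz.comp_fst.mul measurable_snd.aestronglyMeasurable)
  have h2 := hz.mul h1.aestronglyMeasurable.integral_prod_right'
  refine h2.congr (Filter.Eventually.of_forall fun x => ?_)
  have h3 := intervalIntegral.smul_integral_comp_mul_left (a := 0) (b := 1) (f x) (z x)
  simp only [mul_zero, mul_one, smul_eq_mul] at h3
  rw [intervalIntegral.integral_of_le zero_le_one] at h3
  exact h3

lemma integrable_primitive [SFinite μ] (hf : IsMonotoneCaratheodory μ f) {z : X → ℝ}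
    (hz : MemLp z 2 μ) (hfz : MemLp (fun x => f x (z x)) 2 μ) :
    Integrable (fun x => ∫ u in (0 : ℝ)..z x, f x u) μ := by
  have h1 : Integrable (fun x => |f x 0 * z x| + |f x (z x) * z x|) μ :=
    (hf.memLp_zero.integrable_mul hz).abs.add (hfz.integrable_mul hz).abs
  refine h1.mono' (hf.aestronglyMeasurable_primitive hz.1) ?_
  filter_upwards [hf.continuous, hf.monotone] with x hc hm using abs_integral_zero_le hc hm _

/-- The superposition operator is contained in the subdifferential of the integral functional. -/
lemma mem_subdiff [SFinite μ] (hf : IsMonotoneCaratheodory μ f)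
    {E : Type*} [NormedAddCommGroup E] [InnerProductSpace ℝ E] (T : E →L[ℝ] Lp ℝ 2 μ)
    {Φ : E → EReal}
    (hΦ : ∀ c, Φ c = eintegral μ fun x => ((∫ u in (0 : ℝ)..T c x, f x u : ℝ) : EReal))
    {c p : E} {n : Lp ℝ 2 μ} (hn : ∀ᵐ x ∂μ, n x = f x (T c x))
    (hp : ∀ h, inner ℝ p h = inner ℝ n (T h)) : p ∈ subdiff Φ c := by
  have hint := hf.integrable_primitive (Lp.memLp (T c)) ((Lp.memLp n).ae_eq hn)
  have hval := hΦ c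
  rw [eintegral_coe hint] at hval
  refine ⟨by rw [hval]; exact EReal.coe_ne_bot _, by rw [hval]; exact EReal.coe_ne_top _,
    fun y => ?_⟩
  have hin := L2.integrable_inner (𝕜 := ℝ) n (T (y - c))
  rw [hval, hp, L2.inner_def, ← EReal.coe_add, ← integral_add hint hin,
    hΦ]
  refine (eintegral_coe (hint.add hin)).symm.le.trans (eintegral_mono_ae ?_)
  have h1 := Lp.coeFn_sub (T y) (T c)
  rw [← map_sub] at h1
  filter_upwards [hf.continuous, hf.monotone, hn, h1] with x hc hm hnx hx
  rw [EReal.coe_le_coe_iff, Pi.add_apply, hx, hnx]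
  have := mul_sub_le_integral_sub_integral hc hm (T c x) (T y x)
  simp only [Pi.sub_apply, RCLike.inner_apply, conj_trivial]
  linarith

/-- The resolvent of the superposition operator. -/
lemma exists_add_eq (hf : IsMonotoneCaratheodory μ f) (z : Lp ℝ 2 μ) :
    ∃ n ρ : Lp ℝ 2 μ, (∀ᵐ x ∂μ, n x = f x (ρ x)) ∧ n + ρ = z := by
  -- By monotonicity, s ↦ f(x, s) + s lies above f(x, 0) + s for s ≥ 0 and below it for s ≤ 0; hence
  -- it is onto.
  have hsurj : ∀ x, Continuous (f x) → Monotone (f x) → ∃ s, f x s + s = z x := by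
    intro x hc hm
    have hg : Continuous fun s => f x s + s := hc.add continuous_id
    refine hg.surjective ?_ ?_ (z x)
    · refine Filter.tendsto_atTop_mono' _ ?_
        (Filter.tendsto_atTop_add_const_left _ (f x 0) Filter.tendsto_id)
      filter_upwards [Filter.eventually_ge_atTop 0] with s hs
      exact add_le_add_left (hm hs) _
    · refine Filter.tendsto_atBot_mono' _ ?_
        (Filter.tendsto_atBot_add_const_left _ (f x 0) Filter.tendsto_id)
      filter_upwards [Filter.eventually_le_atBot 0] with s hs
      exact add_le_add_left (hm hs) _
  classical
  have hR : ∃ R : X → ℝ, ∀ᵐ x ∂μ, f x (R x) + R x = z x := by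
    refine ⟨fun x => if h : ∃ s, f x s + s = z x then h.choose else 0, ?_⟩
    filter_upwards [hf.continuous, hf.monotone] with x hc hm
    rw [dif_pos (hsurj x hc hm)]
    exact (hsurj x hc hm).choose_spec
  obtain ⟨R, hR⟩ := hR
  have hRm : AEMeasurable R μ := by
    rw [← aestronglyMeasurable_iff_aemeasurable, aestronglyMeasurable_iff_nullMeasurable_separable]
    refine ⟨?_, univ, TopologicalSpace.IsSeparable.of_separableSpace _, by simp⟩
    refine measurable_of_Iic (α := ℝ) (δ := NullMeasurableSpace X μ) fun s => ?_
    -- R is picked by choice, but s ↦ f(x, s) + s is strictly increasing, so {R ≤ s} agrees up to a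
    -- null set with a set defined from the data alone.
    have h1 : NullMeasurableSet {x | z x ≤ f x s + s} μ :=
      nullMeasurableSet_le (Lp.aestronglyMeasurable z).aemeasurable
        ((hf.aemeasurable s).add_const s)
    refine h1.congr ?_
    filter_upwards [hR, hf.monotone] with x hx hm
    refine propext ⟨fun h : z x ≤ f x s + s => ?_, fun h : R x ≤ s => ?_⟩
    · by_contra hn
      have hn' : s < R x := not_le.1 hn
      linarith [hm hn'.le]
    · change z x ≤ f x s + s
      linarith [hm h]
  have hRL : MemLp R 2 μ := by
    -- R and f(·, R) - f(·, 0) have the same sign and their sum is z - f(·, 0), so |R| ≤ |z - f(·,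
    -- 0)|.
    refine ((Lp.memLp z).sub hf.memLp_zero).mono hRm.aestronglyMeasurable ?_
    filter_upwards [hR, hf.monotone] with x hx hm
    rw [Real.norm_eq_abs, Real.norm_eq_abs, Pi.sub_apply]
    rcases le_total 0 (R x) with h | h
    · rw [abs_of_nonneg h]
      exact le_trans (by linarith [hm h]) (le_abs_self _)
    · rw [abs_of_nonpos h]
      exact le_trans (by linarith [hm h]) (neg_le_abs _)
  refine ⟨z - hRL.toLp R, hRL.toLp R, ?_, sub_add_cancel _ _⟩
  filter_upwards [Lp.coeFn_sub z (hRL.toLp R), hRL.coeFn_toLp, hR] with x h1 h2 h3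
  rw [h1, Pi.sub_apply, h2, ← h3]
  ring

/-- The inverse of the superposition operator lies in the subdifferential of the conjugate and
satisfies Minty's range condition by `exists_add_eq`, so the two coincide. The operator itself need
not map all of L² into L². -/
lemma mem_subdiff_conj [SFinite μ] (hf : IsMonotoneCaratheodory μ f) {Φ : Lp ℝ 2 μ → EReal}
    (hΦ : ∀ ρ, Φ ρ = eintegral μ fun x => ((∫ u in (0 : ℝ)..ρ x, f x u : ℝ) : EReal)) :
    IsMaximallyMonotone (subdiff (conj Φ)) ∧
      ∀ n ρ : Lp ℝ 2 μ, ρ ∈ subdiff (conj Φ) n ↔ ∀ᵐ x ∂μ, n x = f x (ρ x) := by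
  have hsub : ∀ n : Lp ℝ 2 μ, {ρ : Lp ℝ 2 μ | ∀ᵐ x ∂μ, n x = f x (ρ x)} ⊆ subdiff (conj Φ) n :=
    fun n ρ h => MFG.mem_subdiff_conj
      (hf.mem_subdiff (ContinuousLinearMap.id ℝ _) hΦ h fun _ => rfl)
  have hmax : IsMaximallyMonotone fun n : Lp ℝ 2 μ =>
      {ρ : Lp ℝ 2 μ | ∀ᵐ x ∂μ, n x = f x (ρ x)} := by
    refine IsMonotoneOp.isMaximallyMonotone_of_surjective ?_ fun z => ?_
    · exact fun x y u hu v hv => isMonotoneOp_subdiff _ x y u (hsub x hu) v (hsub y hv)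
    · obtain ⟨n, ρ, h, e⟩ := hf.exists_add_eq z
      exact ⟨n, ρ, h, e⟩
  have heq := hmax.eq_of_subset (isMonotoneOp_subdiff (conj Φ)) hsub
  rw [heq]
  exact ⟨hmax, fun n ρ => Iff.rfl⟩

/-- No growth condition on f is needed: by monotonicity, f(x, z + sh) for 0 ≤ s ≤ 1 lies between
f(x, z) and f(x, z + h), which are both in L² and provide the dominating function. -/
lemma tendsto_integral_superposition (hf : IsMonotoneCaratheodory μ f) {z h : X → ℝ}
    (hzm : AEStronglyMeasurable z μ) (hh : MemLp h 2 μ)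
    (hz : MemLp (fun x => f x (z x)) 2 μ) (hzh : MemLp (fun x => f x (z x + h x)) 2 μ) :
    Filter.Tendsto (fun n : ℕ => ∫ x, f x (z x + 1 / ((n : ℝ) + 1) * h x) * h x ∂μ)
      Filter.atTop (nhds (∫ x, f x (z x) * h x ∂μ)) := by
  refine tendsto_integral_of_dominated_convergence
    (fun x => |f x (z x) * h x| + |f x (z x + h x) * h x|) (fun n => ?_)
    ((hz.integrable_mul hh).abs.add (hzh.integrable_mul hh).abs) (fun n => ?_) ?_
  · exact (aemeasurable_caratheodory hf.aemeasurable hf.continuous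
      (hzm.add (hh.1.const_mul _))).aestronglyMeasurable.mul hh.1
  · filter_upwards [hf.monotone] with x hm
    rw [Real.norm_eq_abs, abs_mul, abs_mul, abs_mul, ← add_mul]
    refine mul_le_mul_of_nonneg_right ?_ (abs_nonneg _)
    have h0 : (0 : ℝ) < 1 / ((n : ℝ) + 1) := by positivity
    have h1 : 1 / ((n : ℝ) + 1) ≤ 1 := by
      rw [div_le_one (by positivity)]
      linarith [n.cast_nonneg (α := ℝ)]
    have := abs_nonneg (f x (z x)); have := abs_nonneg (f x (z x + h x))
    have := le_abs_self (f x (z x)); have := le_abs_self (f x (z x + h x))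
    have := neg_abs_le (f x (z x)); have := neg_abs_le (f x (z x + h x))
    rw [abs_le]
    rcases le_total 0 (h x) with hs | hs
    · have m1 := hm (show z x ≤ z x + 1 / ((n : ℝ) + 1) * h x by nlinarith)
      have m2 := hm (show z x + 1 / ((n : ℝ) + 1) * h x ≤ z x + h x by nlinarith)
      constructor <;> linarith
    · have m1 := hm (show z x + 1 / ((n : ℝ) + 1) * h x ≤ z x by nlinarith)
      have m2 := hm (show z x + h x ≤ z x + 1 / ((n : ℝ) + 1) * h x by nlinarith)
      constructor <;> linarith
  · filter_upwards [hf.continuous] with x hc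
    refine Filter.Tendsto.mul_const _ ((hc.tendsto _).comp ?_)
    have h1 := ((tendsto_one_div_add_atTop_nhds_zero_nat (𝕜 := ℝ)).mul_const (h x)).const_add (z x)
    simpa using h1

/-- Here the L² hypothesis holds on the whole range of T, so the gradient T*f(·, Tc) is defined
everywhere, and hemicontinuity replaces Minty's range condition. One maximality statement identifies
the subdifferential; its inverse identifies that of the conjugate. -/
lemma subdiff_comp [SFinite μ] (hf : IsMonotoneCaratheodory μ f)
    {E : Type*} [NormedAddCommGroup E] [InnerProductSpace ℝ E] [CompleteSpace E]
    (T : E →L[ℝ] Lp ℝ 2 μ) (hT : ∀ c, MemLp (fun x => f x (T c x)) 2 μ) {Φ : E → EReal}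
    (hΦ : ∀ c, Φ c = eintegral μ fun x => ((∫ u in (0 : ℝ)..T c x, f x u : ℝ) : EReal)) :
    (∀ c, subdiff Φ c = {ContinuousLinearMap.adjoint T ((hT c).toLp _)}) ∧
      ∀ p, subdiff (conj Φ) p = {c | p = ContinuousLinearMap.adjoint T ((hT c).toLp _)} := by
  have hsub : ∀ c, ({ContinuousLinearMap.adjoint T ((hT c).toLp _)} : Set E) ⊆ subdiff Φ c := by
    rintro c _ rfl
    exact hf.mem_subdiff T hΦ (hT c).coeFn_toLp fun h => T.adjoint_inner_left _ _
  have hmax : IsMaximallyMonotone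
      fun c => ({ContinuousLinearMap.adjoint T ((hT c).toLp _)} : Set E) := by
    refine isMaximallyMonotone_singleton (fun x y => ?_) fun c h => ?_
    · exact isMonotoneOp_subdiff _ x y _ (hsub x rfl) _ (hsub y rfl)
    · simp only [ContinuousLinearMap.adjoint_inner_left]
      have key : ∀ c h : E, inner ℝ ((hT c).toLp _) (T h) = ∫ x, f x (T c x) * T h x ∂μ := by
        intro c h
        rw [L2.inner_def]
        refine integral_congr_ae ?_
        filter_upwards [(hT c).coeFn_toLp] with x hx
        rw [hx]
        simp [mul_comm]
      have hadd : ∀ (k : ℝ), ∀ᵐ x ∂μ, T (c + k • h) x = T c x + k * T h x := by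
        intro k
        rw [map_add, map_smul]
        filter_upwards [Lp.coeFn_add (T c) (k • T h), Lp.coeFn_smul k (T h)] with x h1 h2
        rw [h1, Pi.add_apply, h2]
        rfl
      have hzh : MemLp (fun x => f x (T c x + T h x)) 2 μ := by
        refine (hT (c + (1 : ℝ) • h)).ae_eq ?_
        filter_upwards [hadd 1] with x hx
        rw [hx, one_mul]
      rw [key]
      refine (hf.tendsto_integral_superposition (Lp.aestronglyMeasurable _) (Lp.memLp (T h))
        (hT c) hzh).congr fun n => ?_
      rw [key]
      refine integral_congr_ae ?_
      filter_upwards [hadd (1 / ((n : ℝ) + 1))] with x hx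
      rw [hx]
  refine ⟨fun c => congrFun (hmax.eq_of_subset (isMonotoneOp_subdiff Φ) hsub) c, fun p => ?_⟩
  exact congrFun (hmax.inverse.eq_of_subset (isMonotoneOp_subdiff (conj Φ))
    fun p c hp => MFG.mem_subdiff_conj (hsub c hp)) p

end IsMonotoneCaratheodory


/-! ### The pointwise resolvent of the Hamiltonian relation, and its measurability. -/

section Projection

lemma nonneg_of_forall_add_mul {X Y : ℝ} (h : ∀ s, 0 < s → s ≤ 1 → 0 ≤ X + s * Y) : 0 ≤ X := by
  have h1 := ((tendsto_one_div_add_atTop_nhds_zero_nat (𝕜 := ℝ)).mul_const Y).const_add X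
  rw [zero_mul, add_zero] at h1
  refine ge_of_tendsto' h1 fun n => h _ (by positivity) ?_
  rw [div_le_one (by positivity)]
  linarith [n.cast_nonneg (α := ℝ)]

variable {E : Type*} [NormedAddCommGroup E] [InnerProductSpace ℝ E] [FiniteDimensional ℝ E]

/-- The projection of `(a, v)` onto the convex set `{(s, e) | s + h(-e) ≤ 0}` is `(a - ρ, p)` with
`ρ = (a + h(-p))⁺`, and `v - p = -ρ ∇h(-p)`. -/
lemma exists_projection {h : E → ℝ} (hconv : ConvexOn ℝ univ h) (hd : Differentiable ℝ h)
    (a : ℝ) (v : E) :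
    ∃ p : E, v - p = -(max (a + h (-p)) 0 • gradient h (-p)) ∧
      ∀ e, ‖e - p‖ ^ 2 + (max (a + h (-p)) 0 ^ 2 + ‖v - p‖ ^ 2)
        ≤ max (a + h (-e)) 0 ^ 2 + ‖v - e‖ ^ 2 := by
  have hc : Continuous fun e => max (a + h (-e)) 0 ^ 2 + ‖v - e‖ ^ 2 := by
    have := hd.continuous
    fun_prop
  obtain ⟨p, hp⟩ := hc.exists_forall_le (by
    refine Filter.tendsto_atTop_mono (fun e => le_add_of_nonneg_left (sq_nonneg _)) ?_
    refine (Filter.tendsto_pow_atTop two_ne_zero).comp ?_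
    refine Filter.tendsto_atTop_mono (fun e => ?_)
      (Filter.tendsto_atTop_add_const_right _ (-‖v‖) (tendsto_norm_cocompact_atTop (E := E)))
    rw [norm_sub_rev]
    linarith [norm_sub_norm_le e v])
  -- The first-order optimality condition: move from p towards e by a fraction s, bound the positive
  -- part by convexity, divide by s and let s tend to 0.
  have key : ∀ e, inner ℝ (v - p) (e - p)
      ≤ max (a + h (-p)) 0 * (max (a + h (-e)) 0 - max (a + h (-p)) 0) := by
    intro e
    set A := max (a + h (-p)) 0
    set B := max (a + h (-e)) 0
    suffices 0 ≤ 2 * (A * (B - A) - inner ℝ (v - p) (e - p)) by linarith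
    refine nonneg_of_forall_add_mul (Y := (B - A) ^ 2 + ‖e - p‖ ^ 2) fun s hs hs1 => ?_
    have h1 := hp (p + s • (e - p))
    have h2 : max (a + h (-(p + s • (e - p)))) 0 ≤ (1 - s) * A + s * B := by
      have hA : a + h (-p) ≤ A := le_max_left _ _
      have hB : a + h (-e) ≤ B := le_max_left _ _
      have hA0 : 0 ≤ A := le_max_right _ _
      have hB0 : 0 ≤ B := le_max_right _ _
      refine max_le ?_ (by nlinarith)
      have h3 := hconv.2 (mem_univ (-p)) (mem_univ (-e)) (sub_nonneg.2 hs1) hs.le (by ring)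
      have h4 : -(p + s • (e - p)) = (1 - s) • (-p) + s • (-e) := by module
      rw [h4]
      simp only [smul_eq_mul] at h3
      nlinarith
    have h3 : max (a + h (-(p + s • (e - p)))) 0 ^ 2 ≤ ((1 - s) * A + s * B) ^ 2 :=
      pow_le_pow_left₀ (le_max_right _ _) h2 2
    have h4 : ‖v - (p + s • (e - p))‖ ^ 2
        = ‖v - p‖ ^ 2 - 2 * s * inner ℝ (v - p) (e - p) + s ^ 2 * ‖e - p‖ ^ 2 := by
      rw [← sub_sub, norm_sub_sq_real, inner_smul_right, norm_smul, mul_pow, Real.norm_eq_abs,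
        sq_abs]
      ring
    simp only [h4] at h1
    have h5 : 0 ≤ s * (2 * (A * (B - A) - inner ℝ (v - p) (e - p)) + s * ((B - A) ^ 2
        + ‖e - p‖ ^ 2)) := by
      change A ^ 2 + ‖v - p‖ ^ 2 ≤ _ at h1
      nlinarith
    exact nonneg_of_mul_nonneg_right h5 hs
  refine ⟨p, ?_, fun e => ?_⟩
  · set ρ := max (a + h (-p)) 0 with hρ
    have hmin : IsLocalMin (fun e => ρ * h (-e) - inner ℝ (v - p) e) p := by
      -- Near p the positive part can be dropped: either its weight ρ is 0, or a + h(-p) > 0, which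
      -- persists by continuity. The condition thus becomes a differentiable one.
      have hev : ∀ᶠ e in nhds p, ρ * max (a + h (-e)) 0 = ρ * (a + h (-e)) := by
        rcases (le_max_right (a + h (-p)) 0).eq_or_lt with h0 | h0
        · have : ρ = 0 := by rw [hρ, ← h0]
          exact Filter.Eventually.of_forall fun e => by rw [this]; ring
        · have h1 : 0 < a + h (-p) := by
            by_contra hn
            rw [max_eq_right (not_lt.1 hn)] at h0
            exact lt_irrefl _ h0
          have h2 : Continuous fun e => a + h (-e) := by
            have := hd.continuous
            fun_prop
          filter_upwards [h2.continuousAt.eventually_const_lt h1] with e he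
          rw [max_eq_left he.le]
      have hev0 := hev.self_of_nhds
      filter_upwards [hev] with e he
      have := key e
      rw [mul_sub, he] at this
      rw [← hρ] at hev0
      rw [hev0, inner_sub_right] at this
      linarith
    have hg : HasFDerivAt (fun e => ρ * h (-e) - inner ℝ (v - p) e)
        (ρ • ((fderiv ℝ h (-p)).comp (-ContinuousLinearMap.id ℝ E)) - innerSL ℝ (v - p)) p := by
      refine HasFDerivAt.sub ?_ (innerSL ℝ (v - p)).hasFDerivAt
      exact ((hd (-p)).hasFDerivAt.comp p (hasFDerivAt_id p).neg).const_mul ρ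
    have h0 := hmin.hasFDerivAt_eq_zero hg
    refine ext_inner_right ℝ fun w => ?_
    have h1 := DFunLike.congr_fun h0 w
    have h2 : inner ℝ (gradient h (-p)) w = fderiv ℝ h (-p) w := by
      rw [gradient, InnerProductSpace.toDual_symm_apply]
    rw [inner_neg_left, real_inner_smul_left, h2]
    simp only [sub_apply, smul_apply, ContinuousLinearMap.comp_apply, neg_apply,
      ContinuousLinearMap.id_apply, map_neg, innerSL_apply_apply, zero_apply, smul_eq_mul] at h1
    linarith
  · have h1 := key e
    -- Expanding around p and using `key`, the excess over the claimed bound is at least the square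
    -- of the difference of the two positive parts.
    have h2 : ‖v - e‖ ^ 2 = ‖v - p‖ ^ 2 - 2 * inner ℝ (v - p) (e - p) + ‖e - p‖ ^ 2 := by
      rw [← norm_sub_sq_real]
      congr 2
      abel
    nlinarith [sq_nonneg (max (a + h (-e)) 0 - max (a + h (-p)) 0)]

end Projection

section Selection
variable {X : Type*} [MeasurableSpace X] {μ : Measure X}
  {E : Type*} [NormedAddCommGroup E] [MeasurableSpace E] [BorelSpace E]

/-- Well-posed minimizers of a measurable family of functions depend measurably on the
parameter. -/
lemma aemeasurable_minimizer {j : ℕ → X → ℝ} (hj : ∀ k, AEMeasurable (j k) μ) (e : ℕ → E)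
    {J : X → ℝ} {p : X → E} (h1 : ∀ᵐ x ∂μ, ∀ k, ‖e k - p x‖ ^ 2 + J x ≤ j k x)
    (h2 : ∀ᵐ x ∂μ, ∀ ε > 0, ∃ k, j k x < J x + ε) : AEMeasurable p μ := by
  classical
  have hJ : AEMeasurable J μ := by
    refine (AEMeasurable.iInf hj).congr ?_
    filter_upwards [h1, h2] with x hx1 hx2
    refine ciInf_eq_of_forall_ge_of_forall_gt_exists_lt (fun k => ?_) fun w hw => ?_
    · linarith [hx1 k, sq_nonneg ‖e k - p x‖]
    · obtain ⟨k, hk⟩ := hx2 (w - J x) (sub_pos.2 hw)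
      exact ⟨k, by linarith⟩
  let P : ℕ → X → ℕ → Prop := fun n x k => (hj k).mk _ x < hJ.mk _ x + 1 / ((n : ℝ) + 1)
  have hP : ∀ n k, MeasurableSet {x | P n x k} := fun n k =>
    measurableSet_lt (hj k).measurable_mk (hJ.measurable_mk.add_const _)
  -- The second alternative only makes the search for the first near-minimizer total; it is used on
  -- a null set at most.
  let Q : ℕ → X → ℕ → Prop := fun n x k => P n x k ∨ ∀ l, ¬ P n x l
  have hQ : ∀ n x, ∃ k, Q n x k := fun n x => by
    by_cases hx : ∃ k, P n x k
    · exact hx.imp fun k hk => Or.inl hk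
    · exact ⟨0, Or.inr (not_exists.1 hx)⟩
  have hQm : ∀ n k, MeasurableSet {x | Q n x k} := fun n k => by
    have : {x | Q n x k} = {x | P n x k} ∪ ⋂ l, {x | P n x l}ᶜ := by
      ext x; simp [Q]
    rw [this]
    exact (hP n k).union (MeasurableSet.iInter fun l => (hP n l).compl)
  refine aemeasurable_of_tendsto_metrizable_ae (u := Filter.atTop)
    (f := fun n x => e (Nat.find (hQ n x)))
    (fun n => (measurable_from_nat.comp (measurable_find (hQ n) (hQm n))).aemeasurable) ?_
  filter_upwards [h1, h2, hJ.ae_eq_mk, ae_all_iff.2 fun k => (hj k).ae_eq_mk] with x hx1 hx2 e1 e2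
  -- Quadratic growth makes near-minimizers close to p, so p is an a.e. limit of measurable
  -- selections with values in a countable set.
  have hb : ∀ n : ℕ, ‖e (Nat.find (hQ n x)) - p x‖ ^ 2 ≤ 1 / ((n : ℝ) + 1) := by
    intro n
    have hk : P n x (Nat.find (hQ n x)) := by
      refine (Nat.find_spec (hQ n x)).resolve_right fun hn => ?_
      obtain ⟨k, hk⟩ := hx2 (1 / ((n : ℝ) + 1)) (by positivity)
      exact hn k (by simpa only [P, ← e1, ← e2] using hk)
    simp only [P, ← e1, ← e2] at hk
    linarith [hx1 (Nat.find (hQ n x))]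
  rw [tendsto_iff_norm_sub_tendsto_zero]
  have h3 : Filter.Tendsto (fun n : ℕ => ‖e (Nat.find (hQ n x)) - p x‖ ^ 2) Filter.atTop (nhds 0) :=
    squeeze_zero (fun n => sq_nonneg _) hb tendsto_one_div_add_atTop_nhds_zero_nat
  have h4 := (Real.continuous_sqrt.tendsto 0).comp h3
  simpa [Function.comp_def] using h4

end Selection

section Hamiltonian
variable {X : Type*} [MeasurableSpace X] {μ : Measure X}
  {E : Type*} [NormedAddCommGroup E] [InnerProductSpace ℝ E] [FiniteDimensional ℝ E]
  [MeasurableSpace E] [BorelSpace E]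

/-- The relation `m = -ρ ∇H(-v)`, `u + H(-v) ≤ 0` with equality where `ρ > 0`, for `ρ ≥ 0`. -/
structure IsHamiltonianPair (μ : Measure X) (H : X → E → ℝ) (u : X → ℝ) (v : X → E)
    (ρ : X → ℝ) (m : X → E) : Prop where
  nonneg : ∀ᵐ x ∂μ, 0 ≤ ρ x
  le : ∀ᵐ x ∂μ, u x + H x (-v x) ≤ 0
  eq : ∀ᵐ x ∂μ, 0 < ρ x → u x + H x (-v x) = 0
  flux : ∀ᵐ x ∂μ, m x = -(ρ x • gradient (H x) (-v x))

/-- The relation `IsHamiltonianPair` satisfies Minty's range condition. -/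
lemma exists_isHamiltonianPair_add_eq {H : X → E → ℝ}
    (hm : ∀ p, AEMeasurable (fun x => H x p) μ) (hconv : ∀ᵐ x ∂μ, ConvexOn ℝ univ (H x))
    (hd : ∀ᵐ x ∂μ, Differentiable ℝ (H x)) (h0 : MemLp (fun x => H x 0) 2 μ)
    (a : Lp ℝ 2 μ) (b : Lp E 2 μ) :
    ∃ (u : Lp ℝ 2 μ) (v : Lp E 2 μ) (ρ : Lp ℝ 2 μ) (m : Lp E 2 μ),
      IsHamiltonianPair μ H u v ρ m ∧ u + ρ = a ∧ v + m = b := by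
  classical
  obtain ⟨p, hp⟩ : ∃ p : X → E, ∀ᵐ x ∂μ,
      b x - p x = -(max (a x + H x (-p x)) 0 • gradient (H x) (-p x)) ∧
      ∀ e, ‖e - p x‖ ^ 2 + (max (a x + H x (-p x)) 0 ^ 2 + ‖b x - p x‖ ^ 2)
        ≤ max (a x + H x (-e)) 0 ^ 2 + ‖b x - e‖ ^ 2 := by
    refine ⟨fun x => if h : ConvexOn ℝ univ (H x) ∧ Differentiable ℝ (H x) then
      (exists_projection h.1 h.2 (a x) (b x)).choose else 0, ?_⟩
    filter_upwards [hconv, hd] with x h1 h2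
    rw [dif_pos ⟨h1, h2⟩]
    exact (exists_projection h1 h2 (a x) (b x)).choose_spec
  have ham := (Lp.aestronglyMeasurable a).aemeasurable
  have hbm := (Lp.aestronglyMeasurable b).aemeasurable
  -- p was picked by choice at each point; the quadratic growth from `exists_projection` and a dense
  -- sequence of competitors make it measurable.
  have hpm : AEMeasurable p μ := by
    refine aemeasurable_minimizer
      (j := fun k x => max (a x + H x (-TopologicalSpace.denseSeq E k)) 0 ^ 2
        + ‖b x - TopologicalSpace.denseSeq E k‖ ^ 2)
      (J := fun x => max (a x + H x (-p x)) 0 ^ 2 + ‖b x - p x‖ ^ 2)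
      (fun k => ?_) (TopologicalSpace.denseSeq E) ?_ ?_
    · have := hm (-TopologicalSpace.denseSeq E k)
      fun_prop
    · filter_upwards [hp] with x hx k using hx.2 _
    · filter_upwards [hd] with x hx ε hε
      have hc : Continuous fun e => max (a x + H x (-e)) 0 ^ 2 + ‖b x - e‖ ^ 2 := by
        have := hx.continuous
        fun_prop
      have hopen := hc.isOpen_preimage _ (isOpen_Iio
        (a := max (a x + H x (-p x)) 0 ^ 2 + ‖b x - p x‖ ^ 2 + ε))
      obtain ⟨k, hk⟩ := (TopologicalSpace.denseRange_denseSeq E).exists_mem_open hopen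
        ⟨p x, by simpa using hε⟩
      exact ⟨k, hk⟩
  have hρm : AEMeasurable (fun x => max (a x + H x (-p x)) 0) μ :=
    (ham.add (aemeasurable_caratheodory (f := fun x e => H x e) hm
      (hd.mono fun x hx => hx.continuous)
      hpm.neg.aestronglyMeasurable)).max aemeasurable_const
  -- Comparison of the minimum with the competitor e = 0; the bound is in L² because H(·, 0) is.
  have hbound : ∀ᵐ x ∂μ, max (a x + H x (-p x)) 0 ^ 2 + ‖b x - p x‖ ^ 2
      ≤ (|a x + H x 0| + ‖b x‖) ^ 2 := by
    filter_upwards [hp] with x hx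
    have h1 := hx.2 0
    rw [neg_zero, sub_zero] at h1
    have h2 : max (a x + H x 0) 0 ≤ |a x + H x 0| := max_le (le_abs_self _) (abs_nonneg _)
    have h3 := pow_le_pow_left₀ (le_max_right _ _) h2 2
    nlinarith [sq_nonneg ‖0 - p x‖, mul_nonneg (abs_nonneg (a x + H x 0)) (norm_nonneg (b x))]
  have hG : MemLp (fun x => |a x + H x 0| + ‖b x‖) 2 μ :=
    ((Lp.memLp a).add h0).abs.add (Lp.memLp b).norm
  have hρL : MemLp (fun x => max (a x + H x (-p x)) 0) 2 μ := by
    refine hG.mono hρm.aestronglyMeasurable ?_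
    filter_upwards [hbound] with x hx
    rw [← sq_le_sq₀ (norm_nonneg _) (norm_nonneg _), Real.norm_eq_abs, Real.norm_eq_abs, sq_abs,
      sq_abs]
    linarith [sq_nonneg ‖b x - p x‖]
  have hmL : MemLp (fun x => b x - p x) 2 μ := by
    refine hG.mono (hbm.sub hpm).aestronglyMeasurable ?_
    filter_upwards [hbound] with x hx
    rw [← sq_le_sq₀ (norm_nonneg _) (norm_nonneg _), Real.norm_eq_abs, sq_abs]
    linarith [sq_nonneg (max (a x + H x (-p x)) 0)]
  have eρ := hρL.coeFn_toLp
  have em := hmL.coeFn_toLp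
  have eu : ∀ᵐ x ∂μ, (a - hρL.toLp _) x = a x - max (a x + H x (-p x)) 0 := by
    filter_upwards [Lp.coeFn_sub a (hρL.toLp _), eρ] with x h1 h2
    rw [h1, Pi.sub_apply, h2]
  have ev : ∀ᵐ x ∂μ, (b - hmL.toLp _) x = p x := by
    filter_upwards [Lp.coeFn_sub b (hmL.toLp _), em] with x h1 h2
    rw [h1, Pi.sub_apply, h2, sub_sub_cancel]
  refine ⟨a - hρL.toLp _, b - hmL.toLp _, hρL.toLp _, hmL.toLp _, ⟨?_, ?_, ?_, ?_⟩,
    sub_add_cancel _ _, sub_add_cancel _ _⟩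
  · filter_upwards [eρ] with x h1
    rw [h1]
    exact le_max_right _ _
  · filter_upwards [eu, ev] with x h1 h2
    rw [h1, h2]
    linarith [le_max_left (a x + H x (-p x)) 0]
  · filter_upwards [eρ, eu, ev] with x h1 h2 h3 h4
    rw [h1] at h4
    rw [h2, h3]
    rcases max_choice (a x + H x (-p x)) 0 with h | h
    · rw [h]; ring
    · rw [h] at h4; exact absurd h4 (lt_irrefl _)
  · filter_upwards [eρ, em, ev, hp] with x h1 h2 h3 h4
    rw [h1, h2, h3]
    exact h4.1

end Hamiltonian


/-- The gradient inequality for a differentiable convex function. -/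
lemma add_inner_gradient_le {E : Type*} [NormedAddCommGroup E] [InnerProductSpace ℝ E]
    [CompleteSpace E] {h : E → ℝ} (hconv : ConvexOn ℝ univ h) (hd : Differentiable ℝ h) (p e : E) :
    h p + inner ℝ (gradient h p) (e - p) ≤ h e := by
  have h1 : ConvexOn ℝ univ (h ∘ AffineMap.lineMap (k := ℝ) p e) :=
    hconv.comp_affineMap (AffineMap.lineMap p e)
  have h2 : HasDerivAt (h ∘ AffineMap.lineMap (k := ℝ) p e) (fderiv ℝ h p (e - p)) 0 := by
    refine HasFDerivAt.comp_hasDerivAt (x := (0 : ℝ)) ?_ AffineMap.hasDerivAt_lineMap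
    rw [AffineMap.lineMap_apply_zero]
    exact (hd p).hasFDerivAt
  have h3 := h1.le_slope_of_hasDerivAt (mem_univ 0) (mem_univ 1) one_pos h2
  rw [slope_def_field] at h3
  simp only [Function.comp_apply, AffineMap.lineMap_apply_one, AffineMap.lineMap_apply_zero,
    sub_zero, div_one] at h3
  rw [gradient, InnerProductSpace.toDual_symm_apply]
  linarith

/-! ### The functional Ξ and the operator N. -/

namespace MFGData
variable {d r : ℕ} (D : MFGData d r)

lemma ae_mem_cyl : ∀ᵐ w ∂cylMeasure D.Ω, w.1 ∈ D.Ω ∧ w.2 ∈ Ioo (0 : ℝ) 1 :=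
  (ae_cyl_iff D.isOpen_Ω).2 (Filter.Eventually.of_forall fun _ hw => hw)

lemma ae_mem_space : ∀ᵐ x ∂spaceMeasure D.Ω, x ∈ D.Ω :=
  ae_restrict_mem D.isOpen_Ω.measurableSet

lemma ae_convexOn_H : ∀ᵐ w ∂cylMeasure D.Ω, ConvexOn ℝ univ (D.H w.2 w.1) := by
  filter_upwards [D.ae_mem_cyl] with w hw using D.convex_H _ hw.2 _ hw.1

lemma ae_differentiable_H : ∀ᵐ w ∂cylMeasure D.Ω, Differentiable ℝ (D.H w.2 w.1) := by
  filter_upwards [D.ae_mem_cyl] with w hw using D.differentiable_H _ hw.2 _ hw.1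

lemma coe_le_L (t : ℝ) (x v p : Vec d) :
    ((-inner ℝ v p - D.H t x p : ℝ) : EReal) ≤ D.L t x v :=
  le_iSup (fun p : Vec d => ((-inner ℝ v p - D.H t x p : ℝ) : EReal)) p

/-- The gradient inequality says that the supremum defining L at -∇H(p) is attained at p: equality
in Fenchel–Young. -/
lemma L_neg_gradient {t : ℝ} {x : Vec d} (hconv : ConvexOn ℝ univ (D.H t x))
    (hd : Differentiable ℝ (D.H t x)) (p : Vec d) :
    D.L t x (-gradient (D.H t x) p)
      = ((inner ℝ (gradient (D.H t x) p) p - D.H t x p : ℝ) : EReal) := by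
  refine le_antisymm (iSup_le fun e => ?_) ?_
  · have h1 := add_inner_gradient_le hconv hd p e
    rw [EReal.coe_le_coe_iff, inner_neg_left]
    rw [inner_sub_right] at h1
    linarith
  · refine le_trans (le_of_eq ?_) (D.coe_le_L t x _ p)
    rw [inner_neg_left, neg_neg]

/-- The integrand of the kinetic term in `Ξ`. -/
noncomputable def kinetic (q : D.Dual) (w : Vec d × ℝ) : EReal :=
  if 0 < q.ρ w then ((q.ρ w : ℝ) : EReal) * D.L w.2 w.1 ((q.ρ w)⁻¹ • q.m w) else 0

/-- Testing L at -v gives ρL(m/ρ) ≥ v·m - ρH(-v), and -H(-v) ≥ u by hypothesis. The indicator keeps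
the bound valid where ρ ≤ 0, so q need not be feasible. -/
lemma coe_le_kinetic (q : D.Dual) {w : Vec d × ℝ} {u : ℝ} {v : Vec d}
    (h : u + D.H w.2 w.1 (-v) ≤ 0) :
    (({w | 0 < q.ρ w}.indicator (fun w => u * q.ρ w + inner ℝ v (q.m w)) w : ℝ) : EReal)
      ≤ D.kinetic q w := by
  by_cases hw : 0 < q.ρ w
  · rw [kinetic, if_pos hw, indicator_of_mem (show w ∈ {w | 0 < q.ρ w} from hw)]
    refine le_trans ?_ (mul_le_mul_of_nonneg_left (D.coe_le_L _ _ _ (-v))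
      (EReal.coe_nonneg.2 hw.le))
    rw [← EReal.coe_mul, EReal.coe_le_coe_iff, inner_neg_right, real_inner_smul_left, mul_sub,
      neg_neg, mul_inv_cancel_left₀ hw.ne', real_inner_comm]
    nlinarith
  · rw [kinetic, if_neg hw, indicator_of_notMem (show w ∉ {w | 0 < q.ρ w} from hw)]
    exact le_rfl

lemma Xi_eq_kinetic {q : D.Dual} (h0 : q.ρ0 = D.ρInit) (h1 : ∀ᵐ w ∂cylMeasure D.Ω, 0 ≤ q.ρ w)
    (h2 : ∀ᵐ w ∂cylMeasure D.Ω, q.ρ w = 0 → q.m w = 0) :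
    D.Xi q = eintegral (cylMeasure D.Ω) (D.kinetic q) := by
  rw [Xi, convexInd, convexInd, convexInd, if_pos h0, if_pos h1, if_pos h2, add_zero, add_zero,
    add_zero]
  rfl

/-- In `EReal`, ⊥ + ⊤ = ⊥, so a violated constraint makes Ξ infinite only if the kinetic term is not
⊥. -/
lemma Xi_eq_top {q : D.Dual} (hb : eintegral (cylMeasure D.Ω) (D.kinetic q) ≠ ⊥)
    (h : ¬ (q.ρ0 = D.ρInit ∧ (∀ᵐ w ∂cylMeasure D.Ω, 0 ≤ q.ρ w) ∧
      ∀ᵐ w ∂cylMeasure D.Ω, q.ρ w = 0 → q.m w = 0)) : D.Xi q = ⊤ := by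
  have hind : ∀ p : Prop, convexInd p ≠ ⊥ := fun p => by
    rw [convexInd]; split_ifs <;> simp
  have hadd : ∀ x y : EReal, x ≠ ⊥ → y ≠ ⊥ → x + y ≠ ⊥ := fun x y hx hy =>
    EReal.add_ne_bot_iff.2 ⟨hx, hy⟩
  change eintegral (cylMeasure D.Ω) (D.kinetic q) + _ + _ + _ = ⊤
  by_cases h0 : q.ρ0 = D.ρInit
  · by_cases h1 : ∀ᵐ w ∂cylMeasure D.Ω, 0 ≤ q.ρ w
    · rw [convexInd, convexInd, convexInd, if_neg fun h2 => h ⟨h0, h1, h2⟩]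
      refine EReal.add_top_of_ne_bot (hadd _ _ (hadd _ _ hb ?_) ?_) <;> split_ifs <;> simp
    · rw [convexInd, convexInd, if_neg h1, EReal.add_top_of_ne_bot, EReal.top_add_of_ne_bot]
      · exact hind _
      · refine hadd _ _ hb ?_
        split_ifs <;> simp
  · rw [convexInd, if_neg h0, EReal.add_top_of_ne_bot hb, EReal.top_add_of_ne_bot (hind _),
      EReal.top_add_of_ne_bot (hind _)]

/-- The optimality relation that characterizes `N`. -/
def IsOptimal (σ q : D.Dual) : Prop :=
  IsHamiltonianPair (cylMeasure D.Ω) (fun w => D.H w.2 w.1) σ.bulk σ.field q.ρ q.m ∧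
    q.ρ0 = D.ρInit ∧ σ.slice1 = 0

/-- At q the kinetic integrand equals u ρ + v·m, where (u, v) are the bulk and field of σ. At any
feasible q' the same linear expression in q' is a lower bound by `coe_le_kinetic`. Subtracting gives
the subgradient inequality. -/
lemma IsOptimal.mem_subdiff_Xi {σ q : D.Dual} (h : D.IsOptimal σ q) : σ ∈ subdiff D.Xi q := by
  obtain ⟨hp, h0, h1⟩ := h
  have hint : ∀ q' : D.Dual,
      Integrable (fun w => σ.bulk w * q'.ρ w + inner ℝ (σ.field w) (q'.m w)) (cylMeasure D.Ω) := by
    intro q'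
    exact ((Lp.memLp σ.bulk).integrable_mul (Lp.memLp q'.ρ)).add
      (L2.integrable_inner (𝕜 := ℝ) σ.field q'.m)
  have hsum : ∀ q' : D.Dual,
      ∫ w, (σ.bulk w * q'.ρ w + inner ℝ (σ.field w) (q'.m w)) ∂cylMeasure D.Ω
        = inner ℝ σ.bulk q'.ρ + inner ℝ σ.field q'.m := by
    intro q'
    rw [L2.inner_def, L2.inner_def, ← integral_add (L2.integrable_inner _ _)
      (L2.integrable_inner _ _)]
    refine integral_congr_ae (Filter.Eventually.of_forall fun w => ?_)
    simp [mul_comm]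
  have hvac : ∀ᵐ w ∂cylMeasure D.Ω, q.ρ w = 0 → q.m w = 0 := by
    filter_upwards [hp.flux] with w hw h
    rw [hw, h, zero_smul, neg_zero]
  have hval : D.Xi q = ((inner ℝ σ.bulk q.ρ + inner ℝ σ.field q.m : ℝ) : EReal) := by
    rw [D.Xi_eq_kinetic h0 hp.nonneg hvac, ← hsum, ← eintegral_coe (hint q)]
    refine eintegral_congr_ae ?_
    filter_upwards [hp.nonneg, hp.eq, hp.flux, D.ae_convexOn_H, D.ae_differentiable_H]
      with w k1 k2 k3 k4 k5
    rcases k1.eq_or_lt with k | k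
    · rw [kinetic, if_neg (by rw [← k]; exact lt_irrefl _), k3, ← k]
      simp
    · rw [kinetic, if_pos k, k3, smul_neg, smul_smul, inv_mul_cancel₀ k.ne', one_smul,
        D.L_neg_gradient k4 k5, ← EReal.coe_mul, EReal.coe_eq_coe_iff, inner_neg_right,
        inner_neg_right, inner_smul_right, real_inner_comm]
      linear_combination (-q.ρ w) * k2 k
  have hle : ∀ q' : D.Dual, ((∫ w, {w | 0 < q'.ρ w}.indicator
      (fun w => σ.bulk w * q'.ρ w + inner ℝ (σ.field w) (q'.m w)) w ∂cylMeasure D.Ω : ℝ) : EReal)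
      ≤ eintegral (cylMeasure D.Ω) (D.kinetic q') := by
    intro q'
    have hpos : NullMeasurableSet {w | 0 < q'.ρ w} (cylMeasure D.Ω) :=
      nullMeasurableSet_lt aemeasurable_const (Lp.aestronglyMeasurable q'.ρ).aemeasurable
    rw [← eintegral_coe ((hint q').indicator₀ hpos)]
    refine eintegral_mono_ae ?_
    filter_upwards [hp.le] with w hw using D.coe_le_kinetic q' hw
  refine ⟨by rw [hval]; exact EReal.coe_ne_bot _, by rw [hval]; exact EReal.coe_ne_top _,
    fun q' => ?_⟩
  by_cases hq : q'.ρ0 = D.ρInit ∧ (∀ᵐ w ∂cylMeasure D.Ω, 0 ≤ q'.ρ w) ∧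
      ∀ᵐ w ∂cylMeasure D.Ω, q'.ρ w = 0 → q'.m w = 0
  · rw [D.Xi_eq_kinetic hq.1 hq.2.1 hq.2.2, hval]
    refine le_trans (le_of_eq ?_) (hle q')
    -- The traces do not contribute to ⟨σ, q' - q⟩: both initial traces are the prescribed density,
    -- and the terminal component of σ is 0.
    rw [integral_congr_ae (g := fun w => σ.bulk w * q'.ρ w + inner ℝ (σ.field w) (q'.m w)), hsum,
      Quad.inner_def, h1, inner_zero_left, sub_eq_add_neg, Quad.add_slice0, Quad.neg_slice0,
      show q'.slice0 = q.slice0 from hq.1.trans h0.symm, add_neg_cancel, inner_zero_right]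
    · norm_cast
      simp only [Quad.add_bulk, Quad.neg_bulk, Quad.add_field, Quad.neg_field, inner_add_right,
        inner_neg_right]
      ring
    · filter_upwards [hq.2.1, hq.2.2] with w k1 k2
      rcases k1.eq_or_lt with k | k
      · rw [indicator_of_notMem (show w ∉ {w | 0 < q'.ρ w} from k.not_lt), k2 k.symm, ← k]
        simp
      · rw [indicator_of_mem (show w ∈ {w | 0 < q'.ρ w} from k)]
  -- For infeasible q' the finite lower bound `hle` excludes ⊥, so Ξ(q') = ⊤ and there is nothing to
  -- prove.
  · rw [D.Xi_eq_top (fun hb => EReal.coe_ne_bot _ (le_bot_iff.1 (hb ▸ hle q'))) hq]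
    exact le_top

lemma opN_eq : IsMaximallyMonotone D.opN ∧ ∀ σ q, q ∈ D.opN σ ↔ D.IsOptimal σ q := by
  have hsub : ∀ σ, {q | D.IsOptimal σ q} ⊆ subdiff (conj D.Xi) σ :=
    fun σ q h => mem_subdiff_conj h.mem_subdiff_Xi
  have hmax : IsMaximallyMonotone fun σ => {q | D.IsOptimal σ q} := by
    refine IsMonotoneOp.isMaximallyMonotone_of_surjective
      (fun x y u hu v hv => isMonotoneOp_subdiff _ x y u (hsub x hu) v (hsub y hv)) fun z => ?_
    obtain ⟨u, v, ρ, m, h, e1, e2⟩ := exists_isHamiltonianPair_add_eq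
      (H := fun w : Vec d × ℝ => D.H w.2 w.1) D.measurable_H D.ae_convexOn_H
      D.ae_differentiable_H D.memLp_H z.bulk z.field
    -- The relation fixes the initial component of q and the terminal component of σ; the other
    -- member of each pair is free and absorbs z.
    exact ⟨Quad.mk u v (z.slice0 - D.ρInit) 0, Quad.mk ρ m D.ρInit z.slice1, ⟨h, rfl, rfl⟩,
      Quad.ext' e1 e2 (sub_add_cancel _ _) (zero_add _)⟩
  have heq := hmax.eq_of_subset (isMonotoneOp_subdiff (conj D.Xi)) hsub
  rw [opN, heq]
  exact ⟨hmax, fun _ _ => Iff.rfl⟩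

end MFGData

lemma ae_ae_of_ae_prod_symm {X Y : Type*} [MeasurableSpace X] [MeasurableSpace Y] {μ : Measure X}
    {ν : Measure Y} [SFinite μ] [SFinite ν] {p : X × Y → Prop} (h : ∀ᵐ z ∂μ.prod ν, p z) :
    ∀ᵐ y ∂ν, ∀ᵐ x ∂μ, p (x, y) :=
  Measure.ae_ae_of_ae_prod (Measure.measurePreserving_swap.quasiMeasurePreserving.ae h)

/-! ### Expansion in the ζᵢ, and the adjoint operators as moments. -/

namespace MFGData
variable {d r : ℕ} (D : MFGData d r)

lemma sumTime_apply (a : Lp (Vec r) 2 timeMeasure) :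
    ∀ᵐ w ∂cylMeasure D.Ω, D.sumTime a w = ∑ i, a w.2 i * D.ζ i w.1 := by
  have h1 : D.sumTime a = ∑ i, tensorTime (D.memLp_ζ i)
      ((EuclideanSpace.proj i : Vec r →L[ℝ] ℝ).compLpL 2 timeMeasure a) := by
    rw [sumTime, sum_apply]
    rfl
  have h2 : ∀ i : Fin r, ∀ᵐ w ∂cylMeasure D.Ω, tensorTime (D.memLp_ζ i)
      ((EuclideanSpace.proj i : Vec r →L[ℝ] ℝ).compLpL 2 timeMeasure a) w
        = a w.2 i * D.ζ i w.1 := by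
    intro i
    filter_upwards [(memLp_tensor (D.memLp_ζ i) (Lp.memLp
      ((EuclideanSpace.proj i : Vec r →L[ℝ] ℝ).compLpL 2 timeMeasure a))).coeFn_toLp,
      Measure.quasiMeasurePreserving_snd.ae ((EuclideanSpace.proj i : Vec r →L[ℝ] ℝ).coeFn_compLpL a)]
      with w e1 e2
    refine e1.trans ?_
    rw [e2, mul_comm]
    rfl
  rw [h1]
  filter_upwards [Lp.coeFn_finsetSum Finset.univ fun i => tensorTime (D.memLp_ζ i)
      ((EuclideanSpace.proj i : Vec r →L[ℝ] ℝ).compLpL 2 timeMeasure a), ae_all_iff.2 h2]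
    with w e1 e2
  rw [e1, Finset.sum_apply]
  exact Finset.sum_congr rfl fun i _ => e2 i

lemma sumSpace_eq (b : Vec r) : D.sumSpace b = ∑ i, b i • D.ζL i := by
  rw [sumSpace, sum_apply]
  rfl

lemma sum_smul_ζL_apply (b : Fin r → ℝ) :
    ∀ᵐ x ∂spaceMeasure D.Ω, (∑ i, b i • D.ζL i) x = ∑ i, b i * D.ζ i x := by
  filter_upwards [Lp.coeFn_finsetSum Finset.univ fun i => b i • D.ζL i,
    ae_all_iff.2 fun i => Lp.coeFn_smul (b i) (D.ζL i),
    ae_all_iff.2 fun i => (D.memLp_ζ i).coeFn_toLp] with x e1 e2 e3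
  rw [e1, Finset.sum_apply]
  refine Finset.sum_congr rfl fun i _ => ?_
  rw [e2, Pi.smul_apply, smul_eq_mul]
  exact congrArg _ (e3 i)

lemma sumSpace_apply (b : Vec r) :
    ∀ᵐ x ∂spaceMeasure D.Ω, D.sumSpace b x = ∑ i, b i * D.ζ i x := by
  rw [sumSpace_eq]
  exact D.sum_smul_ζL_apply b

lemma inner_ζL (u : Lp ℝ 2 (spaceMeasure D.Ω)) (i : Fin r) :
    inner ℝ (D.ζL i) u = ∫ x, u x * D.ζ i x ∂spaceMeasure D.Ω :=
  (integral_mul_eq_inner u (D.memLp_ζ i)).symm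

lemma adjoint_sumSpace_apply (u : Lp ℝ 2 (spaceMeasure D.Ω)) (i : Fin r) :
    ContinuousLinearMap.adjoint D.sumSpace u i = ∫ x, u x * D.ζ i x ∂spaceMeasure D.Ω := by
  have h1 := ContinuousLinearMap.adjoint_inner_right D.sumSpace (EuclideanSpace.single i (1 : ℝ)) u
  rw [EuclideanSpace.inner_single_left, sumSpace_eq, Finset.sum_eq_single i] at h1
  · simpa [inner_ζL] using h1
  · intro j _ hj
    simp [hj]
  · simp

lemma integrable_mul_ζ {u : Vec d × ℝ → ℝ} (hu : MemLp u 2 (cylMeasure D.Ω)) (i : Fin r) :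
    Integrable (fun w : Vec d × ℝ => u w * D.ζ i w.1) (cylMeasure D.Ω) := by
  have := isProbabilityMeasure_timeMeasure
  have h1 : MemLp (fun w : Vec d × ℝ => D.ζ i w.1 * (1 : ℝ)) 2 (cylMeasure D.Ω) :=
    memLp_tensor (D.memLp_ζ i) (memLp_const 1)
  simp only [mul_one] at h1
  exact hu.integrable_mul h1

/-- Two integrable functions of t agree a.e. if their integrals over all measurable sets agree;
pairing the adjoint with the i-th unit vector times the indicator of such a set, and Fubini, give
these integrals. -/
lemma adjoint_sumTime_apply (u : Lp ℝ 2 (cylMeasure D.Ω)) (i : Fin r) :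
    ∀ᵐ t ∂timeMeasure, ContinuousLinearMap.adjoint D.sumTime u t i
      = ∫ x, u (x, t) * D.ζ i x ∂spaceMeasure D.Ω := by
  have := isProbabilityMeasure_timeMeasure
  set v := ContinuousLinearMap.adjoint D.sumTime u with hv
  have hint := D.integrable_mul_ζ (Lp.memLp u) i
  have hv1 : Integrable (fun t => v t) timeMeasure := (Lp.memLp v).integrable one_le_two
  refine Integrable.ae_eq_of_forall_setIntegral_eq _ _
    ((EuclideanSpace.proj i : Vec r →L[ℝ] ℝ).integrable_comp hv1)
    hint.integral_prod_right fun s hs _ => ?_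
  have hsf : timeMeasure s ≠ ⊤ := measure_ne_top _ _
  have h1 : ∫ t in s, v t i ∂timeMeasure
      = inner ℝ (indicatorConstLp 2 hs hsf (EuclideanSpace.single i (1 : ℝ))) v := by
    rw [L2.inner_indicatorConstLp_eq_inner_setIntegral ℝ hs hsf, EuclideanSpace.inner_single_left,
      map_one, one_mul]
    exact (EuclideanSpace.proj i : Vec r →L[ℝ] ℝ).integral_comp_comm hv1.restrict
  change ∫ t in s, v t i ∂timeMeasure = _
  rw [h1, hv, ContinuousLinearMap.adjoint_inner_right, L2.inner_def, ← integral_indicator hs]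
  have h2 : ∀ᵐ w ∂cylMeasure D.Ω,
      inner ℝ (D.sumTime (indicatorConstLp 2 hs hsf (EuclideanSpace.single i (1 : ℝ))) w) (u w)
        = (Prod.snd ⁻¹' s).indicator (fun w : Vec d × ℝ => u w * D.ζ i w.1) w := by
    filter_upwards [D.sumTime_apply (indicatorConstLp 2 hs hsf (EuclideanSpace.single i (1 : ℝ))),
      Measure.quasiMeasurePreserving_snd.ae (indicatorConstLp_coeFn (p := 2) (hs := hs)
        (hμs := hsf) (c := EuclideanSpace.single i (1 : ℝ)))] with w e1 e2
    rw [e1, e2]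
    by_cases hw : w.2 ∈ s
    · rw [indicator_of_mem hw, indicator_of_mem (show w ∈ Prod.snd ⁻¹' s from hw),
        Finset.sum_eq_single i]
      · simp
      · intro j _ hj
        simp [hj]
      · simp
    · rw [indicator_of_notMem hw, indicator_of_notMem (show w ∉ Prod.snd ⁻¹' s from hw)]
      simp
  rw [integral_congr_ae h2, integral_prod_symm _ (hint.indicator (measurable_snd hs))]
  refine integral_congr_ae (Filter.Eventually.of_forall fun t => ?_)
  by_cases ht : t ∈ s
  · simp only [indicator_of_mem ht]
    refine integral_congr_ae (Filter.Eventually.of_forall fun x => ?_)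
    exact indicator_of_mem (show (x, t) ∈ Prod.snd ⁻¹' s from ht) _
  · simp only [indicator_of_notMem ht]
    refine integral_eq_zero_of_ae (Filter.Eventually.of_forall fun x => ?_)
    exact indicator_of_notMem (show (x, t) ∉ Prod.snd ⁻¹' s from ht) _

/-! The adjoint of `C`. -/

lemma inner_opCAdj (q : D.Dual) (s : D.Primal) :
    inner ℝ (D.opCAdj q) s = inner ℝ q.ρ (-(D.sumTime s.a) - s.α - H1.dt s.φ)
      + (inner ℝ q.m (-H1.grad s.φ) + (inner ℝ q.ρ0 (-H1.init s.φ)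
        + inner ℝ q.ρ1 (-(D.sumSpace s.b) - s.β + H1.fin s.φ))) := by
  rw [opCAdj, ContinuousLinearMap.adjoint_inner_left, Quad.inner_def]
  rfl

lemma opCAdj_a (q : D.Dual) : (-D.opCAdj q).a = ContinuousLinearMap.adjoint D.sumTime q.ρ := by
  refine ext_inner_right ℝ fun h => ?_
  have := D.inner_opCAdj q (Primal.mk h 0 0 0 0)
  rw [Primal.inner_def] at this
  simp [H1.dt, H1.grad, H1.init, H1.fin] at this
  rw [Primal.neg_a, inner_neg_left, this, neg_neg, ContinuousLinearMap.adjoint_inner_left]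

lemma opCAdj_b (q : D.Dual) : (-D.opCAdj q).b = ContinuousLinearMap.adjoint D.sumSpace q.ρ1 := by
  refine ext_inner_right ℝ fun h => ?_
  have := D.inner_opCAdj q (Primal.mk 0 h 0 0 0)
  rw [Primal.inner_def] at this
  simp [H1.dt, H1.grad, H1.init, H1.fin] at this
  rw [Primal.neg_b, inner_neg_left, this, neg_neg, ContinuousLinearMap.adjoint_inner_left]

lemma opCAdj_α (q : D.Dual) : (-D.opCAdj q).α = q.ρ := by
  refine ext_inner_right ℝ fun h => ?_
  have := D.inner_opCAdj q (Primal.mk 0 0 h 0 0)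
  rw [Primal.inner_def] at this
  simp [H1.dt, H1.grad, H1.init, H1.fin] at this
  rw [Primal.neg_α, inner_neg_left, this, neg_neg]

lemma opCAdj_β (q : D.Dual) : (-D.opCAdj q).β = q.ρ1 := by
  refine ext_inner_right ℝ fun h => ?_
  have := D.inner_opCAdj q (Primal.mk 0 0 0 h 0)
  rw [Primal.inner_def] at this
  simp [H1.dt, H1.grad, H1.init, H1.fin] at this
  rw [Primal.neg_β, inner_neg_left, this, neg_neg]

/-- The Riesz representative in H¹ is never computed: it is zero exactly when its pairing with every
ψ vanishes, and that pairing is the defect in the weak continuity equation. -/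
lemma opCAdj_φ (q : D.Dual) :
    (-D.opCAdj q).φ = 0 ↔ D.WeakContinuityEq q.ρ q.m q.ρ0 q.ρ1 := by
  have h1 : ∀ ψ : H1 D.Ω, inner ℝ (-D.opCAdj q).φ ψ = inner ℝ (H1.dt ψ) q.ρ
      + inner ℝ (H1.grad ψ) q.m - (inner ℝ (H1.fin ψ) q.ρ1 - inner ℝ (H1.init ψ) q.ρ0) := by
    intro ψ
    have := D.inner_opCAdj q (Primal.mk 0 0 0 0 ψ)
    rw [Primal.inner_def] at this
    simp only [Primal.mk_a, Primal.mk_b, Primal.mk_α, Primal.mk_β, Primal.mk_φ, map_zero,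
      inner_zero_right, zero_add, neg_zero, zero_sub, sub_zero, inner_neg_right] at this
    rw [Primal.neg_φ, inner_neg_left, this, real_inner_comm q.ρ, real_inner_comm q.m,
      real_inner_comm q.ρ0, real_inner_comm q.ρ1]
    ring
  have h2 : ∀ ψ : H1 D.Ω,
      ∫ w, (H1.dt ψ w * q.ρ w + inner ℝ (H1.grad ψ w) (q.m w)) ∂cylMeasure D.Ω
        = inner ℝ (H1.dt ψ) q.ρ + inner ℝ (H1.grad ψ) q.m := by
    intro ψ
    rw [L2.inner_def, L2.inner_def, ← integral_add (L2.integrable_inner _ _)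
      (L2.integrable_inner _ _)]
    refine integral_congr_ae (Filter.Eventually.of_forall fun w => ?_)
    simp [mul_comm]
  have h3 : ∀ u v : Lp ℝ 2 (spaceMeasure D.Ω),
      ∫ x, u x * v x ∂spaceMeasure D.Ω = inner ℝ u v := by
    intro u v
    rw [L2.inner_def]
    refine integral_congr_ae (Filter.Eventually.of_forall fun w => ?_)
    simp [mul_comm]
  simp only [WeakContinuityEq, h2, h3]
  constructor
  · intro h ψ
    rw [← sub_eq_zero, ← h1, h, inner_zero_left]
  · intro h
    refine ext_inner_right ℝ fun ψ => ?_
    rw [h1, h, sub_self, inner_zero_left]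

/-! The couplings as monotone Carathéodory functions, and the operator `M`. -/

lemma isMonotoneCaratheodory_f₀ :
    IsMonotoneCaratheodory (cylMeasure D.Ω) fun w => D.f₀ w.2 w.1 where
  aemeasurable := D.measurable_f₀
  continuous := D.ae_mem_cyl.mono fun _ hw => D.continuous_f₀ _ hw.2 _ hw.1
  monotone := D.ae_mem_cyl.mono fun _ hw => D.monotone_f₀ _ hw.2 _ hw.1
  memLp_zero := D.memLp_f₀

lemma isMonotoneCaratheodory_g₀ : IsMonotoneCaratheodory (spaceMeasure D.Ω) D.g₀ where
  aemeasurable := D.measurable_g₀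
  continuous := D.ae_mem_space.mono fun _ hw => D.continuous_g₀ _ hw
  monotone := D.ae_mem_space.mono fun _ hw => D.monotone_g₀ _ hw
  memLp_zero := D.memLp_g₀

lemma isMonotoneCaratheodory_f₁ :
    IsMonotoneCaratheodory (cylMeasure D.Ω) fun w => D.f₁ w.2 w.1 where
  aemeasurable := D.measurable_f₁
  continuous := D.ae_mem_cyl.mono fun _ hw => D.continuous_f₁ _ hw.2 _ hw.1
  monotone := D.ae_mem_cyl.mono fun _ hw => D.monotone_f₁ _ hw.2 _ hw.1
  memLp_zero := by
    -- The value at z = 0 is the superposition with the zero coefficient function.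
    refine (D.memLp_f₁ 0).ae_eq ?_
    filter_upwards [Measure.quasiMeasurePreserving_snd.ae
      (Lp.coeFn_zero (Vec r) 2 timeMeasure)] with w hw
    rw [hw]
    simp

lemma isMonotoneCaratheodory_g₁ : IsMonotoneCaratheodory (spaceMeasure D.Ω) D.g₁ where
  aemeasurable := D.measurable_g₁
  continuous := D.ae_mem_space.mono fun _ hw => D.continuous_g₁ _ hw
  monotone := D.ae_mem_space.mono fun _ hw => D.monotone_g₁ _ hw
  memLp_zero := by simpa using D.memLp_g₁ 0

lemma memLp_f₁_sumTime (c : Lp (Vec r) 2 timeMeasure) :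
    MemLp (fun w : Vec d × ℝ => D.f₁ w.2 w.1 (D.sumTime c w)) 2 (cylMeasure D.Ω) := by
  refine (D.memLp_f₁ c).ae_eq ?_
  filter_upwards [D.sumTime_apply c] with w hw
  rw [hw]

lemma memLp_g₁_sumSpace (b : Vec r) :
    MemLp (fun x => D.g₁ x (D.sumSpace b x)) 2 (spaceMeasure D.Ω) := by
  refine (D.memLp_g₁ b).ae_eq ?_
  filter_upwards [D.sumSpace_apply b] with w hw
  rw [hw]

/-- The gradient of `U₁`. -/
noncomputable def gradU₁ (c : Lp (Vec r) 2 timeMeasure) : Lp (Vec r) 2 timeMeasure :=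
  ContinuousLinearMap.adjoint D.sumTime ((D.memLp_f₁_sumTime c).toLp _)

/-- The gradient of `V₁`. -/
noncomputable def gradV₁ (b : Vec r) : Vec r :=
  ContinuousLinearMap.adjoint D.sumSpace ((D.memLp_g₁_sumSpace b).toLp _)

lemma subdiff_U₁ : (∀ c, subdiff D.U₁ c = {D.gradU₁ c}) ∧
    ∀ a, subdiff (conj D.U₁) a = {c | a = D.gradU₁ c} := by
  refine D.isMonotoneCaratheodory_f₁.subdiff_comp D.sumTime D.memLp_f₁_sumTime fun c => ?_
  refine eintegral_congr_ae ?_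
  filter_upwards [D.sumTime_apply c] with w hw
  rw [hw]

lemma subdiff_V₁ : (∀ b, subdiff D.V₁ b = {D.gradV₁ b}) ∧
    ∀ a, subdiff (conj D.V₁) a = {c | a = D.gradV₁ c} := by
  refine D.isMonotoneCaratheodory_g₁.subdiff_comp D.sumSpace D.memLp_g₁_sumSpace fun c => ?_
  refine eintegral_congr_ae ?_
  filter_upwards [D.sumSpace_apply c] with w hw
  rw [hw]

lemma subdiff_conj_U₀ : IsMaximallyMonotone (subdiff (conj D.U₀)) ∧ ∀ n ρ,
    ρ ∈ subdiff (conj D.U₀) n ↔ ∀ᵐ w ∂cylMeasure D.Ω, n w = D.f₀ w.2 w.1 (ρ w) :=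
  D.isMonotoneCaratheodory_f₀.mem_subdiff_conj fun _ => rfl

lemma subdiff_conj_V₀ : IsMaximallyMonotone (subdiff (conj D.V₀)) ∧ ∀ n μ,
    μ ∈ subdiff (conj D.V₀) n ↔ ∀ᵐ x ∂spaceMeasure D.Ω, n x = D.g₀ x (μ x) :=
  D.isMonotoneCaratheodory_g₀.mem_subdiff_conj fun _ => rfl

section Matrices
variable {A : Matrix (Fin r) (Fin r) ℝ}

lemma matVec_mul (A B : Matrix (Fin r) (Fin r) ℝ) (b : Vec r) :
    matVec A (matVec B b) = matVec (A * B) b := by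
  simp only [matVec, map_mul]
  rfl

lemma matVec_one (b : Vec r) : matVec (1 : Matrix (Fin r) (Fin r) ℝ) b = b := by
  simp [matVec]

lemma matVec_apply (A : Matrix (Fin r) (Fin r) ℝ) (b : Vec r) (i : Fin r) :
    matVec A b i = ∑ j, A i j * b j := by
  simp [matVec, Matrix.ofLp_toEuclideanCLM, Matrix.mulVec, dotProduct]

lemma matTime_apply (A : Matrix (Fin r) (Fin r) ℝ) (c : Lp (Vec r) 2 timeMeasure) :
    ∀ᵐ t ∂timeMeasure, matTime A c t = matVec A (c t) :=
  ContinuousLinearMap.coeFn_compLpL _ c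

lemma matTime_mul (A B : Matrix (Fin r) (Fin r) ℝ) (c : Lp (Vec r) 2 timeMeasure) :
    matTime A (matTime B c) = matTime (A * B) c := by
  refine Lp.ext ?_
  filter_upwards [matTime_apply A (matTime B c), matTime_apply B c, matTime_apply (A * B) c]
    with t h1 h2 h3
  rw [h1, h2, h3, matVec_mul]

lemma matTime_one (c : Lp (Vec r) 2 timeMeasure) :
    matTime (1 : Matrix (Fin r) (Fin r) ℝ) c = c := by
  refine Lp.ext ?_
  filter_upwards [matTime_apply 1 c] with t h1
  rw [h1, matVec_one]

lemma mem_image_matVec_inv (hA : IsUnit A.det) (S : Set (Vec r)) (b : Vec r) :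
    b ∈ matVec A⁻¹ '' S ↔ matVec A b ∈ S := by
  constructor
  · rintro ⟨c, hc, rfl⟩
    rwa [matVec_mul, Matrix.mul_nonsing_inv _ hA, matVec_one]
  · exact fun h => ⟨_, h, by rw [matVec_mul, Matrix.nonsing_inv_mul _ hA, matVec_one]⟩

lemma mem_image_matTime_inv (hA : IsUnit A.det) (S : Set (Lp (Vec r) 2 timeMeasure))
    (c : Lp (Vec r) 2 timeMeasure) : c ∈ matTime A⁻¹ '' S ↔ matTime A c ∈ S := by
  constructor
  · rintro ⟨c, hc, rfl⟩
    rwa [matTime_mul, Matrix.mul_nonsing_inv _ hA, matTime_one]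
  · exact fun h => ⟨_, h, by rw [matTime_mul, Matrix.nonsing_inv_mul _ hA, matTime_one]⟩

end Matrices

/-- Invertibility of 𝐊 and 𝐒 turns images under the inverse matrices into preimages, and the
inverted gradients are read as equations for a and b. -/
lemma mem_opM (s u : D.Primal) : u ∈ D.opM s ↔
    s.a = D.gradU₁ (matTime D.matK u.a) ∧ s.b = D.gradV₁ (matVec D.matS u.b) ∧
      u.α ∈ subdiff (conj D.U₀) s.α ∧ u.β ∈ subdiff (conj D.V₀) s.β ∧ u.φ = 0 := by
  change _ ∧ _ ∧ _ ∧ _ ∧ _ ↔ _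
  rw [mem_image_matTime_inv (A := D.matK) D.isUnit_K,
    mem_image_matVec_inv (A := D.matS) D.isUnit_S, D.subdiff_U₁.2,
    D.subdiff_V₁.2]
  rfl

/-- M is a product of five maximally monotone operators. Its maximality is checked one coordinate at
a time: if one coordinate failed, a graph point with negative pairing there, combined with points of
nonpositive pairing in the other four, would contradict the assumed relation. This requires no
nonemptiness of values at the given point. -/
lemma isMaximallyMonotone_opM
    (hU : IsMaximallyMonotone fun c => subdiff D.U₁ (matTime D.matK c))
    (hV : IsMaximallyMonotone fun w => subdiff D.V₁ (matVec D.matS w)) :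
    IsMaximallyMonotone D.opM := by
  have hA : IsMaximallyMonotone fun a => {c | a ∈ subdiff D.U₁ (matTime D.matK c)} := hU.inverse
  have hB : IsMaximallyMonotone fun b => {w | b ∈ subdiff D.V₁ (matVec D.matS w)} := hV.inverse
  have hφ : IsMaximallyMonotone fun _ : H1 D.Ω => ({0} : Set (H1 D.Ω)) :=
    isMaximallyMonotone_singleton (A := fun _ => 0) (by simp) (by simp)
  have hmem : ∀ s u : D.Primal, u ∈ D.opM s ↔
      u.a ∈ {c | s.a ∈ subdiff D.U₁ (matTime D.matK c)} ∧
      u.b ∈ {w | s.b ∈ subdiff D.V₁ (matVec D.matS w)} ∧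
      u.α ∈ subdiff (conj D.U₀) s.α ∧ u.β ∈ subdiff (conj D.V₀) s.β ∧ u.φ = 0 := by
    intro s u
    rw [mem_opM]
    simp only [D.subdiff_U₁.1, D.subdiff_V₁.1]
    rfl
  refine ⟨fun x y u hu v hv => ?_, fun x u h => ?_⟩
  · rw [hmem] at hu hv
    rw [Primal.inner_def]
    have h1 := hA.1 x.a y.a u.a hu.1 v.a hv.1
    have h2 := hB.1 x.b y.b u.b hu.2.1 v.b hv.2.1
    have h3 := D.subdiff_conj_U₀.1.1 _ _ _ hu.2.2.1 _ hv.2.2.1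
    have h4 := D.subdiff_conj_V₀.1.1 _ _ _ hu.2.2.2.1 _ hv.2.2.2.1
    have h5 := hφ.1 x.φ y.φ _ hu.2.2.2.2 _ hv.2.2.2.2
    exact add_nonneg h1 (add_nonneg h2 (add_nonneg h3 (add_nonneg h4 h5)))
  · obtain ⟨y1, v1, m1, n1⟩ := hA.exists_inner_nonpos x.a u.a
    obtain ⟨y2, v2, m2, n2⟩ := hB.exists_inner_nonpos x.b u.b
    obtain ⟨y3, v3, m3, n3⟩ := D.subdiff_conj_U₀.1.exists_inner_nonpos x.α u.α
    obtain ⟨y4, v4, m4, n4⟩ := D.subdiff_conj_V₀.1.exists_inner_nonpos x.β u.β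
    obtain ⟨y5, v5, m5, n5⟩ := hφ.exists_inner_nonpos x.φ u.φ
    have key : ∀ z1, ∀ w1 ∈ {c | z1 ∈ subdiff D.U₁ (matTime D.matK c)},
        ∀ z2, ∀ w2 ∈ {w | z2 ∈ subdiff D.V₁ (matVec D.matS w)},
        ∀ z3, ∀ w3 ∈ subdiff (conj D.U₀) z3, ∀ z4, ∀ w4 ∈ subdiff (conj D.V₀) z4,
        ∀ z5 : H1 D.Ω, ∀ w5 ∈ ({0} : Set (H1 D.Ω)),
        0 ≤ inner ℝ (x.a - z1) (u.a - w1) + (inner ℝ (x.b - z2) (u.b - w2) +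
          (inner ℝ (x.α - z3) (u.α - w3) + (inner ℝ (x.β - z4) (u.β - w4) +
            inner ℝ (x.φ - z5) (u.φ - w5)))) := by
      intro z1 w1 k1 z2 w2 k2 z3 w3 k3 z4 w4 k4 z5 w5 k5
      have := h (Primal.mk z1 z2 z3 z4 z5) (Primal.mk w1 w2 w3 w4 w5)
        ((hmem _ _).2 ⟨k1, k2, k3, k4, k5⟩)
      rw [Primal.inner_def] at this
      exact this
    rw [hmem]
    refine ⟨?_, ?_, ?_, ?_, ?_⟩ <;> by_contra hn
    · obtain ⟨z, w, hw, hlt⟩ := hA.exists_inner_neg hn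
      linarith [key z w hw y2 v2 m2 y3 v3 m3 y4 v4 m4 y5 v5 m5]
    · obtain ⟨z, w, hw, hlt⟩ := hB.exists_inner_neg hn
      linarith [key y1 v1 m1 z w hw y3 v3 m3 y4 v4 m4 y5 v5 m5]
    · obtain ⟨z, w, hw, hlt⟩ := D.subdiff_conj_U₀.1.exists_inner_neg hn
      linarith [key y1 v1 m1 y2 v2 m2 z w hw y4 v4 m4 y5 v5 m5]
    · obtain ⟨z, w, hw, hlt⟩ := D.subdiff_conj_V₀.1.exists_inner_neg hn
      linarith [key y1 v1 m1 y2 v2 m2 y3 v3 m3 z w hw y5 v5 m5]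
    · obtain ⟨z, w, hw, hlt⟩ := hφ.exists_inner_neg (x := x.φ) hn
      linarith [key y1 v1 m1 y2 v2 m2 y3 v3 m3 y4 v4 m4 z w hw]

end MFGData

/-- The converse of Fubini for null sets needs measurability; writing the property as g ∈ S allows g
to be replaced by a measurable representative. -/
lemma ae_prod_of_ae_ae_symm {X Y Z : Type*} [MeasurableSpace X] [MeasurableSpace Y]
    [MeasurableSpace Z] {μ : Measure X} {ν : Measure Y} [SFinite μ] [SFinite ν] {g : X × Y → Z}
    (hg : AEMeasurable g (μ.prod ν)) {S : Set Z} (hS : MeasurableSet S)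
    (h : ∀ᵐ y ∂ν, ∀ᵐ x ∂μ, g (x, y) ∈ S) : ∀ᵐ z ∂μ.prod ν, g z ∈ S := by
  have h1 : ∀ᵐ y ∂ν, ∀ᵐ x ∂μ, hg.mk g (x, y) ∈ S := by
    filter_upwards [h, ae_ae_of_ae_prod_symm hg.ae_eq_mk] with y h2 h3
    filter_upwards [h2, h3] with x h4 h5
    rwa [← h5]
  have hm : MeasurableSet {z | hg.mk g z ∈ S} := hg.measurable_mk hS
  have h2 : ∀ᵐ z ∂μ.prod ν, hg.mk g z ∈ S :=
    (Measure.ae_prod_iff_ae_ae hm).2 ((Measure.ae_ae_comm hm).2 h1)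
  filter_upwards [h2, hg.ae_eq_mk] with z h3 h4
  rwa [h4]

lemma ae_memLp_two_slice {X Y : Type*} [MeasurableSpace X] [MeasurableSpace Y] {μ : Measure X}
    {ν : Measure Y} [SFinite μ] [SFinite ν] {g : X × Y → ℝ} (hg : MemLp g 2 (μ.prod ν)) :
    ∀ᵐ y ∂ν, MemLp (fun x => g (x, y)) 2 μ := by
  filter_upwards [hg.integrable_sq.prod_left_ae, hg.1.prod_swap.prodMk_left] with y h1 h2
  exact (memLp_two_iff_integrable_sq h2).2 h1

lemma starProjection_span_range {ι V : Type*} [Fintype ι] [NormedAddCommGroup V]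
    [InnerProductSpace ℝ V] {e : ι → V} (he : Orthonormal ℝ e) (u : V) :
    (Submodule.span ℝ (range e)).starProjection u = ∑ i, inner ℝ (e i) u • e i := by
  refine (Submodule.eq_starProjection_of_mem_of_inner_eq_zero
    (Submodule.sum_mem _ fun i _ => Submodule.smul_mem _ _ (Submodule.subset_span ⟨i, rfl⟩)) ?_)
  intro w hw
  induction hw using Submodule.span_induction with
  | mem x hx =>
    obtain ⟨j, rfl⟩ := hx
    rw [inner_sub_left, sum_inner, Finset.sum_eq_single j]
    · rw [real_inner_smul_left, real_inner_self_eq_norm_sq, he.1 j, real_inner_comm]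
      ring
    · intro i _ hij
      rw [real_inner_smul_left, he.2 hij, mul_zero]
    · simp
  | zero => simp
  | add x y _ _ hx hy => rw [inner_add_right, hx, hy, add_zero]
  | smul c x _ hx => rw [inner_smul_right, hx, mul_zero]

/-! ### Projected kernels and the nonlocal couplings in coefficients. -/

namespace MFGData
variable {d r : ℕ} (D : MFGData d r)

lemma integral_ζ_mul_ζ (i j : Fin r) :
    ∫ x, D.ζ i x * D.ζ j x ∂spaceMeasure D.Ω = if i = j then 1 else 0 := by
  have h1 : inner ℝ (D.ζL i) (D.ζL j) = if i = j then (1 : ℝ) else 0 :=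
    orthonormal_iff_ite.1 D.orthonormal_ζ i j
  rw [← h1, real_inner_comm, inner_ζL]
  refine integral_congr_ae ?_
  filter_upwards [(D.memLp_ζ i).coeFn_toLp] with x hx
  exact congrArg (· * D.ζ j x) hx.symm

lemma orthonormal_tensor : Orthonormal ℝ fun ij : Fin r × Fin r =>
    (memLp_tensor (D.memLp_ζ ij.1) (D.memLp_ζ ij.2)).toLp
      (fun z : Vec d × Vec d => D.ζ ij.1 z.1 * D.ζ ij.2 z.2) := by
  rw [orthonormal_iff_ite]
  intro ij kl
  rw [← integral_mul_eq_inner]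
  have h1 : ∫ z, (memLp_tensor (D.memLp_ζ kl.1) (D.memLp_ζ kl.2)).toLp
      (fun z : Vec d × Vec d => D.ζ kl.1 z.1 * D.ζ kl.2 z.2) z * (D.ζ ij.1 z.1 * D.ζ ij.2 z.2)
        ∂(spaceMeasure D.Ω).prod (spaceMeasure D.Ω)
      = ∫ z, (D.ζ ij.1 z.1 * D.ζ kl.1 z.1) * (D.ζ ij.2 z.2 * D.ζ kl.2 z.2)
        ∂(spaceMeasure D.Ω).prod (spaceMeasure D.Ω) := by
    refine integral_congr_ae ?_
    filter_upwards [(memLp_tensor (D.memLp_ζ kl.1) (D.memLp_ζ kl.2)).coeFn_toLp] with z hz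
    rw [hz]
    ring
  rw [h1, integral_prod_mul (fun x => D.ζ ij.1 x * D.ζ kl.1 x)
    (fun x => D.ζ ij.2 x * D.ζ kl.2 x), integral_ζ_mul_ζ, integral_ζ_mul_ζ]
  simp only [Prod.ext_iff]
  split_ifs <;> simp_all

/-- The projected kernel in terms of its coefficient matrix. -/
lemma projRR_apply {k : Vec d → Vec d → ℝ}
    (hk : MemLp (fun z : Vec d × Vec d => k z.1 z.2) 2
      ((spaceMeasure D.Ω).prod (spaceMeasure D.Ω))) :
    ∀ᵐ z ∂(spaceMeasure D.Ω).prod (spaceMeasure D.Ω), D.projRR (hk.toLp _) z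
      = ∑ ij : Fin r × Fin r, kernelMatrix D.Ω D.ζ k ij.1 ij.2 * (D.ζ ij.1 z.1 * D.ζ ij.2 z.2) := by
  have hc : ∀ ij : Fin r × Fin r, inner ℝ
      ((memLp_tensor (D.memLp_ζ ij.1) (D.memLp_ζ ij.2)).toLp
        (fun z : Vec d × Vec d => D.ζ ij.1 z.1 * D.ζ ij.2 z.2)) (hk.toLp _)
      = kernelMatrix D.Ω D.ζ k ij.1 ij.2 := by
    intro ij
    rw [← integral_mul_eq_inner, kernelMatrix, Matrix.of_apply]
    refine integral_congr_ae ?_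
    filter_upwards [hk.coeFn_toLp] with z hz
    rw [hz, mul_assoc]
  rw [projRR, starProjection_span_range D.orthonormal_tensor]
  simp only [hc]
  filter_upwards [Lp.coeFn_finsetSum Finset.univ fun ij : Fin r × Fin r =>
      kernelMatrix D.Ω D.ζ k ij.1 ij.2 • (memLp_tensor (D.memLp_ζ ij.1) (D.memLp_ζ ij.2)).toLp
        (fun z : Vec d × Vec d => D.ζ ij.1 z.1 * D.ζ ij.2 z.2),
    ae_all_iff.2 fun ij : Fin r × Fin r => Lp.coeFn_smul (kernelMatrix D.Ω D.ζ k ij.1 ij.2)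
      ((memLp_tensor (D.memLp_ζ ij.1) (D.memLp_ζ ij.2)).toLp
        (fun z : Vec d × Vec d => D.ζ ij.1 z.1 * D.ζ ij.2 z.2)),
    ae_all_iff.2 fun ij : Fin r × Fin r =>
      (memLp_tensor (D.memLp_ζ ij.1) (D.memLp_ζ ij.2)).coeFn_toLp] with z e1 e2 e3
  rw [e1, Finset.sum_apply]
  refine Finset.sum_congr rfl fun ij _ => ?_
  rw [e2, Pi.smul_apply, smul_eq_mul, e3]

/-- The quantifier over u stands inside "for almost every x": the exceptional set depends on the
kernel only, so one null set serves the slices u = ρ(·, t) for all t. -/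
lemma integral_projRR_mul {k : Vec d → Vec d → ℝ}
    (hk : MemLp (fun z : Vec d × Vec d => k z.1 z.2) 2
      ((spaceMeasure D.Ω).prod (spaceMeasure D.Ω))) :
    ∀ᵐ x ∂spaceMeasure D.Ω, ∀ u : Vec d → ℝ,
      (∀ i, Integrable (fun y => u y * D.ζ i y) (spaceMeasure D.Ω)) →
      ∀ c : Vec r, (∀ i, c i = ∫ y, u y * D.ζ i y ∂spaceMeasure D.Ω) →
      ∫ y, D.projRR (hk.toLp _) (x, y) * u y ∂spaceMeasure D.Ω
        = ∑ p, matVec (kernelMatrix D.Ω D.ζ k) c p * D.ζ p x := by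
  filter_upwards [Measure.ae_ae_of_ae_prod (D.projRR_apply hk)] with x hx u hu c hc
  have h1 : ∫ y, D.projRR (hk.toLp _) (x, y) * u y ∂spaceMeasure D.Ω
      = ∫ y, ∑ ij : Fin r × Fin r,
        (kernelMatrix D.Ω D.ζ k ij.1 ij.2 * D.ζ ij.1 x) * (u y * D.ζ ij.2 y)
          ∂spaceMeasure D.Ω := by
    refine integral_congr_ae ?_
    filter_upwards [hx] with y hy
    rw [hy, Finset.sum_mul]
    exact Finset.sum_congr rfl fun ij _ => by ring
  rw [h1, integral_finsetSum _ fun ij _ => (hu ij.2).const_mul _, Fintype.sum_prod_type]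
  refine Finset.sum_congr rfl fun p _ => ?_
  rw [matVec_apply, Finset.sum_mul]
  refine Finset.sum_congr rfl fun q _ => ?_
  rw [integral_const_mul, hc]
  ring

/-- The coefficients of the nonlocal term generated by the density `ρ`. -/
noncomputable def timeCoeff (ρ : Lp ℝ 2 (cylMeasure D.Ω)) : Lp (Vec r) 2 timeMeasure :=
  matTime D.matK (ContinuousLinearMap.adjoint D.sumTime ρ)

/-- The coefficients of the nonlocal term generated by the terminal density `μ`. -/
noncomputable def spaceCoeff (μ : Lp ℝ 2 (spaceMeasure D.Ω)) : Vec r :=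
  matVec D.matS (ContinuousLinearMap.adjoint D.sumSpace μ)

/-- K_r has finite rank, so the integral sees ρ(·, t) only through its moments against the ζ_q, on
which 𝐊 acts. -/
lemma integral_Kr_mul (ρ : Lp ℝ 2 (cylMeasure D.Ω)) :
    ∀ᵐ t ∂timeMeasure, ∀ᵐ x ∂spaceMeasure D.Ω,
      ∫ y, D.Kr (x, y) * ρ (y, t) ∂spaceMeasure D.Ω = D.sumTime (D.timeCoeff ρ) (x, t) := by
  filter_upwards [ae_ae_of_ae_prod_symm (D.sumTime_apply (D.timeCoeff ρ)),
    matTime_apply D.matK (ContinuousLinearMap.adjoint D.sumTime ρ),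
    ae_all_iff.2 (D.adjoint_sumTime_apply ρ),
    ae_all_iff.2 fun i => (D.integrable_mul_ζ (Lp.memLp ρ) i).prod_left_ae] with t h1 h2 h3 h4
  filter_upwards [h1, D.integral_projRR_mul D.memLp_K] with x h5 h6
  rw [h5]
  refine (h6 (fun y => ρ (y, t)) h4 _ h3).trans ?_
  refine Finset.sum_congr rfl fun p _ => ?_
  rw [timeCoeff, h2]
  rfl

lemma integral_Sr_mul (μ : Lp ℝ 2 (spaceMeasure D.Ω)) :
    ∀ᵐ x ∂spaceMeasure D.Ω,
      ∫ y, D.Sr (x, y) * μ y ∂spaceMeasure D.Ω = D.sumSpace (D.spaceCoeff μ) x := by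
  filter_upwards [D.sumSpace_apply (D.spaceCoeff μ), D.integral_projRR_mul D.memLp_S] with x h1 h2
  rw [h1]
  exact h2 (fun y => μ y) (fun i => (Lp.memLp μ).integrable_mul (D.memLp_ζ i)) _
    (D.adjoint_sumSpace_apply μ)

lemma f₁_integral_Kr (ρ : Lp ℝ 2 (cylMeasure D.Ω)) :
    ∀ᵐ t ∂timeMeasure,
      (fun x => (D.memLp_f₁_sumTime (D.timeCoeff ρ)).toLp _ (x, t)) =ᵐ[spaceMeasure D.Ω]
        fun x => D.f₁ t x (∫ y, D.Kr (x, y) * ρ (y, t) ∂spaceMeasure D.Ω) := by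
  filter_upwards [D.integral_Kr_mul ρ,
    ae_ae_of_ae_prod_symm (D.memLp_f₁_sumTime (D.timeCoeff ρ)).coeFn_toLp] with t h1 h2
  filter_upwards [h1, h2] with x h3 h4
  rw [h3, h4]

lemma g₁_integral_Sr (μ : Lp ℝ 2 (spaceMeasure D.Ω)) :
    (D.memLp_g₁_sumSpace (D.spaceCoeff μ)).toLp _ =ᵐ[spaceMeasure D.Ω]
      fun x => D.g₁ x (∫ y, D.Sr (x, y) * μ y ∂spaceMeasure D.Ω) := by
  filter_upwards [D.integral_Sr_mul μ,
    (D.memLp_g₁_sumSpace (D.spaceCoeff μ)).coeFn_toLp] with x h1 h2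
  rw [h1, h2]

lemma gradU₁_timeCoeff (ρ : Lp ℝ 2 (cylMeasure D.Ω)) (i : Fin r) :
    ∀ᵐ t ∂timeMeasure, D.gradU₁ (D.timeCoeff ρ) t i
      = ∫ x, D.f₁ t x (∫ y, D.Kr (x, y) * ρ (y, t) ∂spaceMeasure D.Ω) * D.ζ i x
        ∂spaceMeasure D.Ω := by
  filter_upwards [D.adjoint_sumTime_apply ((D.memLp_f₁_sumTime (D.timeCoeff ρ)).toLp _) i,
    D.f₁_integral_Kr ρ] with t h1 h2
  refine h1.trans (integral_congr_ae ?_)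
  filter_upwards [h2] with x h3
  rw [h3]

lemma gradV₁_spaceCoeff (μ : Lp ℝ 2 (spaceMeasure D.Ω)) (i : Fin r) :
    D.gradV₁ (D.spaceCoeff μ) i
      = ∫ x, D.g₁ x (∫ y, D.Sr (x, y) * μ y ∂spaceMeasure D.Ω) * D.ζ i x
        ∂spaceMeasure D.Ω := by
  refine (D.adjoint_sumSpace_apply _ i).trans (integral_congr_ae ?_)
  filter_upwards [D.g₁_integral_Sr μ] with x h3
  rw [h3]

lemma projR_apply {u : Vec d → ℝ} (hu : MemLp u 2 (spaceMeasure D.Ω)) :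
    ∀ᵐ x ∂spaceMeasure D.Ω,
      D.projR u x = ∑ i, (∫ y, u y * D.ζ i y ∂spaceMeasure D.Ω) * D.ζ i x := by
  have h1 : D.projR u = ∑ i, (∫ y, u y * D.ζ i y ∂spaceMeasure D.Ω) • D.ζL i := by
    rw [projR, dif_pos hu, starProjection_span_range (e := D.ζL) D.orthonormal_ζ]
    refine Finset.sum_congr rfl fun i _ => ?_
    congr 1
    refine (D.inner_ζL _ i).trans (integral_congr_ae ?_)
    filter_upwards [hu.coeFn_toLp] with x hx
    rw [hx]
  rw [h1]
  exact D.sum_smul_ζL_apply _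

lemma projR_f₁ (ρ : Lp ℝ 2 (cylMeasure D.Ω)) :
    ∀ᵐ t ∂timeMeasure, ∀ᵐ x ∂spaceMeasure D.Ω,
      D.projR (fun x' => D.f₁ t x' (∫ y, D.Kr (x', y) * ρ (y, t) ∂spaceMeasure D.Ω)) x
        = ∑ i, D.gradU₁ (D.timeCoeff ρ) t i * D.ζ i x := by
  -- For almost every t the slice is in L²(Ω), so that `projR` is the genuine projection and not its
  -- default value 0.
  filter_upwards [D.f₁_integral_Kr ρ, ae_all_iff.2 (D.gradU₁_timeCoeff ρ),
    ae_memLp_two_slice (Lp.memLp ((D.memLp_f₁_sumTime (D.timeCoeff ρ)).toLp _))] with t h1 h2 h3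
  filter_upwards [D.projR_apply (h3.ae_eq h1)] with x h4
  rw [h4]
  exact Finset.sum_congr rfl fun i _ => by rw [h2]

lemma projR_g₁ (μ : Lp ℝ 2 (spaceMeasure D.Ω)) :
    ∀ᵐ x ∂spaceMeasure D.Ω,
      D.projR (fun x' => D.g₁ x' (∫ y, D.Sr (x', y) * μ y ∂spaceMeasure D.Ω)) x
        = ∑ i, D.gradV₁ (D.spaceCoeff μ) i * D.ζ i x := by
  filter_upwards [D.projR_apply ((Lp.memLp _).ae_eq (D.g₁_integral_Sr μ))] with x h4
  rw [h4]
  exact Finset.sum_congr rfl fun i _ => by rw [gradV₁_spaceCoeff]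

/-! ### The inclusions read as systems. -/

lemma compatibility_iff (s : D.Primal) (q : D.Dual) : D.Compatibility s q ↔
    s.a = D.gradU₁ (D.timeCoeff q.ρ) ∧ s.b = D.gradV₁ (D.spaceCoeff q.ρ1) ∧
      (∀ᵐ w ∂cylMeasure D.Ω, s.α w = D.f₀ w.2 w.1 (q.ρ w)) ∧
      (∀ᵐ x ∂spaceMeasure D.Ω, s.β x = D.g₀ x (q.ρ1 x)) ∧
      D.WeakContinuityEq q.ρ q.m q.ρ0 q.ρ1 := by
  constructor
  · rintro ⟨h1, h2, h3, h4, h5⟩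
    refine ⟨?_, ?_, h3, h4, h5⟩
    · refine Lp.ext ?_
      filter_upwards [ae_all_iff.2 h1, ae_all_iff.2 (D.gradU₁_timeCoeff q.ρ)] with t e1 e2
      ext i
      rw [e1, e2]
    · ext i
      rw [h2, gradV₁_spaceCoeff]
  · rintro ⟨h1, h2, h3, h4, h5⟩
    refine ⟨fun i => ?_, fun i => ?_, h3, h4, h5⟩
    · rw [h1]
      exact D.gradU₁_timeCoeff q.ρ i
    · rw [h2]
      exact D.gradV₁_spaceCoeff q.ρ1 i

/-- By `opCAdj_a` and `opCAdj_b`, the arguments 𝐊u.a and 𝐒u.b in `mem_opM` at u = -C*q are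
`timeCoeff` and `spaceCoeff`; the remaining three components match term by term. -/
lemma opM_iff (s : D.Primal) (q : D.Dual) : -(D.opCAdj q) ∈ D.opM s ↔ D.Compatibility s q := by
  rw [mem_opM, compatibility_iff, opCAdj_a, opCAdj_b, opCAdj_α, opCAdj_β, opCAdj_φ,
    D.subdiff_conj_U₀.2, D.subdiff_conj_V₀.2]
  rfl

/-- The minus sign in the field -∇φ of Cs makes H(-v) equal H(∇φ), and the bulk of Cs plus H(∇φ) is
the left side of the Hamilton–Jacobi equation minus its right side. Complementarity with ρ ≥ 0 is
what produces the vacuum reading. -/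
lemma coefficientSystem_iff (s : D.Primal) (q : D.Dual) :
    D.CoefficientSystem hjVacuum s q ↔ D.IsOptimal (D.opC s) q := by
  have hbulk : ∀ᵐ w ∂cylMeasure D.Ω, (D.opC s).bulk w
      = -(∑ i, s.a w.2 i * D.ζ i w.1) - s.α w - H1.dt s.φ w := by
    change ∀ᵐ w ∂cylMeasure D.Ω, (-(D.sumTime s.a) - s.α - H1.dt s.φ) w = _
    filter_upwards [Lp.coeFn_sub (-(D.sumTime s.a) - s.α) (H1.dt s.φ),
      Lp.coeFn_sub (-(D.sumTime s.a)) s.α, Lp.coeFn_neg (D.sumTime s.a),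
      D.sumTime_apply s.a] with w e1 e2 e3 e4
    rw [e1, Pi.sub_apply, e2, Pi.sub_apply, e3, Pi.neg_apply, e4]
  have hfield : ∀ᵐ w ∂cylMeasure D.Ω, -(D.opC s).field w = H1.grad s.φ w := by
    change ∀ᵐ w ∂cylMeasure D.Ω, -(-H1.grad s.φ) w = _
    filter_upwards [Lp.coeFn_neg (H1.grad s.φ)] with w e1
    rw [e1, Pi.neg_apply, neg_neg]
  have hslice : (D.opC s).slice1 = 0 ↔
      ∀ᵐ x ∂spaceMeasure D.Ω, H1.fin s.φ x = s.β x + ∑ i, s.b i * D.ζ i x := by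
    change -(D.sumSpace s.b) - s.β + H1.fin s.φ = 0 ↔ _
    rw [show -(D.sumSpace s.b) - s.β + H1.fin s.φ = H1.fin s.φ - (s.β + D.sumSpace s.b) by abel,
      sub_eq_zero, Lp.ext_iff]
    have hae := D.sumSpace_apply s.b
    have hadd := Lp.coeFn_add s.β (D.sumSpace s.b)
    constructor <;> intro h <;> filter_upwards [h, hae, hadd] with x e1 e2 e3
    · rw [e1, e3, Pi.add_apply, e2]
    · rw [e1, e3, Pi.add_apply, e2]
  rw [IsOptimal, hslice]
  constructor
  · rintro ⟨h1, h2, h3, h4, h5⟩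
    refine ⟨⟨h1, ?_, ?_, ?_⟩, h4, h5⟩
    · filter_upwards [h2, hbulk, hfield] with w e1 e2 e3
      have := e1.1
      rw [e2, e3]
      rw [hjLhs] at this
      linarith
    · filter_upwards [h2, hbulk, hfield] with w e1 e2 e3 hw
      have := e1.2 hw
      rw [e2, e3]
      rw [hjLhs] at this
      linarith
    · filter_upwards [h3, hfield] with w e1 e3
      rw [e1, e3]
      rfl
  · rintro ⟨⟨h1, h2, h2', h3⟩, h4, h5⟩
    refine ⟨h1, ?_, ?_, h4, h5⟩
    · filter_upwards [h2, h2', hbulk, hfield] with w e1 e1' e2 e3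
      rw [e2, e3] at e1 e1'
      rw [hjLhs]
      exact ⟨by linarith, fun hw => by linarith [e1' hw]⟩
    · filter_upwards [h3, hfield] with w e1 e3
      rw [e1, e3]
      rfl

lemma dualInclusion_iff (s : D.Primal) (q : D.Dual) :
    D.CoefficientSystem hjVacuum s q ∧ D.Compatibility s q ↔ D.DualInclusion s q := by
  rw [DualInclusion, D.opN_eq.2, opM_iff, coefficientSystem_iff]

lemma CoefficientSystem.vacuum {s : D.Primal} {q : D.Dual} (h : D.CoefficientSystem hjExact s q) :
    D.CoefficientSystem hjVacuum s q :=
  ⟨h.nonneg, h.hamiltonJacobi.mono fun _ hw => ⟨le_of_eq hw, fun _ => hw⟩, h.flux, h.initial,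
    h.terminal⟩

lemma CoefficientSystem.exact_of_pos {s : D.Primal} {q : D.Dual}
    (h : D.CoefficientSystem hjVacuum s q) (hpos : ∀ᵐ w ∂cylMeasure D.Ω, 0 < q.ρ w) :
    D.CoefficientSystem hjExact s q :=
  ⟨h.nonneg, by filter_upwards [h.hamiltonJacobi, hpos] with w h1 h2 using h1.2 h2, h.flux,
    h.initial, h.terminal⟩

lemma primalInclusion_iff (s : D.Primal) :
    D.PrimalInclusion s ↔ ∃ q : D.Dual, D.DualInclusion s q := by
  constructor
  · rintro ⟨u, hu, _, ⟨q, hq, rfl⟩, h⟩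
    exact ⟨q, hq, by rwa [← eq_neg_of_add_eq_zero_left h]⟩
  · rintro ⟨q, hq, hu⟩
    exact ⟨_, hu, _, ⟨q, hq, rfl⟩, neg_add_cancel _⟩

lemma opC_ne_zero : D.opC ≠ 0 := by
  intro h
  obtain ⟨x, hx⟩ := D.nonempty_Ω
  obtain ⟨ε, hε, hball⟩ := Metric.isOpen_iff.1 D.isOpen_Ω x hx
  have hs : MeasurableSet (Metric.ball x ε ×ˢ Ioo (0 : ℝ) 1) :=
    measurableSet_ball.prod measurableSet_Ioo
  have hμ : cylMeasure D.Ω (Metric.ball x ε ×ˢ Ioo (0 : ℝ) 1) = volume (Metric.ball x ε) := by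
    rw [Measure.prod_prod, Measure.restrict_apply measurableSet_ball, Measure.restrict_apply
      measurableSet_Ioo, inter_eq_left.2 hball, inter_self, Real.volume_Ioo]
    simp
  have hfin : cylMeasure D.Ω (Metric.ball x ε ×ˢ Ioo (0 : ℝ) 1) ≠ ⊤ := by
    rw [hμ]
    exact measure_ball_lt_top.ne
  -- For a tuple with only α nonzero, the bulk of its image is -α. A ball inside Ω is used since Ω
  -- may have infinite measure.
  have h1 : (D.opC (Primal.mk 0 0 (indicatorConstLp 2 hs hfin (1 : ℝ)) 0 0)).bulk = 0 := by
    rw [h]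
    rfl
  have h2 : -(D.sumTime 0) - indicatorConstLp 2 hs hfin (1 : ℝ) - H1.dt (0 : H1 D.Ω) = 0 := h1
  rw [map_zero, neg_zero, zero_sub, show H1.dt (0 : H1 D.Ω) = 0 from rfl, sub_zero,
    neg_eq_zero] at h2
  have h3 := norm_indicatorConstLp (p := 2) (hs := hs) (hμs := hfin) (c := (1 : ℝ)) (by simp)
    (by simp)
  rw [h2, norm_zero, norm_one, one_mul, measureReal_def, hμ] at h3
  have h4 : 0 < (volume (Metric.ball x ε)).toReal :=
    ENNReal.toReal_pos (Metric.measure_ball_pos _ _ hε).ne' measure_ball_lt_top.ne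
  exact (Real.rpow_pos_of_pos h4 _).ne h3

/-! The equivalence of the projected system and the coefficient system. -/

lemma measurableSet_hj {R : HJReading} (hR : R ∈ ({hjExact, hjVacuum} : Set HJReading)) :
    MeasurableSet {z : ℝ × ℝ × ℝ | R z.1 z.2.1 z.2.2} := by
  have heq : MeasurableSet {z : ℝ × ℝ × ℝ | z.2.1 = z.2.2} :=
    measurableSet_eq_fun (by fun_prop) (by fun_prop)
  rcases hR with rfl | rfl
  · exact heq
  · have h1 : MeasurableSet {z : ℝ × ℝ × ℝ | z.2.1 ≤ z.2.2} :=
      measurableSet_le (by fun_prop) (by fun_prop)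
    have h2 : MeasurableSet {z : ℝ × ℝ × ℝ | 0 < z.1} :=
      measurableSet_lt (by fun_prop) (by fun_prop)
    exact h1.inter (h2.imp heq)

lemma aemeasurable_hjLhs (φ : H1 D.Ω) : AEMeasurable (D.hjLhs φ) (cylMeasure D.Ω) := by
  refine (Lp.aestronglyMeasurable (H1.dt φ)).aemeasurable.neg.add ?_
  exact aemeasurable_caratheodory (f := fun (w : Vec d × ℝ) p => D.H w.2 w.1 p) D.measurable_H
    (D.ae_differentiable_H.mono fun w hw => hw.continuous) (Lp.aestronglyMeasurable (H1.grad φ))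

/-- The term with `projR` is defined slice by slice and carries no joint measurability, so (1) is
stated for a.e. t and then a.e. x. Once it is replaced by the sum of the aᵢ(t) ζᵢ(x), both sides are
jointly measurable and Fubini applies in both directions. -/
lemma hamiltonJacobi_iff {R : HJReading} (hR : R ∈ ({hjExact, hjVacuum} : Set HJReading))
    {φ : H1 D.Ω} {ρ α : Lp ℝ 2 (cylMeasure D.Ω)} {a : Lp (Vec r) 2 timeMeasure}
    (hα : ∀ᵐ w ∂cylMeasure D.Ω, α w = D.f₀ w.2 w.1 (ρ w)) (ha : a = D.gradU₁ (D.timeCoeff ρ)) :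
    (∀ᵐ t ∂timeMeasure, ∀ᵐ x ∂spaceMeasure D.Ω,
      R (ρ (x, t)) (D.hjLhs φ (x, t)) (D.f₀ t x (ρ (x, t)) +
        D.projR (fun x' => D.f₁ t x' (∫ y, D.Kr (x', y) * ρ (y, t) ∂spaceMeasure D.Ω)) x)) ↔
    ∀ᵐ w ∂cylMeasure D.Ω, R (ρ w) (D.hjLhs φ w) (α w + ∑ i, a w.2 i * D.ζ i w.1) := by
  constructor
  · intro h
    have hm : AEMeasurable (fun w => (ρ w, D.hjLhs φ w, α w + D.sumTime a w)) (cylMeasure D.Ω) :=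
      (Lp.aestronglyMeasurable ρ).aemeasurable.prodMk ((D.aemeasurable_hjLhs φ).prodMk
        ((Lp.aestronglyMeasurable α).aemeasurable.add
          (Lp.aestronglyMeasurable (D.sumTime a)).aemeasurable))
    have h1 := ae_prod_of_ae_ae_symm hm (measurableSet_hj hR) (by
      filter_upwards [h, D.projR_f₁ ρ, ae_ae_of_ae_prod_symm hα,
        ae_ae_of_ae_prod_symm (D.sumTime_apply a)] with t h1 h2 h3 h4
      filter_upwards [h1, h2, h3, h4] with x e1 e2 e3 e4
      rw [e2, ← ha] at e1
      simpa only [e3, e4] using e1)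
    filter_upwards [h1, D.sumTime_apply a] with w e1 e2
    rw [← e2]
    exact e1
  · intro h
    filter_upwards [ae_ae_of_ae_prod_symm h, D.projR_f₁ ρ, ae_ae_of_ae_prod_symm hα]
      with t h1 h2 h3
    filter_upwards [h1, h2, h3] with x e1 e2 e3
    rw [e2, ← ha, ← e3]
    exact e1

lemma projectedSystem_iff {R : HJReading} (hR : R ∈ ({hjExact, hjVacuum} : Set HJReading))
    (φ : H1 D.Ω) (ρ : Lp ℝ 2 (cylMeasure D.Ω)) (ρ0 ρ1 : Lp ℝ 2 (spaceMeasure D.Ω)) :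
    D.ProjectedSystem R φ ρ ρ0 ρ1 ↔
      ∃ (a : Lp (Vec r) 2 timeMeasure) (b : Vec r) (α : Lp ℝ 2 (cylMeasure D.Ω))
        (β : Lp ℝ 2 (spaceMeasure D.Ω)) (m : Lp (Vec d) 2 (cylMeasure D.Ω)),
        D.CoefficientSystem R (Primal.mk a b α β φ) (Quad.mk ρ m ρ0 ρ1) ∧
          D.Compatibility (Primal.mk a b α β φ) (Quad.mk ρ m ρ0 ρ1) := by
  have hcont : ∀ m : Lp (Vec d) 2 (cylMeasure D.Ω),
      (∀ᵐ w ∂cylMeasure D.Ω, m w = -(ρ w • D.gradH φ w)) →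
      (D.WeakContinuityEq ρ (fun w => -(ρ w • D.gradH φ w)) ρ0 ρ1 ↔
        D.WeakContinuityEq ρ m ρ0 ρ1) := by
    intro m hm
    refine forall_congr' fun ψ => ?_
    rw [integral_congr_ae]
    filter_upwards [hm] with w hw
    rw [hw]
  constructor
  · rintro ⟨h1, h2, h3, h4, h5, h6, h7⟩
    have hα := h2.coeFn_toLp
    have hm := h3.neg.coeFn_toLp
    -- (1) does not require g₀(x, ρ(x,1)) to be in L², so β is defined by the terminal condition of
    -- (2); it then equals that coupling a.e. by the terminal condition of (1).
    refine ⟨D.gradU₁ (D.timeCoeff ρ), D.gradV₁ (D.spaceCoeff ρ1), h2.toLp _,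
      H1.fin φ - D.sumSpace (D.gradV₁ (D.spaceCoeff ρ1)), h3.neg.toLp _, ?_, ?_⟩
    · refine ⟨h1, (D.hamiltonJacobi_iff hR hα rfl).1 h4, hm, h6, ?_⟩
      filter_upwards [Lp.coeFn_sub (H1.fin φ) (D.sumSpace (D.gradV₁ (D.spaceCoeff ρ1))),
        D.sumSpace_apply (D.gradV₁ (D.spaceCoeff ρ1))] with x e1 e2
      change _ = (H1.fin φ - D.sumSpace (D.gradV₁ (D.spaceCoeff ρ1))) x + _
      rw [e1, Pi.sub_apply, e2]
      exact (sub_add_cancel _ _).symm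
    · rw [compatibility_iff]
      refine ⟨rfl, rfl, hα, ?_, (hcont _ hm).1 h5⟩
      filter_upwards [Lp.coeFn_sub (H1.fin φ) (D.sumSpace (D.gradV₁ (D.spaceCoeff ρ1))),
        D.sumSpace_apply (D.gradV₁ (D.spaceCoeff ρ1)), D.projR_g₁ ρ1, h7] with x e1 e2 e3 e4
      change (H1.fin φ - D.sumSpace (D.gradV₁ (D.spaceCoeff ρ1))) x = _
      rw [e1, Pi.sub_apply, e2, e4, e3]
      exact add_sub_cancel_right _ _
  · rintro ⟨a, b, α, β, m, ⟨h1, h2, h3, h4, h5⟩, hc⟩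
    rw [compatibility_iff] at hc
    obtain ⟨c1, c2, c3, c4, c5⟩ := hc
    -- The L² requirements in (1) are inherited from α and m, which are elements of L² by type.
    refine ⟨h1, (Lp.memLp α).ae_eq c3, ?_, (D.hamiltonJacobi_iff hR c3 c1).2 h2,
      (hcont m h3).2 c5, h4, ?_⟩
    · refine (Lp.memLp m).neg.ae_eq ?_
      filter_upwards [h3] with w hw
      exact neg_eq_iff_eq_neg.2 hw
    · filter_upwards [h5, c4, D.projR_g₁ ρ1] with x e1 e2 e3
      have e2' : β x = D.g₀ x (ρ1 x) := e2
      have c2' : b = D.gradV₁ (D.spaceCoeff ρ1) := c2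
      rw [e3, ← c2', ← e2']
      exact e1

end MFGData
end MFG

open MeasureTheory MFG
theorem mainTheorem1 {d r : ℕ} (D : MFGData d r) :
    (∀ R ∈ ({MFGData.hjExact, MFGData.hjVacuum} : Set MFGData.HJReading),
      ∀ (φ : H1 D.Ω) (ρ : Lp ℝ 2 (cylMeasure D.Ω)) (ρ0 ρ1 : Lp ℝ 2 (spaceMeasure D.Ω)),
        D.ProjectedSystem R φ ρ ρ0 ρ1 ↔
          ∃ (a : Lp (Vec r) 2 timeMeasure) (b : Vec r) (α : Lp ℝ 2 (cylMeasure D.Ω))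
            (β : Lp ℝ 2 (spaceMeasure D.Ω)) (m : Lp (Vec d) 2 (cylMeasure D.Ω)),
            D.CoefficientSystem R (MFGData.Primal.mk a b α β φ) (Quad.mk ρ m ρ0 ρ1) ∧
              D.Compatibility (MFGData.Primal.mk a b α β φ) (Quad.mk ρ m ρ0 ρ1)) ∧
    (∀ (s : D.Primal) (q : D.Dual),
      D.CoefficientSystem MFGData.hjVacuum s q ∧ D.Compatibility s q ↔ D.DualInclusion s q) ∧
    (∀ (s : D.Primal) (q : D.Dual),
      D.CoefficientSystem MFGData.hjExact s q ∧ D.Compatibility s q → D.DualInclusion s q) ∧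
    (∀ (s : D.Primal) (q : D.Dual), (∀ᵐ w ∂cylMeasure D.Ω, 0 < q.ρ w) →
      (D.CoefficientSystem MFGData.hjExact s q ∧ D.Compatibility s q ↔ D.DualInclusion s q)) ∧
    (∀ s : D.Primal, D.PrimalInclusion s ↔ ∃ q : D.Dual, D.DualInclusion s q) ∧
    (IsMaximallyMonotone D.opN ∧ D.opC ≠ 0) ∧
    (IsMaximallyMonotone (fun c => subdiff D.U₁ (MFGData.matTime D.matK c)) →
      IsMaximallyMonotone (fun w => subdiff D.V₁ (MFGData.matVec D.matS w)) →
      IsMaximallyMonotone D.opM) := by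
  refine ⟨fun R hR => D.projectedSystem_iff hR, D.dualInclusion_iff, fun s q h => ?_,
    fun s q hpos => ?_, D.primalInclusion_iff, ⟨D.opN_eq.1, D.opC_ne_zero⟩,
    D.isMaximallyMonotone_opM⟩
  · exact (D.dualInclusion_iff s q).1 ⟨h.1.vacuum, h.2⟩
  · rw [← D.dualInclusion_iff]
    exact and_congr_left fun _ => ⟨fun h => h.vacuum, fun h => h.exact_of_pos D hpos⟩
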